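/- Let $(Q,\mu)$ be a smooth Riemannian manifold of dimension $n$ with Levi-Civita connection $\nabla$, and let $G$ be a (finite-dimensional) Lie group acting smoothly and properly on $Q$ by isometries; the action need not be free. Let $\mathcal H:T^*Q\to\mathbb R$ be smooth and invariant under the cotangent lifted $G$-action. *Frame bundle.* Let $\rho:P\to Q$ be the orthonormal frame bundle; its points over $q$ are the linear isometries $u:\mathbb R^n\to T_qQ$. Put $K=O(n)$ and let $K\times G$ act on $P$ from the left by $(k,g).u=T_qg\circ u\circ k^{-1}$. Let $\omega:TP\to\mathfrak o(n)$ be the connection form induced by $\nabla$, let $\sigma_u(\xi)=u^{-1}(T_u\rho\,\xi)$ be the soldering form, and equip $P$ with the Riemannian metric $\mu^P$ for which every $(\sigma_u,\omega_u):T_uP\to\mathbb R^n\times\mathfrak o(n)$ is an isometry, where $\mathbb R^n$ has its standard inner product and $\mathfrak o(n)$ the inner product $\mathrm{tr}(A^{\top}B)$. For the standard basis $e_1,\dots,e_n$ of $\mathbb R^n$ let $L_i(u)\in T_uP$ be the canonical horizontal fields: $T\rho\,L_i(u)=u(e_i)$ and $\omega(L_i(u))=0$. *Hamiltonian vector fields.*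 $T^*P$ carries its canonical symplectic form $\Omega=-d\theta$, where $\theta$ is the Liouville form, and $X_f$ denotes the Hamiltonian vector field of $f$, $\Omega(X_f,\cdot)=df$. Let $\rho:T^*P\to T^*Q$ also denote the map obtained from $T\rho:TP\to TQ$ by identifying $TP\cong T^*P$ and $TQ\cong T^*Q$ through the metrics $\mu^P$ and $\mu$, let $\rho^*\mathcal H=\mathcal H\circ\rho:T^*P\to\mathbb R$, and let $H^i:T^*P\to\mathbb R$, $H^i(\eta)=\langle\eta,L_i(u)\rangle$ for $\eta\in T_u^*P$. *The operator.* A Stratonovich operator from a manifold $N$ to a manifold $M$ is a family of linear maps $\mathcal S(x,y):T_yN\to T_xM$ $(x\in M,\ y\in N)$ that depends smoothly on $(x,y)$. For $\eta\in T^*P$, $(t,w)\in\mathbb R\times\mathbb R^n$ and $(t',w')\in T_{(t,w)}(\mathbb R\times\mathbb R^n)$ put $$\mathcal S(\eta,t,w,t',w')=X_{\rho^*\mathcal H}(\eta)\,t'+\sum_{i=1}^n X_{H^i}(\eta)\,\langle e_i,w'\rangle .$$ Let $K\times G$ act on $T^*P$ by the cotangent lift of its action on $P$, and on $\mathbb R\times\mathbb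 R^n$ by $(k,g).(t,w)=(t,kw)$. Let $J_G:T^*P\to\mathfrak g^*$, $\langle J_G(\eta),X\rangle=\langle\eta,X_P(u)\rangle$ for $\eta\in T^*_uP$, be the standard momentum map of the $G$-action, $X_P$ being the fundamental vector field of $X\in\mathfrak g$. For a subset $Z$ of a manifold $M$ we say that a Stratonovich operator $\mathcal S$ from $N$ to $M$ *restricts to a Stratonovich operator from $N$ to $Z$* if for all $x\in Z$ and $y\in N$ each vector in the image of $\mathcal S(x,y)$ is tangent to $Z$, i.e. is the velocity at time $0$ of a smooth curve $\mathbb R\to M$ that lies in $Z$ and starts at $x$; and if, moreover, whenever $Z$ is the image of an injectively immersed initial submanifold $\iota:Z'\to M$ (initial: a curve $c$ in $Z'$ is smooth as soon as $\iota\circ c$ is), there is a Stratonovich operator $\mathcal S'$ from $N$ to $Z'$ with $T\iota\,\mathcal S'(p,y)=\mathcal S(\iota(p),y)$ for all $p\in Z'$, $y\in N$. Then: 1. $\mathcal S$ is a Stratonovich operator from $\mathbb R\times\mathbb R^n$ to $T^*P$ and it is $K\times G$-equivariant: for $h\in K\times G$, $\eta\in T^*P$, $y\in\mathbb R\times\mathbb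 R^n$ and $y'\in T_y(\mathbb R\times\mathbb R^n)$, $$\mathcal S(h.\eta,\;h.y,\;Th.y')=Th.\mathcal S(\eta,y,y').$$ 2. Let $\mathcal O\subset\mathfrak g^*$ be a coadjoint orbit. Then $\mathcal S$ restricts to a Stratonovich operator from $\mathbb R\times\mathbb R^n$ to $J_G^{-1}(\mathcal O)$. Moreover, also when the $G$-action is not free, the same holds for each smooth stratum of $J_G^{-1}(\mathcal O)$: for every $\zeta\in J_G^{-1}(\mathcal O)$, $\mathcal S$ restricts to a Stratonovich operator from $\mathbb R\times\mathbb R^n$ to the set of all $\eta\in J_G^{-1}(\mathcal O)$ whose isotropy group $G_\eta$ is conjugate in $G$ to $G_\zeta$, and to the connected component of this set that contains $\zeta$. -/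

import Mathlib

open scoped Manifold ContDiff
open Bundle
noncomputable section
namespace FrameBundle
set_option linter.unusedSectionVars false

section Cayley
variable {A : Type*} [NormedRing A] [NormedAlgebra ℝ A] [CompleteSpace A] [StarRing A]

/-- The Cayley transform `a ↦ (a - 1) (1 + a)⁻¹`, used as a chart of the orthogonal group with
values in the skew-symmetric endomorphisms. -/
def cayley (a : A) : A := (a - 1) * Ring.inverse (1 + a)

/-- The inverse Cayley transform. -/
def cayleyInv (x : A) : A := (1 + x) * Ring.inverse (1 - x)

lemma isUnit_two_smul {a : A} (h : IsUnit a) : IsUnit ((2 : ℝ) • a) := by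
  obtain ⟨u, rfl⟩ := h
  exact ((Units.mk0 (2 : ℝ) two_ne_zero) • u).isUnit

lemma cayleyInv_mem_unitary {x : A} (hx : star x = -x) (hp : IsUnit (1 + x))
    (hm : IsUnit (1 - x)) : cayleyInv x ∈ unitary A := by
  obtain ⟨p, hp⟩ := hp
  obtain ⟨m, hm⟩ := hm
  have hsp : star p = m := Units.ext (by simp [hp, hm, hx, sub_eq_add_neg])
  have hsm : star m = p := by rw [← hsp, star_star]
  have hc : p * m = m * p := Units.ext (by simp only [Units.val_mul, hp, hm]; noncomm_ring)
  have hi : m⁻¹ * p = p * m⁻¹ := by rw [inv_mul_eq_iff_eq_mul, ← mul_assoc, ← hc]; group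
  have : cayleyInv x = ((p * m⁻¹ : Aˣ) : A) := by
    rw [cayleyInv, ← hp, ← hm, Ring.inverse_unit]; rfl
  rw [this, Unitary.mem_iff, ← Units.coe_star, ← Units.val_mul, ← Units.val_mul, star_mul,
    star_inv, hsp, hsm]
  constructor
  · rw [Units.val_eq_one, mul_assoc, ← mul_assoc m, ← hc]; group
  · rw [Units.val_eq_one, ← hi]; group

lemma one_add_cayleyInv {x : A} (hm : IsUnit (1 - x)) :
    1 + cayleyInv x = (2 : ℝ) • Ring.inverse (1 - x) := by
  obtain ⟨m, hm⟩ := hm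
  rw [cayleyInv, ← hm, Ring.inverse_unit]
  have : (1 : A) = m * (m⁻¹ : Aˣ) := by simp
  nth_rw 1 [this]
  rw [hm, ← add_mul, two_smul, sub_add_add_cancel, add_mul, one_mul]

lemma isUnit_one_add_cayleyInv {x : A} (hm : IsUnit (1 - x)) : IsUnit (1 + cayleyInv x) := by
  rw [one_add_cayleyInv hm]
  exact isUnit_two_smul hm.ringInverse

lemma cayley_cayleyInv {x : A} (hm : IsUnit (1 - x)) : cayley (cayleyInv x) = x := by
  obtain ⟨u, hu⟩ := isUnit_one_add_cayleyInv hm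
  have key : cayleyInv x - 1 = x * (1 + cayleyInv x) := by
    rw [one_add_cayleyInv hm]
    obtain ⟨m, hm⟩ := hm
    rw [cayleyInv, ← hm, Ring.inverse_unit]
    have : (1 : A) = m * (m⁻¹ : Aˣ) := by simp
    nth_rw 2 [this]
    rw [hm, ← sub_mul, two_smul, mul_add, ← add_mul]
    congr 1
    abel
  rw [cayley, key, mul_assoc, ← hu, Ring.inverse_unit, Units.mul_inv, mul_one]

lemma star_cayley {a : A} (ha : a ∈ unitary A) (hu : IsUnit (1 + a)) :
    star (cayley a) = -cayley a := by
  obtain ⟨u, hu⟩ := hu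
  obtain ⟨h1, h2⟩ := Unitary.mem_iff.1 ha
  have hsu : star (u : A) = star a * u := by
    rw [hu, star_add, star_one, mul_add, mul_one, h1, add_comm]
  have h3 : star ((u⁻¹ : Aˣ) : A) = (u⁻¹ : Aˣ) * a := by
    have : star (u : A) * star ((u⁻¹ : Aˣ) : A) = 1 := by rw [← star_mul]; simp
    rw [hsu] at this
    calc star ((u⁻¹ : Aˣ) : A)
        = ((u⁻¹ : Aˣ) : A) * (a * star a) * (u * star ((u⁻¹ : Aˣ) : A)) := by
          rw [h2, mul_one, ← mul_assoc]; simp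
      _ = (u⁻¹ : Aˣ) * a * (star a * u * star ((u⁻¹ : Aˣ) : A)) := by simp only [mul_assoc]
      _ = _ := by rw [this, mul_one]
  have hc : (u : A) * (a - 1) = (a - 1) * u := by rw [hu]; noncomm_ring
  rw [cayley, ← hu, Ring.inverse_unit, star_mul, h3, star_sub, star_one, mul_assoc, mul_sub, h2,
    mul_one, ← neg_sub a 1, mul_neg, neg_inj, Units.inv_mul_eq_iff_eq_mul, ← mul_assoc, hc,
    mul_assoc, Units.mul_inv, mul_one]

lemma cayleyInv_cayley {a : A} (hu : IsUnit (1 + a)) : cayleyInv (cayley a) = a := by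
  obtain ⟨u, hu⟩ := hu
  have h1 : (1 : A) = u * (u⁻¹ : Aˣ) := by simp
  have hcoe : cayley a = (a - 1) * (u⁻¹ : Aˣ) := by rw [cayley, ← hu, Ring.inverse_unit]
  have hp : 1 + cayley a = a * ((2 : ℝ) • ((u⁻¹ : Aˣ) : A)) := by
    rw [hcoe]; nth_rw 1 [h1]
    rw [← add_mul, hu, two_smul, mul_add, ← add_mul]
    congr 1; abel
  have hm : 1 - cayley a = (2 : ℝ) • ((u⁻¹ : Aˣ) : A) := by
    rw [hcoe]; nth_rw 1 [h1]
    have h2 : 1 + a - (a - 1) = 1 + 1 := by abel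
    rw [← sub_mul, hu, two_smul, h2, add_mul, one_mul]
  rw [cayleyInv, hp, hm, mul_assoc, Ring.mul_inverse_cancel _ (isUnit_two_smul (u⁻¹).isUnit),
    mul_one]

lemma contDiffAt_cayleyInv {x : A} (hm : IsUnit (1 - x)) : ContDiffAt ℝ ∞ (cayleyInv (A := A)) x := by
  obtain ⟨m, hm⟩ := hm
  refine (contDiff_const.add contDiff_id).contDiffAt.mul
    (ContDiffAt.comp (g := Ring.inverse) (f := fun x : A => 1 - x) x ?_ (contDiff_const.sub contDiff_id).contDiffAt)
  rw [← hm]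
  exact contDiffAt_ringInverse ℝ m

lemma contDiffAt_cayley {x : A} (hm : IsUnit (1 + x)) : ContDiffAt ℝ ∞ (cayley (A := A)) x := by
  obtain ⟨m, hm⟩ := hm
  refine (contDiff_id.sub contDiff_const).contDiffAt.mul
    (ContDiffAt.comp (g := Ring.inverse) (f := fun x : A => 1 + x) x ?_ (contDiff_const.add contDiff_id).contDiffAt)
  rw [← hm]
  exact contDiffAt_ringInverse ℝ m

/-- The skew-adjoint part `(a - a*) / 2`. -/
def skewPartAux [StarModule ℝ A] : A →ₗ[ℝ] skewAdjoint.submodule ℝ A where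
  toFun a := ⟨(2⁻¹ : ℝ) • (a - star a), by
    change _ ∈ skewAdjoint A
    rw [skewAdjoint.mem_iff, star_smul, star_sub, star_star, star_trivial, ← smul_neg, neg_sub]⟩
  map_add' a b := Subtype.ext (by
    change (2⁻¹ : ℝ) • (a + b - star (a + b)) = (2⁻¹ : ℝ) • (a - star a) + (2⁻¹ : ℝ) • (b - star b)
    rw [star_add, ← smul_add, add_sub_add_comm])
  map_smul' c a := Subtype.ext (by
    change (2⁻¹ : ℝ) • (c • a - star (c • a)) = c • ((2⁻¹ : ℝ) • (a - star a))
    rw [star_smul, star_trivial, ← smul_sub, smul_comm])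

lemma coe_skewPartAux [StarModule ℝ A] {a : A} (ha : star a = -a) :
    (skewPartAux a : A) = a := by
  change (2⁻¹ : ℝ) • (a - star a) = a
  rw [ha, sub_neg_eq_add, ← two_smul ℝ a, smul_smul, inv_mul_cancel₀ two_ne_zero, one_smul]

lemma isUnit_one_add_one : IsUnit (1 + 1 : A) := by
  have : (1 + 1 : A) = (2 : ℝ) • 1 := by rw [two_smul]
  rw [this]
  exact isUnit_two_smul isUnit_one

end Cayley

/-- `ℝⁿ` with its standard inner product. -/
abbrev Eucl (n : ℕ) : Type := EuclideanSpace ℝ (Fin n)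

/-- The linear endomorphisms of `ℝⁿ`. -/
abbrev EndEucl (n : ℕ) : Type := Eucl n →L[ℝ] Eucl n

/-- The Lie algebra `𝔬(n)` of the orthogonal group: the skew-symmetric endomorphisms of `ℝⁿ`. -/
def SkewEnd (n : ℕ) : Submodule ℝ (EndEucl n) := skewAdjoint.submodule ℝ (EndEucl n)

variable {n : ℕ}

instance : AddCommGroup (SkewEnd n) := (SkewEnd n).addCommGroup
instance : Module ℝ (SkewEnd n) := (SkewEnd n).module
instance : NormedAddCommGroup (SkewEnd n) := (SkewEnd n).normedAddCommGroup
instance : NormedSpace ℝ (SkewEnd n) := (SkewEnd n).normedSpace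

/-- The orthogonal group `K = O(n)`, as the group of linear isometries of `ℝⁿ`; the product is
composition. -/
abbrev OrthGroup (n : ℕ) : Type := Eucl n ≃ₗᵢ[ℝ] Eucl n

lemma mem_skewEnd {X : EndEucl n} : X ∈ SkewEnd n ↔ star X = -X := skewAdjoint.mem_iff

/-- The endomorphism of `ℝⁿ` underlying an orthogonal transformation. -/
def OrthGroup.endo (k : OrthGroup n) : EndEucl n := (k.toContinuousLinearEquiv : EndEucl n)

/-- A unitary element of the algebra `End(ℝⁿ)`, as an orthogonal transformation. -/
def OrthGroup.ofUnitary (a : EndEucl n) (ha : a ∈ unitary (EndEucl n)) : OrthGroup n :=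
  Unitary.linearIsometryEquiv ⟨a, ha⟩

lemma OrthGroup.endo_mem (k : OrthGroup n) : k.endo ∈ unitary (EndEucl n) :=
  (Unitary.linearIsometryEquiv.symm k).2

lemma OrthGroup.endo_ofUnitary (a : EndEucl n) (ha : a ∈ unitary (EndEucl n)) :
   (OrthGroup.ofUnitary a ha).endo = a := rfl

lemma OrthGroup.endo_injective : Function.Injective (OrthGroup.endo (n := n)) := by
  intro k l h
  ext v : 1
  exact congrArg (fun f : EndEucl n => f v) h

lemma OrthGroup.endo_mul (k l : OrthGroup n) : (k * l).endo = k.endo * l.endo := rfl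

lemma isUnit_one_sub (X : SkewEnd n) : IsUnit (1 - (X : EndEucl n)) := by
  have h : star (X : EndEucl n) = -X := mem_skewEnd.1 X.2
  have hX : ∀ v, inner ℝ (X.1 v) v = 0 := by
    intro v
    have h1 : inner ℝ (star X.1 v) v = inner ℝ v (X.1 v) := by
      rw [ContinuousLinearMap.star_eq_adjoint, ContinuousLinearMap.adjoint_inner_left]
    rw [h, neg_apply, inner_neg_left, real_inner_comm v] at h1
    rw [real_inner_comm]
    linarith
  have hinj : Function.Injective (1 - X.1 : EndEucl n) := by
    rw [injective_iff_map_eq_zero]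
    intro v hv
    have h2 : v = X.1 v := by
      simpa [sub_eq_zero] using hv
    have := hX v
    rw [← h2] at this
    exact inner_self_eq_zero.1 this
  refine ContinuousLinearMap.isUnit_iff_bijective.2 ⟨hinj, ?_⟩
  exact LinearMap.surjective_of_injective
    (f := ((1 - X.1 : EndEucl n) : Eucl n →ₗ[ℝ] Eucl n)) hinj

lemma isUnit_one_add (X : SkewEnd n) : IsUnit (1 + (X : EndEucl n)) := by
  simpa using isUnit_one_sub (-X)

/-- The skew-symmetric part of an endomorphism of `ℝⁿ`. -/
def skewPart : EndEucl n →ₗ[ℝ] SkewEnd n := skewPartAux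

lemma skewPart_eq {a : EndEucl n} (ha : star a = -a) : skewPart a = ⟨a, mem_skewEnd.2 ha⟩ :=
  Subtype.ext (coe_skewPartAux ha)

lemma contDiff_skewPart : ContDiff ℝ ∞ (skewPart (n := n)) :=
  (LinearMap.toContinuousLinearMap (skewPart (n := n))).contDiff

/-- `X ↦ (1 + X)(1 - X)⁻¹`, from skew-symmetric to orthogonal endomorphisms. -/
def orthOfSkew (X : SkewEnd n) : OrthGroup n :=
  OrthGroup.ofUnitary (cayleyInv (X : EndEucl n))
    (cayleyInv_mem_unitary (mem_skewEnd.1 X.2) (isUnit_one_add X) (isUnit_one_sub X))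

/-- The Cayley transform of an orthogonal transformation `k`. It is skew-symmetric, and inverse to
`orthOfSkew`, when `1 + k` is invertible. -/
def skewOfOrth (k : OrthGroup n) : SkewEnd n := skewPart (cayley k.endo)

lemma skewOfOrth_orthOfSkew (X : SkewEnd n) : skewOfOrth (orthOfSkew X) = X := by
  have h : cayley (orthOfSkew X).endo = X := cayley_cayleyInv (isUnit_one_sub X)
  rw [skewOfOrth, h, skewPart_eq (mem_skewEnd.1 X.2)]

lemma orthOfSkew_skewOfOrth {k : OrthGroup n} (hk : IsUnit (1 + k.endo)) :
    orthOfSkew (skewOfOrth k) = k := by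
  apply OrthGroup.endo_injective
  rw [orthOfSkew, OrthGroup.endo_ofUnitary, skewOfOrth, skewPart_eq (star_cayley k.endo_mem hk),
    cayleyInv_cayley hk]


section Frames

variable {Q : Type*} [TopologicalSpace Q] [ChartedSpace (Eucl n) Q]

variable (n Q) in
/-- The total space `P` of the orthonormal frame bundle of the Riemannian manifold `Q`: a point is a
linear isometry `u : ℝⁿ → T_q Q`. -/
structure OrthoFrame [RiemannianBundle (fun q : Q => TangentSpace 𝓘(ℝ, Eucl n) q)] where
  pt : Q
  iso : Eucl n ≃ₗᵢ[ℝ] TangentSpace 𝓘(ℝ, Eucl n) pt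

variable [RiemannianBundle (fun q : Q => TangentSpace 𝓘(ℝ, Eucl n) q)]

lemma OrthoFrame.ext_of {u v : OrthoFrame n Q} (h : u.pt = v.pt)
    (h' : ∀ x, (u.iso x : Eucl n) = (v.iso x : Eucl n)) : u = v := by
  obtain ⟨q, u⟩ := u
  obtain ⟨q', v⟩ := v
  obtain rfl : q = q' := h
  congr 1
  ext x : 1
  exact h' x

instance (q : Q) : FiniteDimensional ℝ (TangentSpace 𝓘(ℝ, Eucl n) q) :=
  inferInstanceAs (FiniteDimensional ℝ (Eucl n))

lemma finrank_tangentSpace (q : Q) :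
    Module.finrank ℝ (TangentSpace 𝓘(ℝ, Eucl n) q) = Fintype.card (Fin n) := by
  have : Module.finrank ℝ (Eucl n) = Fintype.card (Fin n) := by simp
  exact this

variable [IsManifold 𝓘(ℝ, Eucl n) ∞ Q]

/-- The coordinate frame of `TQ` over the domain of the preferred chart at `q₀`. -/
def coordFrame (q₀ : Q) (i : Fin n) (q : Q) : TangentSpace 𝓘(ℝ, Eucl n) q :=
  (trivializationAt (Eucl n) (TangentSpace 𝓘(ℝ, Eucl n)) q₀).localFrame
    (EuclideanSpace.basisFun (Fin n) ℝ).toBasis i q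

/-- The orthonormal frame over the domain of the preferred chart at `q₀` obtained from the coordinate
frame by the Gram-Schmidt process. -/
def localFrame (q₀ q : Q) : OrthonormalBasis (Fin n) ℝ (TangentSpace 𝓘(ℝ, Eucl n) q) :=
  InnerProductSpace.gramSchmidtOrthonormalBasis (finrank_tangentSpace q)
    (fun i => coordFrame q₀ i q)

variable [IsContMDiffRiemannianBundle 𝓘(ℝ, Eucl n) ∞ (Eucl n)
  (fun q : Q => TangentSpace 𝓘(ℝ, Eucl n) q)]

lemma contMDiffOn_coordFrame (q₀ : Q) (i : Fin n) :
    ContMDiffOn 𝓘(ℝ, Eucl n) (𝓘(ℝ, Eucl n).prod 𝓘(ℝ, Eucl n)) ∞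
      (fun q => (⟨q, coordFrame q₀ i q⟩ : TangentBundle 𝓘(ℝ, Eucl n) Q))
      (chartAt (Eucl n) q₀).source :=
  (trivializationAt (Eucl n) (TangentSpace 𝓘(ℝ, Eucl n)) q₀).contMDiffOn_localFrame_baseSet ∞ _ i

lemma linearIndependent_coordFrame (q₀ : Q) {q : Q} (hq : q ∈ (chartAt (Eucl n) q₀).source) :
    LinearIndependent ℝ (fun i : Fin n => coordFrame q₀ i q) :=
  ((trivializationAt (Eucl n) (TangentSpace 𝓘(ℝ, Eucl n)) q₀).isLocalFrameOn_localFrame_baseSet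
    𝓘(ℝ, Eucl n) 1 (EuclideanSpace.basisFun (Fin n) ℝ).toBasis).linearIndependent hq

lemma contMDiffOn_gramSchmidt (q₀ : Q) (i : Fin n) :
    ContMDiffOn 𝓘(ℝ, Eucl n) (𝓘(ℝ, Eucl n).prod 𝓘(ℝ, Eucl n)) ∞
      (fun q => (⟨q, InnerProductSpace.gramSchmidt ℝ (fun j => coordFrame q₀ j q) i⟩ :
        TangentBundle 𝓘(ℝ, Eucl n) Q))
      (chartAt (Eucl n) q₀).source := by
  induction i using WellFoundedLT.induction with
  | ind i ih =>
  have h : ∀ q : Q, InnerProductSpace.gramSchmidt ℝ (fun j => coordFrame q₀ j q) i =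
      coordFrame q₀ i q - ∑ j ∈ Finset.Iio i,
        (inner ℝ (InnerProductSpace.gramSchmidt ℝ (fun j => coordFrame q₀ j q) j)
          (coordFrame q₀ i q) /
          inner ℝ (InnerProductSpace.gramSchmidt ℝ (fun j => coordFrame q₀ j q) j)
            (InnerProductSpace.gramSchmidt ℝ (fun j => coordFrame q₀ j q) j)) •
          InnerProductSpace.gramSchmidt ℝ (fun j => coordFrame q₀ j q) j := by
    intro q
    rw [eq_sub_iff_add_eq]
    conv_rhs => rw [InnerProductSpace.gramSchmidt_def'' ℝ (fun j => coordFrame q₀ j q) i]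
    simp
  simp_rw [h]
  refine ContMDiffOn.sub_section (contMDiffOn_coordFrame q₀ i) (ContMDiffOn.sum_section ?_)
  intro j hj
  have hj' := ih j (Finset.mem_Iio.1 hj)
  refine ContMDiffOn.smul_section ?_ hj'
  refine ContMDiffOn.div₀ (hj'.inner_bundle (contMDiffOn_coordFrame q₀ i)) (hj'.inner_bundle hj') ?_
  intro q hq
  rw [inner_self_ne_zero]
  exact InnerProductSpace.gramSchmidt_ne_zero j (linearIndependent_coordFrame q₀ hq)

lemma contMDiffOn_localFrame (q₀ : Q) (i : Fin n) :
    ContMDiffOn 𝓘(ℝ, Eucl n) (𝓘(ℝ, Eucl n).prod 𝓘(ℝ, Eucl n)) ∞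
      (fun q => (⟨q, localFrame q₀ q i⟩ : TangentBundle 𝓘(ℝ, Eucl n) Q))
      (chartAt (Eucl n) q₀).source := by
  have hg := contMDiffOn_gramSchmidt q₀ i
  have h0 : ∀ q ∈ (chartAt (Eucl n) q₀).source,
      InnerProductSpace.gramSchmidt ℝ (fun j => coordFrame q₀ j q) i ≠ 0 := fun q hq =>
    InnerProductSpace.gramSchmidt_ne_zero i (linearIndependent_coordFrame q₀ hq)
  have hn : ContMDiffOn 𝓘(ℝ, Eucl n) 𝓘(ℝ, ℝ) ∞
      (fun q => (√(inner ℝ (InnerProductSpace.gramSchmidt ℝ (fun j => coordFrame q₀ j q) i)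
        (InnerProductSpace.gramSchmidt ℝ (fun j => coordFrame q₀ j q) i)))⁻¹)
      (chartAt (Eucl n) q₀).source := by
    intro q hq
    have hpos : inner ℝ (InnerProductSpace.gramSchmidt ℝ (fun j => coordFrame q₀ j q) i)
        (InnerProductSpace.gramSchmidt ℝ (fun j => coordFrame q₀ j q) i) ≠ 0 :=
      inner_self_ne_zero.2 (h0 q hq)
    have hc : ContDiffAt ℝ ∞ (fun x : ℝ => (√x)⁻¹)
        (inner ℝ (InnerProductSpace.gramSchmidt ℝ (fun j => coordFrame q₀ j q) i)
        (InnerProductSpace.gramSchmidt ℝ (fun j => coordFrame q₀ j q) i)) :=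
      (Real.contDiffAt_sqrt hpos).inv (Real.sqrt_ne_zero'.2 (lt_of_le_of_ne real_inner_self_nonneg hpos.symm))
    exact ContMDiffAt.comp_contMDiffWithinAt (g := fun x : ℝ => (√x)⁻¹) q hc.contMDiffAt (hg.inner_bundle hg q hq)
  refine (hn.smul_section hg).congr ?_
  intro q hq
  have hne : InnerProductSpace.gramSchmidtNormed ℝ (fun j => coordFrame q₀ j q) i ≠ 0 :=
    smul_ne_zero (inv_ne_zero (by simpa using h0 q hq)) (h0 q hq)
  congr 1
  rw [localFrame, InnerProductSpace.gramSchmidtOrthonormalBasis_apply _ hne,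
    InnerProductSpace.gramSchmidtNormed]
  simp only [Pi.smul_apply', real_inner_self_eq_norm_sq, norm_nonneg, Real.sqrt_sq]
  rfl

/-- The matrix of the frame `u` with respect to the local frame around `q₀`. -/
def OrthoFrame.coords (q₀ : Q) (u : OrthoFrame n Q) : OrthGroup n :=
  u.iso.trans (localFrame q₀ u.pt).repr

/-- The orthogonal matrix relating the orthonormal local frames around `q₀` and `q₁`. -/
def frameChange (q₀ q₁ q : Q) : OrthGroup n :=
  (localFrame q₀ q).repr.symm.trans (localFrame q₁ q).repr

/-- The chart of `P` around `u₀`: the chart of `Q` at the base point of `u₀`, together with the Cayley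
transform of the matrix `A₀⁻¹ A`, where `A` and `A₀` are the matrices of `u` and `u₀` with respect to
the smooth orthonormal local frame around the base point of `u₀`. -/
def orthoChart (u₀ : OrthoFrame n Q) : PartialEquiv (OrthoFrame n Q) (Eucl n × SkewEnd n) where
  toFun u := (chartAt (Eucl n) u₀.pt u.pt,
    skewOfOrth ((u₀.coords u₀.pt)⁻¹ * u.coords u₀.pt))
  invFun y := ⟨(chartAt (Eucl n) u₀.pt).symm y.1,
    (u₀.coords u₀.pt * orthOfSkew y.2).trans
      (localFrame u₀.pt ((chartAt (Eucl n) u₀.pt).symm y.1)).repr.symm⟩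
  source := {u | u.pt ∈ (chartAt (Eucl n) u₀.pt).source ∧
    IsUnit (1 + ((u₀.coords u₀.pt)⁻¹ * u.coords u₀.pt).endo)}
  target := (chartAt (Eucl n) u₀.pt).target ×ˢ Set.univ
  map_source' u hu := ⟨(chartAt (Eucl n) u₀.pt).map_source hu.1, trivial⟩
  map_target' := by
    rintro ⟨x, X⟩ ⟨hx, -⟩
    refine ⟨(chartAt (Eucl n) u₀.pt).map_target hx, ?_⟩
    have : (u₀.coords u₀.pt)⁻¹ * OrthoFrame.coords u₀.pt ⟨(chartAt (Eucl n) u₀.pt).symm x,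
        (u₀.coords u₀.pt * orthOfSkew X).trans
          (localFrame u₀.pt ((chartAt (Eucl n) u₀.pt).symm x)).repr.symm⟩ = orthOfSkew X := by
      rw [inv_mul_eq_iff_eq_mul]
      ext v : 1
      simp [OrthoFrame.coords]
    rw [this]
    exact isUnit_one_add_cayleyInv (isUnit_one_sub X)
  left_inv' := by
    rintro u ⟨hu, hu'⟩
    dsimp only
    rw [orthOfSkew_skewOfOrth hu', mul_inv_cancel_left]
    refine OrthoFrame.ext_of ((chartAt (Eucl n) u₀.pt).left_inv hu) fun x => ?_
    have := (chartAt (Eucl n) u₀.pt).left_inv hu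
    dsimp only
    rw [this]
    simp [OrthoFrame.coords]
  right_inv' := by
    rintro ⟨x, X⟩ ⟨hx, -⟩
    have : (u₀.coords u₀.pt)⁻¹ * OrthoFrame.coords u₀.pt ⟨(chartAt (Eucl n) u₀.pt).symm x,
        (u₀.coords u₀.pt * orthOfSkew X).trans
          (localFrame u₀.pt ((chartAt (Eucl n) u₀.pt).symm x)).repr.symm⟩ = orthOfSkew X := by
      rw [inv_mul_eq_iff_eq_mul]
      ext v : 1
      simp [OrthoFrame.coords]
    dsimp only
    rw [this, skewOfOrth_orthOfSkew, (chartAt (Eucl n) u₀.pt).right_inv hx]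

lemma contDiffOn_frameChange (q₀ q₁ : Q) :
    ContDiffOn ℝ ∞ (fun x : Eucl n => (frameChange (n := n) q₀ q₁ ((chartAt (Eucl n) q₀).symm x)).endo)
      ((chartAt (Eucl n) q₀).symm.trans (chartAt (Eucl n) q₁)).source := by
  rw [contDiffOn_clm_apply]
  intro v
  rw [contDiffOn_euclidean]
  intro i
  have h : ∀ q : Q, (frameChange (n := n) q₀ q₁ q).endo v i =
      ∑ j, v j * inner ℝ (localFrame q₁ q i) (localFrame q₀ q j) := by
    intro q
    change (localFrame q₁ q).repr ((localFrame q₀ q).repr.symm v) i = _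
    rw [OrthonormalBasis.repr_apply_apply, ← OrthonormalBasis.sum_repr_symm, inner_sum]
    simp [real_inner_smul_right]
  simp_rw [h]
  refine ContDiffOn.sum fun j _ => contDiffOn_const.mul ?_
  rw [← contMDiffOn_iff_contDiffOn]
  have hi : ContMDiffOn 𝓘(ℝ, Eucl n) 𝓘(ℝ, ℝ) ∞
      (fun q => inner ℝ (localFrame q₁ q i) (localFrame q₀ q j))
      ((chartAt (Eucl n) q₀).source ∩ (chartAt (Eucl n) q₁).source) :=
    ((contMDiffOn_localFrame q₁ i).mono Set.inter_subset_right).inner_bundle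
      ((contMDiffOn_localFrame q₀ j).mono Set.inter_subset_left)
  refine hi.comp ((contMDiffOn_chart_symm (I := 𝓘(ℝ, Eucl n)) (x := q₀)).mono ?_) ?_
  · intro x hx
    simp only [mfld_simps] at hx
    exact hx.1
  · intro x hx
    simp only [mfld_simps] at hx ⊢
    exact ⟨(chartAt (Eucl n) q₀).map_target hx.1, hx.2⟩

/-- The matrix appearing in the chart transitions. -/
lemma coords_symm (u₀ u₁ : OrthoFrame n Q) (y : Eucl n × SkewEnd n) :
    (u₁.coords u₁.pt)⁻¹ * ((orthoChart u₀).symm y).coords u₁.pt =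
      (u₁.coords u₁.pt)⁻¹ * (frameChange u₀.pt u₁.pt ((chartAt (Eucl n) u₀.pt).symm y.1) *
        (u₀.coords u₀.pt * orthOfSkew y.2)) := rfl

/-- The matrix appearing in the chart transitions, as an endomorphism. -/
def transMatrix (u₀ u₁ : OrthoFrame n Q) (y : Eucl n × SkewEnd n) : EndEucl n :=
  ((u₁.coords u₁.pt)⁻¹ * ((orthoChart u₀).symm y).coords u₁.pt).endo

lemma contDiffOn_transMatrix (u₀ u₁ : OrthoFrame n Q) :
    ContDiffOn ℝ ∞ (transMatrix u₀ u₁)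
      (((chartAt (Eucl n) u₀.pt).symm.trans (chartAt (Eucl n) u₁.pt)).source ×ˢ Set.univ) := by
  have h1 : ContDiffOn ℝ ∞ (fun y : Eucl n × SkewEnd n =>
      (frameChange u₀.pt u₁.pt ((chartAt (Eucl n) u₀.pt).symm y.1)).endo)
      (((chartAt (Eucl n) u₀.pt).symm.trans (chartAt (Eucl n) u₁.pt)).source ×ˢ Set.univ) :=
    (contDiffOn_frameChange u₀.pt u₁.pt).comp contDiff_fst.contDiffOn fun y hy => hy.1
  have h2 : ContDiff ℝ ∞ (fun y : Eucl n × SkewEnd n => (orthOfSkew y.2).endo) := by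
    rw [contDiff_iff_contDiffAt]
    intro y
    exact (contDiffAt_cayleyInv (isUnit_one_sub y.2)).comp y
      (f := fun y : Eucl n × SkewEnd n => (y.2 : EndEucl n))
      ((SkewEnd n).subtypeL.contDiff.comp contDiff_snd).contDiffAt
  exact (contDiffOn_const (c := ((u₁.coords u₁.pt)⁻¹).endo)).mul
    (h1.mul ((contDiffOn_const (c := (u₀.coords u₀.pt).endo)).mul h2.contDiffOn))

lemma orthoChart_trans_source (u₀ u₁ : OrthoFrame n Q) :
    ((orthoChart u₀).symm.trans (orthoChart u₁)).source =
      (((chartAt (Eucl n) u₀.pt).symm.trans (chartAt (Eucl n) u₁.pt)).source ×ˢ Set.univ) ∩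
        transMatrix u₀ u₁ ⁻¹' {a | IsUnit (1 + a)} := by
  ext ⟨x, X⟩
  simp only [mfld_simps, PartialEquiv.trans_source, PartialEquiv.symm_source]
  change ((x ∈ (chartAt (Eucl n) u₀.pt).target ∧ True) ∧
    ((chartAt (Eucl n) u₀.pt).symm x ∈ (chartAt (Eucl n) u₁.pt).source ∧
      IsUnit (1 + transMatrix u₀ u₁ (x, X)))) ↔ _
  tauto

lemma isOpen_orthoChart_trans_source (u₀ u₁ : OrthoFrame n Q) :
    IsOpen ((orthoChart u₀).symm.trans (orthoChart u₁)).source := by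
  rw [orthoChart_trans_source]
  refine (contDiffOn_transMatrix u₀ u₁).continuousOn.isOpen_inter_preimage
    (((chartAt (Eucl n) u₀.pt).symm.trans (chartAt (Eucl n) u₁.pt)).open_source.prod isOpen_univ) ?_
  exact Units.isOpen.preimage (continuous_const.add continuous_id)

lemma contDiffOn_orthoChart_trans (u₀ u₁ : OrthoFrame n Q) :
    ContDiffOn ℝ ∞ ((orthoChart u₀).symm.trans (orthoChart u₁))
      ((orthoChart u₀).symm.trans (orthoChart u₁)).source := by
  have hb : ContDiffOn ℝ ∞ ((chartAt (Eucl n) u₀.pt).symm.trans (chartAt (Eucl n) u₁.pt))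
      ((chartAt (Eucl n) u₀.pt).symm.trans (chartAt (Eucl n) u₁.pt)).source :=
    (contMDiffOn_of_mem_contDiffGroupoid (HasGroupoid.compatible (G := contDiffGroupoid ∞ 𝓘(ℝ, Eucl n)) (chart_mem_atlas _ _) (chart_mem_atlas _ _))).contDiffOn
  rw [orthoChart_trans_source]
  refine ContDiffOn.prodMk (f := fun y : Eucl n × SkewEnd n => ((chartAt (Eucl n) u₀.pt).symm.trans (chartAt (Eucl n) u₁.pt)) y.1)
    (g := fun y => skewPart (cayley (transMatrix u₀ u₁ y))) ?_ ?_
  · exact hb.comp contDiff_fst.contDiffOn fun y hy => hy.1.1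
  · refine contDiff_skewPart.comp_contDiffOn ?_
    intro y hy
    exact (contDiffAt_cayley hy.2).comp_contDiffWithinAt y
      (((contDiffOn_transMatrix u₀ u₁) y hy.1).mono Set.inter_subset_left)

variable (n Q) in
/-- The charts `orthoChart` are an atlas of the orthonormal frame bundle. -/
def orthoFrameCore : ChartedSpaceCore (Eucl n × SkewEnd n) (OrthoFrame n Q) where
  atlas := Set.range orthoChart
  chartAt := orthoChart
  mem_chart_source u := by
    refine ⟨mem_chart_source _ _, ?_⟩
    rw [inv_mul_cancel]
    exact isUnit_one_add_one (A := EndEucl n)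
  chart_mem_atlas u := ⟨u, rfl⟩
  open_source := by
    rintro _ _ ⟨u₀, rfl⟩ ⟨u₁, rfl⟩
    exact isOpen_orthoChart_trans_source u₀ u₁
  continuousOn_toFun := by
    rintro _ _ ⟨u₀, rfl⟩ ⟨u₁, rfl⟩
    exact (contDiffOn_orthoChart_trans u₀ u₁).continuousOn

instance : TopologicalSpace (OrthoFrame n Q) := (orthoFrameCore n Q).toTopologicalSpace

/-- The manifold structure of `P` given by the charts `orthoChart`. -/
@[reducible]
def orthoFrameChartedSpace : ChartedSpace (Eucl n × SkewEnd n) (OrthoFrame n Q) := (orthoFrameCore n Q).toChartedSpace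

lemma isManifold_orthoFrame :
    @IsManifold ℝ _ _ _ _ _ _ 𝓘(ℝ, Eucl n × SkewEnd n) ∞ (OrthoFrame n Q) _ orthoFrameChartedSpace := by
  let : ChartedSpace (Eucl n × SkewEnd n) (OrthoFrame n Q) := orthoFrameChartedSpace
  refine isManifold_of_contDiffOn _ _ _ ?_
  rintro e e' he he'
  obtain ⟨_, ⟨⟨_, rfl⟩, _, ⟨⟨u₀, rfl⟩, rfl⟩, he⟩⟩ := he
  obtain ⟨_, ⟨⟨_, rfl⟩, _, ⟨⟨u₁, rfl⟩, rfl⟩, he'⟩⟩ := he'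
  obtain rfl := he
  obtain rfl := he'
  have := contDiffOn_orthoChart_trans u₀ u₁
  simp only [mfld_simps]
  exact this

variable (n) in
/-- The vector space `ℝⁿ × 𝔬(n)` on which `P` is modelled. -/
def FrameModel : Type := Eucl n × SkewEnd n

instance : NormedAddCommGroup (FrameModel n) :=
  inferInstanceAs (NormedAddCommGroup (Eucl n × SkewEnd n))

instance : NormedSpace ℝ (FrameModel n) := inferInstanceAs (NormedSpace ℝ (Eucl n × SkewEnd n))

instance : FiniteDimensional ℝ (FrameModel n) :=
  inferInstanceAs (FiniteDimensional ℝ (Eucl n × SkewEnd n))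

instance : ChartedSpace (FrameModel n) (OrthoFrame n Q) := orthoFrameChartedSpace

instance : IsManifold 𝓘(ℝ, FrameModel n) ∞ (OrthoFrame n Q) :=
  isManifold_orthoFrame

instance : IsManifold 𝓘(ℝ, FrameModel n) 1 (OrthoFrame n Q) :=
  IsManifold.of_le (n := ∞) (by norm_cast)

end Frames

section CotangentBundle

variable {E : Type*} [NormedAddCommGroup E] [NormedSpace ℝ E] {H : Type*} [TopologicalSpace H]
  (I : ModelWithCorners ℝ E H) {M : Type*} [TopologicalSpace M] [ChartedSpace H M]

variable (M) in
/-- The cotangent bundle `T*M`, as Mathlib's bundle of continuous linear maps `T_x M → ℝ`. -/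
abbrev Cotangent [IsManifold I 1 M] : Type _ :=
  TotalSpace (E →L[ℝ] ℝ) (fun x : M => TangentSpace I x →L[ℝ] Trivial M ℝ x)

/-- The exterior derivative `dα` of a 1-form `α` on a manifold without boundary, computed at `x` in
the preferred chart at `x`: if `A y` is the coordinate expression of `α`, then
`dα(v, w) = (D_v A)(w) - (D_w A)(v)`. -/
def extDerivOneForm (α : ∀ x : M, TangentSpace I x →L[ℝ] ℝ) (x : M) :
    TangentSpace I x →L[ℝ] TangentSpace I x →L[ℝ] ℝ :=
  let A : E →L[ℝ] E →L[ℝ] ℝ := fderiv ℝ (fun y : E => (α ((extChartAt I x).symm y)).comp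
    (mfderiv 𝓘(ℝ, E) I (extChartAt I x).symm y)) (extChartAt I x x)
  let D : E →L[ℝ] E := mfderiv I 𝓘(ℝ, E) (extChartAt I x) x
  let B : E →L[ℝ] E →L[ℝ] ℝ := (A - A.flip).bilinearComp D D
  B

variable [IsManifold I 1 M]

/-- The canonical 1-form on `T*M`: `θ_η(ξ) = η(Tτ ξ)`, with `τ : T*M → M` the projection. -/
def liouvilleForm (η : Cotangent I M) :
    TangentSpace (I.prod 𝓘(ℝ, E →L[ℝ] ℝ)) η →L[ℝ] ℝ :=
  ContinuousLinearMap.comp (η.2 : TangentSpace I η.1 →L[ℝ] ℝ)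
    (mfderiv (I.prod 𝓘(ℝ, E →L[ℝ] ℝ)) I (fun η : Cotangent I M => η.1) η)

/-- The canonical symplectic form `Ω = -dθ` of `T*M`. -/
def symplecticForm (η : Cotangent I M) :
    TangentSpace (I.prod 𝓘(ℝ, E →L[ℝ] ℝ)) η →L[ℝ]
      TangentSpace (I.prod 𝓘(ℝ, E →L[ℝ] ℝ)) η →L[ℝ] ℝ :=
  -extDerivOneForm (I.prod 𝓘(ℝ, E →L[ℝ] ℝ)) (liouvilleForm I) η

/-- The Hamiltonian vector field `X_f` on `T*M`, determined by `Ω(X_f, ·) = df`. -/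
def hamiltonianVectorField (f : Cotangent I M → ℝ) (η : Cotangent I M) :
    TangentSpace (I.prod 𝓘(ℝ, E →L[ℝ] ℝ)) η :=
  (symplecticForm I η).inverse (mfderiv (I.prod 𝓘(ℝ, E →L[ℝ] ℝ)) 𝓘(ℝ, ℝ) f η)

/-- The cotangent lift of a diffeomorphism `f : M → M`: `η ∈ T*_x M` is mapped to
`η ∘ (T_x f)⁻¹ ∈ T*_{f x} M`. -/
def cotangentLift (f : M → M) (η : Cotangent I M) : Cotangent I M :=
  ⟨f η.1, ContinuousLinearMap.comp (η.2 : TangentSpace I η.1 →L[ℝ] ℝ) (mfderiv I I f η.1).inverse⟩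

end CotangentBundle

section Stratonovich

universe u
variable {E : Type*} [NormedAddCommGroup E] [NormedSpace ℝ E] {H : Type*} [TopologicalSpace H]
  (I : ModelWithCorners ℝ E H) {M : Type u} [TopologicalSpace M] [ChartedSpace H M]
  {E' : Type*} [NormedAddCommGroup E'] [NormedSpace ℝ E'] {H' : Type*} [TopologicalSpace H']
  (J : ModelWithCorners ℝ E' H') {N : Type*} [TopologicalSpace N] [ChartedSpace H' N]

/-- A family of linear maps `S(x, y) : T_y N → T_x M` is a Stratonovich operator if
`M × TN → TM`, `(x, y, v) ↦ S(x, y) v` is smooth, that is, if `S` is a smooth section of the bundle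
`T*N ⊗ TM` over `N × M`. -/
def IsStratonovichOperator [IsManifold I 1 M] [IsManifold J 1 N]
    (S : ∀ (x : M) (y : N), TangentSpace J y →L[ℝ] TangentSpace I x) : Prop :=
  ContMDiff (I.prod J.tangent) I.tangent ∞
    (fun p : M × TangentBundle J N => (⟨p.1, S p.1 p.2.1 p.2.2⟩ : TangentBundle I M))

/-- `ξ ∈ T_x M` is tangent to the subset `Z` of `M`: it is the velocity at time `0` of a smooth curve
of `M` that stays in `Z`. -/
def IsTangentTo (Z : Set M) (x : M) (ξ : TangentSpace I x) : Prop :=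
  ∃ c : ℝ → M, ContMDiff 𝓘(ℝ, ℝ) I ∞ c ∧ (∀ t, c t ∈ Z) ∧
    (⟨c 0, mfderiv 𝓘(ℝ, ℝ) I c 0 (1 : ℝ)⟩ : TangentBundle I M) = ⟨x, ξ⟩

/-- The Stratonovich operator `S` from `N` to `M` restricts to a Stratonovich operator from `N` to the
subset `Z` of `M`: for `x` in `Z` all values of `S(x, y)` are tangent to `Z`; and if `Z` is made a
smooth manifold by an injective immersion `ι : Z' → M` with image `Z` which is an initial submanifold
(a curve in `Z'` is smooth as soon as it is smooth as a curve in `M`; embedded submanifolds have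
this property, and so do the orbits and level sets considered here, which need not be embedded), then
`S` is induced from a Stratonovich operator `S'` from `N` to `Z'`: `Tι (S'(p, y) v) = S(ι p, y) v`. -/
def RestrictsTo [IsManifold J 1 N]
    (S : ∀ (x : M) (y : N), TangentSpace J y →L[ℝ] TangentSpace I x) (Z : Set M) : Prop :=
  (∀ x ∈ Z, ∀ (y : N) (v : TangentSpace J y), IsTangentTo I Z x (S x y v)) ∧
  ∀ (k : ℕ) (Z' : Type u) [TopologicalSpace Z'] [ChartedSpace (Eucl k) Z']
    [IsManifold 𝓘(ℝ, Eucl k) ∞ Z'] (ι : Z' → M),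
    Manifold.IsImmersion 𝓘(ℝ, Eucl k) I ∞ ι → Function.Injective ι → Set.range ι = Z →
    (∀ c : ℝ → Z', ContMDiff 𝓘(ℝ, ℝ) I ∞ (ι ∘ c) → ContMDiff 𝓘(ℝ, ℝ) 𝓘(ℝ, Eucl k) ∞ c) →
    ∃ S' : ∀ (p : Z') (y : N), TangentSpace J y →L[ℝ] TangentSpace 𝓘(ℝ, Eucl k) p,
      IsStratonovichOperator 𝓘(ℝ, Eucl k) J S' ∧
      ∀ (p : Z') (y : N) (v : TangentSpace J y),
        mfderiv 𝓘(ℝ, Eucl k) I ι p (S' p y v) = S (ι p) y v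

end Stratonovich

section Frames

variable {Q : Type*} [TopologicalSpace Q] [ChartedSpace (Eucl n) Q]
  [IsManifold 𝓘(ℝ, Eucl n) ∞ Q]
  [RiemannianBundle (fun q : Q => TangentSpace 𝓘(ℝ, Eucl n) q)]
  [IsContMDiffRiemannianBundle 𝓘(ℝ, Eucl n) ∞ (Eucl n)
    (fun q : Q => TangentSpace 𝓘(ℝ, Eucl n) q)]

variable (n Q) in
/-- The cotangent bundle `T*P` of the orthonormal frame bundle. -/
abbrev CotangentFrame : Type _ := Cotangent 𝓘(ℝ, FrameModel n) (OrthoFrame n Q)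

variable (n) in
/-- The model with corners (without boundary) of the manifold `T*P`. -/
abbrev CotangentFrameModel :
    ModelWithCorners ℝ (FrameModel n × (FrameModel n →L[ℝ] ℝ))
      (ModelProd (FrameModel n) (FrameModel n →L[ℝ] ℝ)) :=
  𝓘(ℝ, FrameModel n).prod 𝓘(ℝ, FrameModel n →L[ℝ] ℝ)

instance : IsManifold (CotangentFrameModel n) ∞ (CotangentFrame n Q) := inferInstance

instance : IsManifold (CotangentFrameModel n) 1 (CotangentFrame n Q) :=
  IsManifold.of_le (n := ∞) (by norm_cast)

instance : IsContMDiffRiemannianBundle 𝓘(ℝ, Eucl n) 1 (Eucl n)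
    (TangentSpace 𝓘(ℝ, Eucl n) : Q → Type _) :=
  IsContMDiffRiemannianBundle.of_le (n := ∞) (by norm_cast)

/-- The Levi-Civita connection of `Q`: the smooth, torsion-free and metric covariant derivative. -/
structure IsLeviCivita (cov : CovariantDerivative 𝓘(ℝ, Eucl n) (Eucl n)
    (TangentSpace 𝓘(ℝ, Eucl n) : Q → Type _)) : Prop where
  smooth : CovariantDerivative.ContMDiffCovariantDerivative cov ∞
  torsion_eq_zero : cov.torsion = 0
  metric : cov.IsMetricCompatible

/-- The derivative `T_u ρ` of the bundle projection `ρ : P → Q`. -/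
def projDeriv (u : OrthoFrame n Q) :
    TangentSpace 𝓘(ℝ, FrameModel n) u →L[ℝ] TangentSpace 𝓘(ℝ, Eucl n) u.pt :=
  mfderiv 𝓘(ℝ, FrameModel n) 𝓘(ℝ, Eucl n) (fun w : OrthoFrame n Q => w.pt) u

/-- The soldering form `σ_u(ξ) = u⁻¹ (T_u ρ ξ)` on `P`. -/
def soldering (u : OrthoFrame n Q) : TangentSpace 𝓘(ℝ, FrameModel n) u →L[ℝ] Eucl n :=
  (u.iso.symm.toContinuousLinearEquiv : TangentSpace 𝓘(ℝ, Eucl n) u.pt →L[ℝ] Eucl n).comp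
    (projDeriv u)

variable (cov : CovariantDerivative 𝓘(ℝ, Eucl n) (Eucl n)
  (TangentSpace 𝓘(ℝ, Eucl n) : Q → Type _))

/-- The value `ω_u(ξ) a` of the connection form on a vector `a` of `ℝⁿ`. In terms of the covariant
derivative, `ω_u(ξ) a = u⁻¹ (∇_{Tρ ξ} X) - d(w ↦ w⁻¹ X(ρ w))_u(ξ)` for every vector field `X` on `Q`
with `X(ρ u) = u a`; the right-hand side does not depend on the choice of `X`. In other words, if
`c` is a curve of frames with velocity `ξ`, then `ω_u(ξ) a = u⁻¹ (∇/dt)(c a)`, so `ω` vanishes exactly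
on the velocities of parallel frames and maps the fundamental vector field of `A ∈ 𝔬(n)` to `A`. -/
def connectionFormApply (u : OrthoFrame n Q) (a : Eucl n) :
    TangentSpace 𝓘(ℝ, FrameModel n) u →L[ℝ] Eucl n :=
  let X : ∀ q : Q, TangentSpace 𝓘(ℝ, Eucl n) q := FiberBundle.extend (Eucl n) (u.iso a)
  let d : TangentSpace 𝓘(ℝ, FrameModel n) u →L[ℝ] Eucl n :=
    mfderiv 𝓘(ℝ, FrameModel n) 𝓘(ℝ, Eucl n) (fun w : OrthoFrame n Q => w.iso.symm (X w.pt)) u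
  (u.iso.symm.toContinuousLinearEquiv : TangentSpace 𝓘(ℝ, Eucl n) u.pt →L[ℝ] Eucl n).comp
    ((cov X u.pt).comp (projDeriv u)) - d

/-- The connection form `ω` on `P` induced by the covariant derivative. It is written with values in
all endomorphisms of `ℝⁿ`; its values are skew-symmetric when the covariant derivative is metric. -/
def connectionForm (u : OrthoFrame n Q) :
    TangentSpace 𝓘(ℝ, FrameModel n) u →L[ℝ] EndEucl n :=
  ∑ j : Fin n, (ContinuousLinearMap.smulRightL ℝ (Eucl n) (Eucl n)
    (innerSL ℝ (EuclideanSpace.single j (1 : ℝ)))).comp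
      (connectionFormApply cov u (EuclideanSpace.single j 1))

/-- The Riemannian metric of `P` for which `(σ, ω) : T_u P → ℝⁿ × 𝔬(n)` is an isometry:
`μ(ξ, ζ) = ⟨σ ξ, σ ζ⟩ + tr((ω ξ)ᵀ ω ζ)`, where the trace is written as `∑ⱼ ⟨(ω ξ) eⱼ, (ω ζ) eⱼ⟩`. -/
def frameMetric (u : OrthoFrame n Q) :
    TangentSpace 𝓘(ℝ, FrameModel n) u →L[ℝ] TangentSpace 𝓘(ℝ, FrameModel n) u →L[ℝ] ℝ :=
  let s : FrameModel n →L[ℝ] Eucl n := soldering u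
  let c (j : Fin n) : FrameModel n →L[ℝ] Eucl n :=
    (ContinuousLinearMap.apply ℝ (Eucl n) (EuclideanSpace.single j (1 : ℝ))).comp
      (connectionForm cov u)
  let B : FrameModel n →L[ℝ] FrameModel n →L[ℝ] ℝ :=
    (innerSL ℝ).bilinearComp s s + ∑ j : Fin n, (innerSL ℝ).bilinearComp (c j) (c j)
  B

/-- The map `ρ : T*P → T*Q` given by `Tρ : TP → TQ` and the identifications `TP ≅ T*P` and
`TQ ≅ T*Q` by the metrics. -/
def cotangentProj (η : CotangentFrame n Q) : Cotangent 𝓘(ℝ, Eucl n) Q :=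
  ⟨η.1.pt, innerSL ℝ (projDeriv η.1 ((frameMetric cov η.1).inverse η.2))⟩

/-- The horizontal lift of `v ∈ T_q Q` to `u` over `q`: the unique `ξ ∈ T_u P` with `Tρ ξ = v` and
`ω ξ = 0`. -/
def horizontalLift (u : OrthoFrame n Q) (v : TangentSpace 𝓘(ℝ, Eucl n) u.pt) :
    TangentSpace 𝓘(ℝ, FrameModel n) u :=
  Classical.epsilon fun ξ => projDeriv u ξ = v ∧ connectionForm cov u ξ = 0

/-- The canonical horizontal vector field `L_i(u) = hl_u(u e_i)` on `P`. -/
def canonicalHorizontal (i : Fin n) (u : OrthoFrame n Q) : TangentSpace 𝓘(ℝ, FrameModel n) u :=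
  horizontalLift cov u (u.iso (EuclideanSpace.single i 1))

/-- The momentum function `H^i(η) = η(L_i(u))`, for `η ∈ T*_u P`, of the canonical horizontal field
`L_i`. -/
def momentum (i : Fin n) (η : CotangentFrame n Q) : ℝ := η.2 (canonicalHorizontal cov i η.1)

/-- The manifold `N = ℝ × ℝⁿ`. -/
abbrev NoiseSpace (n : ℕ) : Type := ℝ × Eucl n

/-- The Stratonovich operator from `ℝ × ℝⁿ` to `T*P`,
`S(η, (t, w)) (t', w') = X_{Ham ∘ ρ}(η) t' + ∑ᵢ X_{H^i}(η) ⟨eᵢ, w'⟩`. -/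
def stratonovichOp (Ham : Cotangent 𝓘(ℝ, Eucl n) Q → ℝ) (η : CotangentFrame n Q)
    (y : NoiseSpace n) :
    TangentSpace 𝓘(ℝ, NoiseSpace n) y →L[ℝ] TangentSpace (CotangentFrameModel n) η :=
  (ContinuousLinearMap.fst ℝ ℝ (Eucl n)).smulRight
      (hamiltonianVectorField 𝓘(ℝ, FrameModel n) (fun ζ => Ham (cotangentProj cov ζ)) η) +
    ∑ i : Fin n,
      ((innerSL ℝ (EuclideanSpace.single i (1 : ℝ))).comp
        (ContinuousLinearMap.snd ℝ ℝ (Eucl n))).smulRight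
          (hamiltonianVectorField 𝓘(ℝ, FrameModel n) (momentum cov i) η)

section Actions

variable {EG : Type*} [NormedAddCommGroup EG] [NormedSpace ℝ EG]
  {G : Type*} [TopologicalSpace G] [ChartedSpace EG G] [Group G] [MulAction G Q]

variable (n Q G) in
/-- `G` acts on the Riemannian manifold `Q` by isometries. -/
def ActsByIsometries : Prop :=
  ∀ (g : G) (q : Q) (v w : TangentSpace 𝓘(ℝ, Eucl n) q),
    inner ℝ (mfderiv 𝓘(ℝ, Eucl n) 𝓘(ℝ, Eucl n) (fun x : Q => g • x) q v)
      (mfderiv 𝓘(ℝ, Eucl n) 𝓘(ℝ, Eucl n) (fun x : Q => g • x) q w) = inner ℝ v w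

/-- The tangent map of the action of `g`, as a linear isometry `T_q Q → T_{g q} Q`. -/
def tangentIsometry (hG : ActsByIsometries n Q G) (g : G) (q : Q) :
    TangentSpace 𝓘(ℝ, Eucl n) q ≃ₗᵢ[ℝ] TangentSpace 𝓘(ℝ, Eucl n) (g • q) :=
  ((mfderiv 𝓘(ℝ, Eucl n) 𝓘(ℝ, Eucl n) (fun x : Q => g • x) q).toLinearMap.isometryOfInner
    (hG g q)).toLinearIsometryEquiv
      ((finrank_tangentSpace (n := n) q).trans (finrank_tangentSpace (n := n) (g • q)).symm)

/-- The left action of `K × G` on `P`: `(k, g) u = Tg ∘ u ∘ k⁻¹`. -/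
def frameAct (hG : ActsByIsometries n Q G) (h : OrthGroup n × G) (u : OrthoFrame n Q) :
    OrthoFrame n Q :=
  ⟨h.2 • u.pt, (h.1⁻¹.trans u.iso).trans (tangentIsometry hG h.2 u.pt)⟩

/-- The action of `K × G` on `T*P` by cotangent lifts. -/
def cotangentAct (hG : ActsByIsometries n Q G) (h : OrthGroup n × G) :
    CotangentFrame n Q → CotangentFrame n Q :=
  cotangentLift 𝓘(ℝ, FrameModel n) (frameAct hG h)

/-- The action of `K × G` on `ℝ × ℝⁿ`: `(k, g) (t, w) = (t, k w)`. -/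
def noiseAct (h : OrthGroup n × G) (y : NoiseSpace n) : NoiseSpace n := (y.1, h.1 y.2)

/-- The momentum map `J_G : T*P → 𝔤*` of the `G`-action: `J_G(η)(X) = η(X_P(u))` for `η ∈ T*_u P`, with
`X_P` the fundamental vector field of `X`. -/
def momentumMap (hG : ActsByIsometries n Q G) (η : CotangentFrame n Q) :
    GroupLieAlgebra 𝓘(ℝ, EG) G →L[ℝ] ℝ :=
  let a : EG →L[ℝ] FrameModel n :=
    mfderiv 𝓘(ℝ, EG) 𝓘(ℝ, FrameModel n) (fun g : G => frameAct hG (1, g) η.1) 1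
  let b : FrameModel n →L[ℝ] ℝ := η.2
  b.comp a

variable (EG) in
/-- The coadjoint action of `G` on `𝔤*`: `g l = l ∘ Ad_{g⁻¹}`. -/
def coadjoint (g : G) (l : GroupLieAlgebra 𝓘(ℝ, EG) G →L[ℝ] ℝ) :
    GroupLieAlgebra 𝓘(ℝ, EG) G →L[ℝ] ℝ :=
  let Ad : EG →L[ℝ] EG := mfderiv 𝓘(ℝ, EG) 𝓘(ℝ, EG) (fun x : G => g⁻¹ * x * g) 1
  let b : EG →L[ℝ] ℝ := l
  b.comp Ad

variable (EG) in
/-- The coadjoint orbit through `l`. -/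
def coadjointOrbit (l : GroupLieAlgebra 𝓘(ℝ, EG) G →L[ℝ] ℝ) :
    Set (GroupLieAlgebra 𝓘(ℝ, EG) G →L[ℝ] ℝ) :=
  Set.range fun g : G => coadjoint EG g l

/-- The subset `J_G⁻¹(O)` of `T*P`. -/
def momentumLevel (hG : ActsByIsometries n Q G) (O : Set (GroupLieAlgebra 𝓘(ℝ, EG) G →L[ℝ] ℝ)) :
    Set (CotangentFrame n Q) :=
  {η | momentumMap hG η ∈ O}

/-- The isotropy groups of `η` and `ζ` in `G` are conjugate. -/
def SameOrbitType (hG : ActsByIsometries n Q G) (η ζ : CotangentFrame n Q) : Prop :=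
  ∃ a : G, ∀ g : G, cotangentAct hG (1, g) η = η ↔ cotangentAct hG (1, a * g * a⁻¹) ζ = ζ

/-- The points of `J_G⁻¹(O)` with the same orbit type as `ζ`. The strata of `J_G⁻¹(O)` are the connected
components of these sets. -/
def orbitTypePiece (hG : ActsByIsometries n Q G) (O : Set (GroupLieAlgebra 𝓘(ℝ, EG) G →L[ℝ] ℝ))
    (ζ : CotangentFrame n Q) : Set (CotangentFrame n Q) :=
  {η | η ∈ momentumLevel hG O ∧ SameOrbitType hG η ζ}

end Actions
end Frames

end FrameBundle

end

open FrameBundle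

/-!
Write `ρ : P → Q` for the frame bundle. By linearity of `f ↦ X_f`, the vector field
`η ↦ S(η, y) v` is the Hamiltonian vector field of `f_v = v.1 · (Ham ∘ ρ) + ⟨(H¹, …, Hⁿ), v.2⟩`
(`noiseHamiltonian`, `hamiltonianVectorField_noiseHamiltonian`). Everything is read off from this
family of functions.

*Smoothness.* In charts of `T*P` that come from charts of `P`, the form `Ω` is the constant form
of `E × E*`, so `X_f` is smooth when `f` is. What has to be shown is that the `L_i` are smooth. In
a chart, `L_i` is determined by its projection `u e_i` and by the derivative along it of the
matrix of the frame with respect to a local orthonormal frame `X₁, …, Xₙ` of `Q`; as `ω(L_i) = 0`,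
the entries of the latter are `⟨∇_{u e_i} X_j, u e_k⟩` (`mfderiv_coords_apply`,
`contMDiff_horizontalLift_iso`). The map `T*P → T*Q` is `η ↦ ∑ Hⁱ(η) ⟨u e_i, ·⟩`
(`cotangentProj_eq`), hence smooth as well.

*Equivariance.* The failure of an isometry to preserve `∇`, paired with a third vector field, is
symmetric in its first two arguments because `∇` has no torsion, and skew in the last two because
`∇` is metric; so it vanishes (`mfderiv_smul_covariantDerivative`). Hence `ω` transforms by
conjugation, horizontal lifts are mapped to horizontal lifts, `(H¹, …, Hⁿ)` is rotated by `k`, and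
`f_{h v} (h η) = f_v η`. Cotangent lifts preserve the Liouville form, hence `Ω`, and so they carry
`X_{f_v}` to `X_{f_{h v}}` (`hamiltonianVectorField_cotangentAct`).

*Restriction.* The group `G` acts trivially on the noise, so each `f_v` is `G`-invariant. Let `γ`
be an integral curve of `X_{f_v}`. By Noether's theorem, `d⟨J_G, X⟩ = Ω(X_{T*P}, ·)`, which
annihilates `X_{f_v}`, so `J_G` is constant along `γ`. An element of `G` that fixes one point of
`γ` maps `γ` to an integral curve through this point, so it fixes `γ` pointwise, and the isotropy
group is constant along `γ`. Thus `γ` stays in `J_G⁻¹(𝒪)`, in its piece of a given orbit type,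
and, being connected, in the connected component of its starting point. Replacing the time of `γ`
by a bounded function of time gives the curve on all of `ℝ` that the definition of tangency asks
for (`isTangentTo_of_invariant`). Finally, on an initial submanifold `ι : Z' → T*P`, the curves
that exhibit tangency lift to smooth curves in `Z'`, so `S(ι p, y)` takes values in the image of
`Tι`; the lifted operator is `T r ∘ S` for a smooth local left inverse `r` of `ι`, hence smooth
(`restrictsTo_of_isTangentTo`).
-/

noncomputable section

open scoped Topology

namespace FrameBundle

set_option linter.unusedSectionVars false

/-! ### The canonical form of `E × E*` -/

section CanonicalForm

set_option synthInstance.maxHeartbeats 400000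

variable {E D : Type*} [NormedAddCommGroup E] [NormedSpace ℝ E] [NormedAddCommGroup D]
  [NormedSpace ℝ D]

/-- The skew form `((v, α), (w, β)) ↦ ⟨β, v⟩ - ⟨α, w⟩` of `E × D`, for a pairing of `D` with `E`. -/
def pairingForm (B : D →L[ℝ] E →L[ℝ] ℝ) : E × D →L[ℝ] E × D →L[ℝ] ℝ :=
  let C : E × D →L[ℝ] E × D →L[ℝ] ℝ :=
    B.bilinearComp (ContinuousLinearMap.snd ℝ E D) (ContinuousLinearMap.fst ℝ E D)
  C.flip - C

@[simp]
lemma pairingForm_apply (B : D →L[ℝ] E →L[ℝ] ℝ) (a b : E × D) :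
    pairingForm B a b = B b.2 a.1 - B a.2 b.1 := rfl

/-- A local diffeomorphism of `E × D` that preserves the one-form `⟨p, dx⟩` preserves the skew form
`pairingForm`: antisymmetrise the derivative of the first identity. -/
lemma pairingForm_fderiv_of_preserves (B : D →L[ℝ] E →L[ℝ] ℝ) {F : E × D → E × D} {y : E × D}
    (hF : ContDiffAt ℝ 2 F y)
    (h : ∀ᶠ z in 𝓝 y, ∀ v, B (F z).2 ((fderiv ℝ F z v).1) = B z.2 v.1) (a b : E × D) :
    pairingForm B (fderiv ℝ F y a) (fderiv ℝ F y b) = pairingForm B a b := by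
  have hF1 : HasFDerivAt F (fderiv ℝ F y) y := (hF.differentiableAt (by simp)).hasFDerivAt
  have hD : HasFDerivAt (fderiv ℝ F) (fderiv ℝ (fderiv ℝ F) y) y :=
    ((hF.fderiv_right (m := 1) (by norm_num)).differentiableAt (by simp)).hasFDerivAt
  have hsymm : IsSymmSndFDerivAt ℝ F y := hF.isSymmSndFDerivAt (by simp)
  have key : ∀ v w : E × D, B (fderiv ℝ F y w).2 ((fderiv ℝ F y v).1) +
      B (F y).2 ((fderiv ℝ (fderiv ℝ F) y w v).1) = B w.2 v.1 := by
    intro v w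
    have h1 : HasFDerivAt (fun z => B (F z).2 ((fderiv ℝ F z v).1)) _ y :=
      (B.hasFDerivAt.comp y hF1.snd).clm_apply ((hD.clm_apply (hasFDerivAt_const v y)).fst)
    have h2 : HasFDerivAt (fun z : E × D => B z.2 v.1) _ y :=
      (B.hasFDerivAt.comp y (hasFDerivAt_snd (𝕜 := ℝ) (p := y))).clm_apply
        (hasFDerivAt_const v.1 y)
    have h3 := h1.unique (h2.congr_of_eventuallyEq (h.mono fun z hz => hz v))
    have h4 := DFunLike.congr_fun h3 w
    simp at h4
    linarith
  have hab := hsymm.eq a b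
  have k1 := key a b
  have k2 := key b a
  rw [← hab] at k1
  simp only [pairingForm_apply]
  linarith

/-- Infinitesimal version of Noether's theorem on `E × D`: if the local flow `Φ` preserves `⟨p, dx⟩`
and `Z` is its generator, then the function `⟨p, Z_x⟩` has differential `Ω(Z, ·)`. -/
lemma hasFDerivAt_pairing_of_preserves (B : D →L[ℝ] E →L[ℝ] ℝ) {Φ : ℝ × (E × D) → E × D}
    {y : E × D} (hΦ : ContDiffAt ℝ 2 Φ (0, y))
    (hid : ∀ᶠ z in 𝓝 y, Φ (0, z) = z)
    (h : ∀ᶠ z in 𝓝 ((0 : ℝ), y), ∀ v, B (Φ z).2 ((fderiv ℝ Φ z (0, v)).1) = B z.2.2 v.1) :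
    HasFDerivAt (fun z : E × D => B z.2 (fderiv ℝ Φ (0, z) (1, 0)).1)
      (pairingForm B (fderiv ℝ Φ (0, y) (1, 0))) y := by
  have hF1 : HasFDerivAt Φ (fderiv ℝ Φ (0, y)) (0, y) :=
    (hΦ.differentiableAt (by simp)).hasFDerivAt
  have hD : HasFDerivAt (fderiv ℝ Φ) (fderiv ℝ (fderiv ℝ Φ) (0, y)) (0, y) :=
    ((hΦ.fderiv_right (m := 1) (by norm_num)).differentiableAt (by simp)).hasFDerivAt
  have hsymm : IsSymmSndFDerivAt ℝ Φ (0, y) := hΦ.isSymmSndFDerivAt (by simp)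
  have hy : Φ (0, y) = y := hid.self_of_nhds
  have hinr : HasFDerivAt (fun z : E × D => ((0 : ℝ), z))
      (ContinuousLinearMap.inr ℝ ℝ (E × D)) y := hasFDerivAt_prodMk_right 0 y
  have hpart : ∀ v, fderiv ℝ Φ (0, y) (0, v) = v := by
    intro v
    have h1 := (hF1.comp y hinr).unique ((hasFDerivAt_id y).congr_of_eventuallyEq hid)
    exact DFunLike.congr_fun h1 v
  have key : ∀ v : E × D, B (fderiv ℝ Φ (0, y) (1, 0)).2 v.1 +
      B y.2 ((fderiv ℝ (fderiv ℝ Φ) (0, y) (1, 0) (0, v)).1) = 0 := by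
    intro v
    have h1 : HasFDerivAt (fun z => B (Φ z).2 ((fderiv ℝ Φ z (0, v)).1)) _ (0, y) :=
      (B.hasFDerivAt.comp (0, y) hF1.snd).clm_apply
        ((hD.clm_apply (hasFDerivAt_const ((0 : ℝ), v) ((0 : ℝ), y))).fst)
    have h2 : HasFDerivAt (fun z : ℝ × (E × D) => B z.2.2 v.1) _ ((0 : ℝ), y) :=
      (B.hasFDerivAt.comp _ ((hasFDerivAt_snd (𝕜 := ℝ) (p := ((0 : ℝ), y))).snd)).clm_apply
        (hasFDerivAt_const v.1 _)
    have h3 := h1.unique (h2.congr_of_eventuallyEq (h.mono fun z hz => hz v))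
    have h4 := DFunLike.congr_fun h3 ((1 : ℝ), 0)
    simp [hpart, hy] at h4
    linarith
  have h5 : HasFDerivAt (fun z : E × D => B z.2 (fderiv ℝ Φ (0, z) (1, 0)).1) _ y :=
    (B.hasFDerivAt.comp y (hasFDerivAt_snd (𝕜 := ℝ) (p := y))).clm_apply
      (((hD.comp y hinr).clm_apply (hasFDerivAt_const ((1 : ℝ), (0 : E × D)) y)).fst)
  refine h5.congr_fderiv (ContinuousLinearMap.ext fun v => ?_)
  have k := key v
  rw [hsymm.eq] at k
  simp
  linarith

lemma isInvertible_of_injective {W : Type*} [NormedAddCommGroup W] [NormedSpace ℝ W]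
    [FiniteDimensional ℝ W] (L : W →L[ℝ] W →L[ℝ] ℝ) (hL : Function.Injective L) :
    L.IsInvertible := by
  have hfin : Module.finrank ℝ W = Module.finrank ℝ (W →L[ℝ] ℝ) := by
    rw [← (LinearMap.toContinuousLinearMap (𝕜 := ℝ) (E := W) (F' := ℝ)).finrank_eq]
    exact (Subspace.dual_finrank_eq (K := ℝ) (V := W)).symm
  let e : W ≃ₗ[ℝ] (W →L[ℝ] ℝ) := LinearEquiv.ofBijective (L : W →ₗ[ℝ] W →L[ℝ] ℝ)
    ⟨hL, (LinearMap.injective_iff_surjective_of_finrank_eq_finrank hfin).1 hL⟩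
  exact ⟨e.toContinuousLinearEquiv, by ext; rfl⟩

variable (E) in
/-- The canonical symplectic form `((v, α), (w, β)) ↦ β v - α w` of `E × E*`. -/
def canonicalForm : E × (E →L[ℝ] ℝ) →L[ℝ] E × (E →L[ℝ] ℝ) →L[ℝ] ℝ :=
  pairingForm (ContinuousLinearMap.id ℝ (E →L[ℝ] ℝ))

lemma canonicalForm_apply (a b : E × (E →L[ℝ] ℝ)) :
    canonicalForm E a b = b.2 a.1 - a.2 b.1 := rfl

lemma canonicalForm_isInvertible [FiniteDimensional ℝ E] :
    (canonicalForm E).IsInvertible := by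
  apply isInvertible_of_injective
  rw [injective_iff_map_eq_zero]
  rintro ⟨v, α⟩ h
  have h1 : ∀ (w : E) (β : E →L[ℝ] ℝ), β v - α w = 0 := fun w β =>
    DFunLike.congr_fun h (w, β)
  have hα : α = 0 := by
    ext w
    simpa using h1 w 0
  have hv : v = 0 := by
    by_contra hv
    obtain ⟨β, -, hβ⟩ := exists_dual_vector ℝ v (norm_ne_zero_iff.2 hv)
    have := h1 0 β
    rw [map_zero, sub_zero, hβ] at this
    exact hv (norm_eq_zero.1 (by simpa using this))
  rw [hα, hv]; rfl

end CanonicalForm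

/-! ### Charts of the cotangent bundle -/

section ExteriorDerivative

variable {E : Type*} [NormedAddCommGroup E] [NormedSpace ℝ E] {H : Type*} [TopologicalSpace H]
  {I : ModelWithCorners ℝ E H} {M : Type*} [TopologicalSpace M] [ChartedSpace H M]
  [IsManifold I 1 M]

lemma extDerivOneForm_apply_of_eventuallyEq (α : ∀ x : M, TangentSpace I x →L[ℝ] ℝ) (x : M)
    (L : E →L[ℝ] E →L[ℝ] ℝ)
    (h : (fun y : E => (α ((extChartAt I x).symm y)).comp
      (mfderiv 𝓘(ℝ, E) I (extChartAt I x).symm y)) =ᶠ[𝓝 (extChartAt I x x)] L)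
    (v w : TangentSpace I x) :
    extDerivOneForm I α x v w = L (v : E) (w : E) - L (w : E) (v : E) := by
  have h1 : fderiv ℝ (fun y : E => ((α ((extChartAt I x).symm y)).comp
      (mfderiv 𝓘(ℝ, E) I (extChartAt I x).symm y) : E →L[ℝ] ℝ)) (extChartAt I x x) = L :=
    h.fderiv_eq.trans L.fderiv
  unfold extDerivOneForm
  rw [h1, mfderiv_extChartAt_self]
  rfl

end ExteriorDerivative

section CotangentCharts

variable {E : Type*} [NormedAddCommGroup E] [NormedSpace ℝ E]
  {M : Type*} [TopologicalSpace M] [ChartedSpace E M]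
  [IsManifold 𝓘(ℝ, E) ∞ M] [IsManifold 𝓘(ℝ, E) 1 M]

variable (E) in
/-- The model with corners of the cotangent bundle of a manifold modelled on `E`. -/
abbrev CotangentModel : ModelWithCorners ℝ (E × (E →L[ℝ] ℝ)) (ModelProd E (E →L[ℝ] ℝ)) :=
  𝓘(ℝ, E).prod 𝓘(ℝ, E →L[ℝ] ℝ)

lemma extChartAt_cotangent (η₀ η : Cotangent 𝓘(ℝ, E) M) (h : η.1 ∈ (chartAt E η₀.1).source) :
    extChartAt (CotangentModel E) η₀ η = (extChartAt 𝓘(ℝ, E) η₀.1 η.1,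
      ContinuousLinearMap.comp (η.2 : TangentSpace 𝓘(ℝ, E) η.1 →L[ℝ] ℝ)
        (mfderiv 𝓘(ℝ, E) 𝓘(ℝ, E) (extChartAt 𝓘(ℝ, E) η₀.1).symm
          (extChartAt 𝓘(ℝ, E) η₀.1 η.1))) := by
  have h1 : extChartAt (CotangentModel E) η₀ η = (extChartAt 𝓘(ℝ, E) η₀.1 η.1,
      ContinuousLinearMap.inCoordinates E (TangentSpace 𝓘(ℝ, E)) ℝ (Trivial M ℝ)
        η₀.1 η.1 η₀.1 η.1 η.2) := by
    have := hom_chart (𝕜 := ℝ) (B := M) (HB := E) (E₁ := TangentSpace 𝓘(ℝ, E))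
      (E₂ := Trivial M ℝ) (F₁ := E) (F₂ := ℝ) η₀ η
    rw [extChartAt_coe, Function.comp_apply, this]
    rfl
  rw [h1, ContinuousLinearMap.inCoordinates]
  congr 1
  rw [TangentBundle.symmL_trivializationAt h]
  ext v
  simp
  rfl

lemma mem_chart_source_cotangent {η₀ η : Cotangent 𝓘(ℝ, E) M} :
    η ∈ (chartAt (ModelProd E (E →L[ℝ] ℝ)) η₀).source ↔ η.1 ∈ (chartAt E η₀.1).source := by
  simp only [FiberBundle.chartedSpace_chartAt, mfld_simps]
  exact ⟨fun h => h.1.1, fun h => ⟨⟨h, trivial⟩, h⟩⟩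

lemma extChartAt_cotangent_snd_mfderiv (η₀ η : Cotangent 𝓘(ℝ, E) M)
    (h : η.1 ∈ (chartAt E η₀.1).source) (v : TangentSpace 𝓘(ℝ, E) η.1) :
    (extChartAt (CotangentModel E) η₀ η).2
      (mfderiv 𝓘(ℝ, E) 𝓘(ℝ, E) (extChartAt 𝓘(ℝ, E) η₀.1) η.1 v) =
      (η.2 : TangentSpace 𝓘(ℝ, E) η.1 →L[ℝ] ℝ) v := by
  rw [extChartAt_cotangent η₀ η h]
  have h1 := mfderivWithin_extChartAt_symm_comp_mfderiv_extChartAt' (I := 𝓘(ℝ, E))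
    (x := η₀.1) (y := η.1) (by simpa using h)
  rw [modelWithCornersSelf_coe, Set.range_id, mfderivWithin_univ] at h1
  have h2 := DFunLike.congr_fun h1 v
  exact congrArg (η.2 : TangentSpace 𝓘(ℝ, E) η.1 →L[ℝ] ℝ) h2

lemma contMDiff_cotangent_proj :
    ContMDiff (CotangentModel E) 𝓘(ℝ, E) ∞ (fun η : Cotangent 𝓘(ℝ, E) M => η.1) :=
  contMDiff_proj _

lemma mdifferentiableAt_extChartAt_cotangent {η₀ η : Cotangent 𝓘(ℝ, E) M}
    (h : η.1 ∈ (chartAt E η₀.1).source) :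
    MDifferentiableAt (CotangentModel E) 𝓘(ℝ, E × (E →L[ℝ] ℝ))
      (extChartAt (CotangentModel E) η₀) η :=
  mdifferentiableAt_extChartAt (mem_chart_source_cotangent.2 h)

lemma mfderiv_extChartAt_cotangent_fst {η₀ η : Cotangent 𝓘(ℝ, E) M}
    (h : η.1 ∈ (chartAt E η₀.1).source) (ξ : TangentSpace (CotangentModel E) η) :
    (mfderiv (CotangentModel E) 𝓘(ℝ, E × (E →L[ℝ] ℝ)) (extChartAt (CotangentModel E) η₀) η ξ).1 =
      mfderiv 𝓘(ℝ, E) 𝓘(ℝ, E) (extChartAt 𝓘(ℝ, E) η₀.1) η.1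
        (mfderiv (CotangentModel E) 𝓘(ℝ, E) (fun η : Cotangent 𝓘(ℝ, E) M => η.1) η ξ) := by
  have h1 : HasMFDerivAt (CotangentModel E) 𝓘(ℝ, E)
      (Prod.fst ∘ extChartAt (CotangentModel E) η₀) η _ :=
    HasMFDerivAt.comp η (hasFDerivAt_fst (𝕜 := ℝ)).hasMFDerivAt
      (mdifferentiableAt_extChartAt_cotangent h).hasMFDerivAt
  have h2 : HasMFDerivAt (CotangentModel E) 𝓘(ℝ, E)
      (extChartAt 𝓘(ℝ, E) η₀.1 ∘ (fun η : Cotangent 𝓘(ℝ, E) M => η.1)) η _ :=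
    HasMFDerivAt.comp η (mdifferentiableAt_extChartAt h).hasMFDerivAt
      ((contMDiff_cotangent_proj η).mdifferentiableAt (by simp)).hasMFDerivAt
  exact DFunLike.congr_fun (hasMFDerivAt_unique h1 h2) ξ

/-- In a chart of `T*M` induced by a chart of `M`, the Liouville form is `p dx`. -/
lemma liouvilleForm_eq_chart {η₀ η : Cotangent 𝓘(ℝ, E) M} (h : η.1 ∈ (chartAt E η₀.1).source)
    (ξ : TangentSpace (CotangentModel E) η) :
    liouvilleForm 𝓘(ℝ, E) η ξ = (extChartAt (CotangentModel E) η₀ η).2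
      (mfderiv (CotangentModel E) 𝓘(ℝ, E × (E →L[ℝ] ℝ)) (extChartAt (CotangentModel E) η₀)
        η ξ).1 := by
  rw [mfderiv_extChartAt_cotangent_fst h, extChartAt_cotangent_snd_mfderiv _ _ h]
  rfl

/-- In the preferred chart at `η` the symplectic form at `η` is the canonical form of `E × E*`. -/
lemma symplecticForm_eq_canonicalForm (η : Cotangent 𝓘(ℝ, E) M)
    (a b : TangentSpace (CotangentModel E) η) :
    symplecticForm 𝓘(ℝ, E) η a b =
      canonicalForm E (a : E × (E →L[ℝ] ℝ)) (b : E × (E →L[ℝ] ℝ)) := by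
  have hA : (fun y : E × (E →L[ℝ] ℝ) =>
      (liouvilleForm 𝓘(ℝ, E) ((extChartAt (CotangentModel E) η).symm y)).comp
        (mfderiv 𝓘(ℝ, E × (E →L[ℝ] ℝ)) (CotangentModel E)
          (extChartAt (CotangentModel E) η).symm y)) =ᶠ[𝓝 (extChartAt (CotangentModel E) η η)]
      fun y => (ContinuousLinearMap.compL ℝ (E × (E →L[ℝ] ℝ)) E ℝ).flip
        (ContinuousLinearMap.fst ℝ E (E →L[ℝ] ℝ)) (ContinuousLinearMap.snd ℝ E (E →L[ℝ] ℝ) y) := by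
    filter_upwards [extChartAt_target_mem_nhds (I := CotangentModel E) η] with y hy
    have hs : ((extChartAt (CotangentModel E) η).symm y).1 ∈ (chartAt E η.1).source := by
      have := (extChartAt (CotangentModel E) η).map_target hy
      rw [extChartAt_source] at this
      exact mem_chart_source_cotangent.1 this
    refine ContinuousLinearMap.ext fun v => ?_
    have h1 := mfderiv_extChartAt_comp_mfderivWithin_extChartAt_symm (I := CotangentModel E) hy
    rw [ModelWithCorners.range_eq_univ, mfderivWithin_univ] at h1
    have h2 := DFunLike.congr_fun h1 v
    have h3 := liouvilleForm_eq_chart hs (mfderiv 𝓘(ℝ, E × (E →L[ℝ] ℝ)) (CotangentModel E)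
          (extChartAt (CotangentModel E) η).symm y v)
    refine h3.trans ?_
    rw [(extChartAt (CotangentModel E) η).right_inv hy]
    exact congrArg (fun w : E × (E →L[ℝ] ℝ) => y.2 w.1) h2
  have h := extDerivOneForm_apply_of_eventuallyEq (I := CotangentModel E) (liouvilleForm 𝓘(ℝ, E)) η
    ((ContinuousLinearMap.compL ℝ (E × (E →L[ℝ] ℝ)) E ℝ).flip
      (ContinuousLinearMap.fst ℝ E (E →L[ℝ] ℝ)) ∘L ContinuousLinearMap.snd ℝ E (E →L[ℝ] ℝ)) hA a b
  refine (congrArg Neg.neg h).trans ?_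
  exact neg_sub _ _

end CotangentCharts

/-! ### Derivatives in charts -/

section ChartDerivatives

variable {E : Type*} [NormedAddCommGroup E] [NormedSpace ℝ E] {H : Type*} [TopologicalSpace H]
  {I : ModelWithCorners ℝ E H} {M : Type*} [TopologicalSpace M] [ChartedSpace H M]
  [IsManifold I 1 M]
  {E' : Type*} [NormedAddCommGroup E'] [NormedSpace ℝ E'] {H' : Type*} [TopologicalSpace H']
  {I' : ModelWithCorners ℝ E' H'} {N : Type*} [TopologicalSpace N] [ChartedSpace H' N]
  [IsManifold I' 1 N]

lemma mfderiv_extChartAt_self_apply {x y : M} (h : y = x) (v : TangentSpace I y) :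
    mfderiv I 𝓘(ℝ, E) (extChartAt I x) y v = (v : E) := by
  subst h
  rw [mfderiv_extChartAt_self]
  rfl

/-- Smoothness of a vector field along a map, tested in the fixed chart of the target at the image
of the point. -/
lemma contMDiffAt_tangentBundle_iff {b : N → M} {V : ∀ y, TangentSpace I (b y)} {y₀ : N}
    {k : ℕ∞ω} (hb : ContMDiffAt I' I k b y₀) :
    ContMDiffAt I' I.tangent k (fun y => (⟨b y, V y⟩ : TangentBundle I M)) y₀ ↔
      ContMDiffAt I' 𝓘(ℝ, E) k
        (fun y => mfderiv I 𝓘(ℝ, E) (extChartAt I (b y₀)) (b y) (V y)) y₀ := by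
  rw [contMDiffAt_totalSpace]
  simp only [hb, true_and]
  apply Filter.EventuallyEq.contMDiffAt_iff
  filter_upwards [hb.continuousAt.preimage_mem_nhds
    ((chartAt H (b y₀)).open_source.mem_nhds (mem_chart_source H (b y₀)))] with y hy
  refine Eq.trans ?_ (DFunLike.congr_fun
    (TangentBundle.continuousLinearMapAt_trivializationAt hy) (V y))
  exact (congrFun (Trivialization.coe_linearMapAt_of_mem (R := ℝ)
    (trivializationAt E (TangentSpace I) (b y₀)) hy) (V y)).symm

variable [BoundarylessManifold I M] [I.Boundaryless]

lemma mdifferentiableAt_extChartAt_symm_apply {x₀ x : M} (hx : x ∈ (chartAt H x₀).source) :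
    MDifferentiableAt 𝓘(ℝ, E) I (extChartAt I x₀).symm (extChartAt I x₀ x) := by
  have := mdifferentiableWithinAt_extChartAt_symm (I := I) (x := x₀) (z := extChartAt I x₀ x)
    ((extChartAt I x₀).map_source (by rwa [extChartAt_source]))
  rwa [I.range_eq_univ, mdifferentiableWithinAt_univ] at this

lemma mfderiv_extChartAt_symm_apply_mfderiv {x₀ x : M} (hx : x ∈ (chartAt H x₀).source)
    (v : TangentSpace I x) :
    mfderiv 𝓘(ℝ, E) I (extChartAt I x₀).symm (extChartAt I x₀ x)
      (mfderiv I 𝓘(ℝ, E) (extChartAt I x₀) x v) = v := by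
  have h1 := mfderivWithin_extChartAt_symm_comp_mfderiv_extChartAt' (I := I)
    (x := x₀) (y := x) (by rwa [extChartAt_source])
  rw [I.range_eq_univ, mfderivWithin_univ] at h1
  exact DFunLike.congr_fun h1 v

lemma mfderiv_extChartAt_apply_mfderiv_symm {x₀ : M} {y : E} (hy : y ∈ (extChartAt I x₀).target)
    (v : E) : mfderiv I 𝓘(ℝ, E) (extChartAt I x₀) ((extChartAt I x₀).symm y)
      (mfderiv 𝓘(ℝ, E) I (extChartAt I x₀).symm y v) = v := by
  have h1 := mfderiv_extChartAt_comp_mfderivWithin_extChartAt_symm (I := I) hy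
  rw [I.range_eq_univ, mfderivWithin_univ] at h1
  exact DFunLike.congr_fun h1 v

/-- The derivative of a map written in charts. -/
lemma hasFDerivAt_writtenInCharts {F : M → N} {x₀ x : M} {y₀ : N}
    (hF : MDifferentiableAt I I' F x)
    (hx : x ∈ (chartAt H x₀).source) (hy : F x ∈ (chartAt H' y₀).source) :
    ∃ L : E →L[ℝ] E',
      HasFDerivAt (extChartAt I' y₀ ∘ F ∘ (extChartAt I x₀).symm) L (extChartAt I x₀ x) ∧
      ∀ v : TangentSpace I x, L (mfderiv I 𝓘(ℝ, E) (extChartAt I x₀) x v) =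
        mfderiv I' 𝓘(ℝ, E') (extChartAt I' y₀) (F x) (mfderiv I I' F x v) := by
  have hl : (extChartAt I x₀).symm (extChartAt I x₀ x) = x :=
    (extChartAt I x₀).left_inv (by rwa [extChartAt_source])
  have h1 := (mdifferentiableAt_extChartAt_symm_apply (I := I) hx).hasMFDerivAt
  have h2 : HasMFDerivAt 𝓘(ℝ, E) I' (F ∘ (extChartAt I x₀).symm) (extChartAt I x₀ x)
      ((mfderiv I I' F x).comp (mfderiv 𝓘(ℝ, E) I (extChartAt I x₀).symm (extChartAt I x₀ x))) :=
    HasMFDerivAt.comp _ (by rw [hl]; exact hF.hasMFDerivAt) h1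
  have h3 : HasMFDerivAt 𝓘(ℝ, E) 𝓘(ℝ, E') (extChartAt I' y₀ ∘ F ∘ (extChartAt I x₀).symm)
      (extChartAt I x₀ x) ((mfderiv I' 𝓘(ℝ, E') (extChartAt I' y₀) (F x)).comp
        ((mfderiv I I' F x).comp
          (mfderiv 𝓘(ℝ, E) I (extChartAt I x₀).symm (extChartAt I x₀ x)))) :=
    HasMFDerivAt.comp _ (by
      rw [Function.comp_apply, hl]; exact (mdifferentiableAt_extChartAt hy).hasMFDerivAt) h2
  refine ⟨_, h3.hasFDerivAt, fun v => ?_⟩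
  have := mfderiv_extChartAt_symm_apply_mfderiv (I := I) hx v
  exact congrArg (fun w => mfderiv I' 𝓘(ℝ, E') (extChartAt I' y₀) (F x) (mfderiv I I' F x w)) this

lemma contDiffAt_writtenInCharts [IsManifold I ∞ M] [IsManifold I' ∞ N] {F : M → N} {x₀ x : M}
    {y₀ : N} {k : ℕ∞} (hF : ContMDiffAt I I' k F x)
    (hx : x ∈ (chartAt H x₀).source) (hy : F x ∈ (chartAt H' y₀).source) :
    ContDiffAt ℝ k (extChartAt I' y₀ ∘ F ∘ (extChartAt I x₀).symm) (extChartAt I x₀ x) := by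
  have : IsManifold I k M := IsManifold.of_le (n := ∞) (by exact_mod_cast le_top)
  have : IsManifold I' k N := IsManifold.of_le (n := ∞) (by exact_mod_cast le_top)
  have hl : (extChartAt I x₀).symm (extChartAt I x₀ x) = x :=
    (extChartAt I x₀).left_inv (by rwa [extChartAt_source])
  rw [← contMDiffAt_iff_contDiffAt]
  have h1 : ContMDiffAt 𝓘(ℝ, E) I k (extChartAt I x₀).symm (extChartAt I x₀ x) :=
    (contMDiffOn_extChartAt_symm x₀).contMDiffAt
      ((isOpen_extChartAt_target x₀).mem_nhds
        ((extChartAt I x₀).map_source (by rwa [extChartAt_source])))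
  have h2 : ContMDiffAt 𝓘(ℝ, E) I' k (F ∘ (extChartAt I x₀).symm) (extChartAt I x₀ x) :=
    ContMDiffAt.comp _ (by rw [hl]; exact hF) h1
  exact ContMDiffAt.comp _ (by rw [Function.comp_apply, hl]; exact contMDiffAt_extChartAt' hy) h2

lemma fderiv_comp_extChartAt_symm {f : M → ℝ} {x₀ x : M} (hf : MDifferentiableAt I 𝓘(ℝ, ℝ) f x)
    (hx : x ∈ (chartAt H x₀).source) (c : E) :
    fderiv ℝ (f ∘ (extChartAt I x₀).symm) (extChartAt I x₀ x) c = mfderiv I 𝓘(ℝ, ℝ) f x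
      (mfderiv 𝓘(ℝ, E) I (extChartAt I x₀).symm (extChartAt I x₀ x) c) := by
  have hl : (extChartAt I x₀).symm (extChartAt I x₀ x) = x :=
    (extChartAt I x₀).left_inv (by rwa [extChartAt_source])
  have h3 : HasMFDerivAt 𝓘(ℝ, E) 𝓘(ℝ, ℝ) (f ∘ (extChartAt I x₀).symm) (extChartAt I x₀ x)
      ((mfderiv I 𝓘(ℝ, ℝ) f x).comp
        (mfderiv 𝓘(ℝ, E) I (extChartAt I x₀).symm (extChartAt I x₀ x))) :=
    HasMFDerivAt.comp _ (by rw [hl]; exact hf.hasMFDerivAt)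
      (mdifferentiableAt_extChartAt_symm_apply hx).hasMFDerivAt
  rw [← mfderiv_eq_fderiv, h3.mfderiv]
  rfl

end ChartDerivatives

lemma contDiffAt_clm_fderiv {W V : Type*} [NormedAddCommGroup W] [NormedSpace ℝ W]
    [NormedAddCommGroup V] [NormedSpace ℝ V] (L : (W →L[ℝ] ℝ) →L[ℝ] V) {f : W → ℝ} {x : W}
    (hf : ContDiffAt ℝ ∞ f x) : ContDiffAt ℝ ∞ (fun y => L (fderiv ℝ f y)) x :=
  L.contDiff.contDiffAt.comp x (hf.fderiv_right (m := ∞) (by simp))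

/-! ### Symplectic maps and Hamiltonian vector fields -/

section Symplectic

variable {E : Type*} [NormedAddCommGroup E] [NormedSpace ℝ E]
  {M : Type*} [TopologicalSpace M] [ChartedSpace E M]
  [IsManifold 𝓘(ℝ, E) ∞ M] [IsManifold 𝓘(ℝ, E) 1 M]

instance : IsManifold (CotangentModel E) ∞ (Cotangent 𝓘(ℝ, E) M) := inferInstance

instance : IsManifold (CotangentModel E) 1 (Cotangent 𝓘(ℝ, E) M) :=
  IsManifold.of_le (n := ∞) (by norm_cast)

/-- A map of `T*M` that preserves the Liouville form is symplectic, expressed in the charts at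
arbitrary points `η₀` and `η₁`. For `F = id` this says that changes of charts of `T*M` preserve the
canonical form. -/
lemma canonicalForm_mfderiv_of_preserves {F : Cotangent 𝓘(ℝ, E) M → Cotangent 𝓘(ℝ, E) M}
    {η₀ η₁ η : Cotangent 𝓘(ℝ, E) M} (hF : ContMDiffAt (CotangentModel E) (CotangentModel E) ∞ F η)
    (h₀ : η.1 ∈ (chartAt E η₀.1).source) (h₁ : (F η).1 ∈ (chartAt E η₁.1).source)
    (hθ : ∀ᶠ ζ in 𝓝 η, ∀ ξ : TangentSpace (CotangentModel E) ζ,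
      liouvilleForm 𝓘(ℝ, E) (F ζ) (mfderiv (CotangentModel E) (CotangentModel E) F ζ ξ) =
        liouvilleForm 𝓘(ℝ, E) ζ ξ) (a b : TangentSpace (CotangentModel E) η) :
    canonicalForm E
      (mfderiv (CotangentModel E) 𝓘(ℝ, E × (E →L[ℝ] ℝ)) (extChartAt (CotangentModel E) η₁) (F η)
        (mfderiv (CotangentModel E) (CotangentModel E) F η a))
      (mfderiv (CotangentModel E) 𝓘(ℝ, E × (E →L[ℝ] ℝ)) (extChartAt (CotangentModel E) η₁) (F η)
        (mfderiv (CotangentModel E) (CotangentModel E) F η b)) =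
    canonicalForm E
      (mfderiv (CotangentModel E) 𝓘(ℝ, E × (E →L[ℝ] ℝ)) (extChartAt (CotangentModel E) η₀) η a)
      (mfderiv (CotangentModel E) 𝓘(ℝ, E × (E →L[ℝ] ℝ))
        (extChartAt (CotangentModel E) η₀) η b) := by
  have h0' := mem_chart_source_cotangent.2 h₀
  have h1' := mem_chart_source_cotangent.2 h₁
  set φ₀ := extChartAt (CotangentModel E) η₀
  set φ₁ := extChartAt (CotangentModel E) η₁
  have hs : η ∈ φ₀.source := by rwa [extChartAt_source]
  have hd := contDiffAt_writtenInCharts (k := 2) (hF.of_le (by exact_mod_cast le_top)) h0' h1'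
  -- the hypothesis on the Liouville form, in the charts
  have hev : ∀ᶠ ζ in 𝓝 η, ∀ v : E × (E →L[ℝ] ℝ),
      ((φ₁ ∘ F ∘ φ₀.symm) (φ₀ ζ)).2 (fderiv ℝ (φ₁ ∘ F ∘ φ₀.symm) (φ₀ ζ) v).1 = (φ₀ ζ).2 v.1 := by
    filter_upwards [hθ, (chartAt (ModelProd E (E →L[ℝ] ℝ)) η₀).open_source.mem_nhds h0',
      hF.continuousAt.preimage_mem_nhds
        ((chartAt (ModelProd E (E →L[ℝ] ℝ)) η₁).open_source.mem_nhds h1'),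
      (contMDiffAt_iff_contMDiffAt_nhds (n := 1) (by simp)).1 (hF.of_le (by simp))]
        with ζ hζ hζ0 hζ1 hζF v
    obtain ⟨L, hL, hL'⟩ := hasFDerivAt_writtenInCharts (hζF.mdifferentiableAt (by simp)) hζ0 hζ1
    have hζs : ζ ∈ φ₀.source := by rwa [extChartAt_source]
    have hsymm := mfderiv_extChartAt_apply_mfderiv_symm (I := CotangentModel E) (x₀ := η₀)
      (φ₀.map_source hζs) v
    rw [hL.fderiv, Function.comp_apply, Function.comp_apply]
    have hl : (extChartAt (CotangentModel E) η₀).symm (φ₀ ζ) = ζ := φ₀.left_inv hζs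
    rw [hl] at hsymm
    have hl' : φ₀.symm (φ₀ ζ) = ζ := hl
    rw [hl', ← hsymm]
    have e1 := liouvilleForm_eq_chart (mem_chart_source_cotangent.1 hζ0)
      (mfderiv 𝓘(ℝ, E × (E →L[ℝ] ℝ)) (CotangentModel E) φ₀.symm (φ₀ ζ) v)
    have e2 := liouvilleForm_eq_chart (mem_chart_source_cotangent.1 hζ1)
      (mfderiv (CotangentModel E) (CotangentModel E) F ζ
        (mfderiv 𝓘(ℝ, E × (E →L[ℝ] ℝ)) (CotangentModel E) φ₀.symm (φ₀ ζ) v))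
    have e3 := hL' (mfderiv 𝓘(ℝ, E × (E →L[ℝ] ℝ)) (CotangentModel E) φ₀.symm (φ₀ ζ) v)
    refine (congrArg (fun w : E × (E →L[ℝ] ℝ) => (φ₁ (F ζ)).2 w.1) e3).trans ?_
    exact e2.symm.trans ((hζ _).trans e1)
  have hev' : ∀ᶠ z in 𝓝 (φ₀ η), ∀ v : E × (E →L[ℝ] ℝ),
      ((φ₁ ∘ F ∘ φ₀.symm) z).2 (fderiv ℝ (φ₁ ∘ F ∘ φ₀.symm) z v).1 = z.2 v.1 := by
    have hc : Filter.Tendsto φ₀.symm (𝓝 (φ₀ η)) (𝓝 η) := by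
      have := continuousAt_extChartAt_symm' (I := CotangentModel E) hs
      rwa [ContinuousAt, φ₀.left_inv hs] at this
    filter_upwards [hc.eventually hev,
      extChartAt_target_mem_nhds' (I := CotangentModel E) (φ₀.map_source hs)]
      with z hz hzt
    rwa [φ₀.right_inv hzt] at hz
  obtain ⟨L, hL, hL'⟩ := hasFDerivAt_writtenInCharts (hF.mdifferentiableAt (by simp)) h0' h1'
  have := pairingForm_fderiv_of_preserves (ContinuousLinearMap.id ℝ (E →L[ℝ] ℝ)) hd hev'
    (mfderiv (CotangentModel E) 𝓘(ℝ, E × (E →L[ℝ] ℝ)) φ₀ η a)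
    (mfderiv (CotangentModel E) 𝓘(ℝ, E × (E →L[ℝ] ℝ)) φ₀ η b)
  rw [hL.fderiv, hL', hL'] at this
  exact this

lemma symplecticForm_inverse (η : Cotangent 𝓘(ℝ, E) M) :
    (symplecticForm 𝓘(ℝ, E) η).inverse = (canonicalForm E).inverse := by
  have : symplecticForm 𝓘(ℝ, E) η = canonicalForm E :=
    ContinuousLinearMap.ext fun a => ContinuousLinearMap.ext fun b =>
      symplecticForm_eq_canonicalForm η a b
  exact congrArg ContinuousLinearMap.inverse this

variable [FiniteDimensional ℝ E]

lemma canonicalForm_inverse_apply (α : E × (E →L[ℝ] ℝ) →L[ℝ] ℝ) :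
    canonicalForm E ((canonicalForm E).inverse α) = α := by
  obtain ⟨e, he⟩ := canonicalForm_isInvertible (E := E)
  rw [← he, ContinuousLinearMap.inverse_equiv]
  exact e.apply_symm_apply α

lemma canonicalForm_hamiltonianVectorField (f : Cotangent 𝓘(ℝ, E) M → ℝ)
    (η : Cotangent 𝓘(ℝ, E) M) (b : TangentSpace (CotangentModel E) η) :
    canonicalForm E (hamiltonianVectorField 𝓘(ℝ, E) f η) (b : E × (E →L[ℝ] ℝ)) =
      mfderiv (CotangentModel E) 𝓘(ℝ, ℝ) f η b := by
  rw [hamiltonianVectorField, symplecticForm_inverse]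
  exact DFunLike.congr_fun (canonicalForm_inverse_apply
    (mfderiv (CotangentModel E) 𝓘(ℝ, ℝ) f η : E × (E →L[ℝ] ℝ) →L[ℝ] ℝ)) (b : E × (E →L[ℝ] ℝ))

lemma canonicalForm_ext {a b : E × (E →L[ℝ] ℝ)}
    (h : ∀ c, canonicalForm E a c = canonicalForm E b c) : a = b := by
  obtain ⟨e, he⟩ := canonicalForm_isInvertible (E := E)
  apply e.injective
  rw [← ContinuousLinearEquiv.coe_coe, he]
  exact ContinuousLinearMap.ext h

/-- A symplectic map carries the Hamiltonian vector field of `f ∘ F` to that of `f`. -/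
lemma hamiltonianVectorField_map {F : Cotangent 𝓘(ℝ, E) M → Cotangent 𝓘(ℝ, E) M}
    {η : Cotangent 𝓘(ℝ, E) M} (hF : ContMDiffAt (CotangentModel E) (CotangentModel E) ∞ F η)
    (hθ : ∀ᶠ ζ in 𝓝 η, ∀ ξ : TangentSpace (CotangentModel E) ζ,
      liouvilleForm 𝓘(ℝ, E) (F ζ) (mfderiv (CotangentModel E) (CotangentModel E) F ζ ξ) =
        liouvilleForm 𝓘(ℝ, E) ζ ξ)
    (hsurj : Function.Surjective (mfderiv (CotangentModel E) (CotangentModel E) F η))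
    {f : Cotangent 𝓘(ℝ, E) M → ℝ} (hf : MDifferentiableAt (CotangentModel E) 𝓘(ℝ, ℝ) f (F η)) :
    hamiltonianVectorField 𝓘(ℝ, E) f (F η) =
      mfderiv (CotangentModel E) (CotangentModel E) F η
        (hamiltonianVectorField 𝓘(ℝ, E) (f ∘ F) η) := by
  apply canonicalForm_ext
  intro c
  obtain ⟨b, hb⟩ := hsurj c
  have h1 := canonicalForm_mfderiv_of_preserves hF (mem_chart_source E η.1)
    (mem_chart_source E (F η).1) hθ (hamiltonianVectorField 𝓘(ℝ, E) (f ∘ F) η) b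
  simp only [mfderiv_extChartAt_self_apply] at h1
  have h2 := canonicalForm_hamiltonianVectorField (f ∘ F) η b
  have h3 := canonicalForm_hamiltonianVectorField f (F η) c
  have h4 : mfderiv (CotangentModel E) 𝓘(ℝ, ℝ) (f ∘ F) η b =
      mfderiv (CotangentModel E) 𝓘(ℝ, ℝ) f (F η)
        (mfderiv (CotangentModel E) (CotangentModel E) F η b) := by
    rw [mfderiv_comp η hf (hF.mdifferentiableAt (by simp))]
    rfl
  refine h3.trans ?_
  rw [← hb, ← h4, ← h2, ← h1]

lemma contMDiff_hamiltonianVectorField {f : Cotangent 𝓘(ℝ, E) M → ℝ}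
    (hf : ContMDiff (CotangentModel E) 𝓘(ℝ, ℝ) ∞ f) :
    ContMDiff (CotangentModel E) (CotangentModel E).tangent ∞
      (fun η => (⟨η, hamiltonianVectorField 𝓘(ℝ, E) f η⟩ :
        TangentBundle (CotangentModel E) (Cotangent 𝓘(ℝ, E) M))) := by
  intro η₀
  refine (contMDiffAt_tangentBundle_iff (b := fun η => η) contMDiffAt_id).2 ?_
  set φ₀ := extChartAt (CotangentModel E) η₀
  have key : ∀ᶠ η in 𝓝 η₀, mfderiv (CotangentModel E) 𝓘(ℝ, E × (E →L[ℝ] ℝ)) φ₀ η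
      (hamiltonianVectorField 𝓘(ℝ, E) f η) =
      (canonicalForm E).inverse (fderiv ℝ (f ∘ φ₀.symm) (φ₀ η)) := by
    filter_upwards [(chartAt (ModelProd E (E →L[ℝ] ℝ)) η₀).open_source.mem_nhds
      (mem_chart_source _ _)] with η hη
    have hηs : η ∈ φ₀.source := by rwa [extChartAt_source]
    apply canonicalForm_ext
    intro c
    have hl : φ₀.symm (φ₀ η) = η := φ₀.left_inv hηs
    have hc := mfderiv_extChartAt_apply_mfderiv_symm (I := CotangentModel E) (x₀ := η₀)
      (φ₀.map_source hηs) c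
    rw [show (extChartAt (CotangentModel E) η₀).symm (φ₀ η) = η from hl] at hc
    set d : E × (E →L[ℝ] ℝ) :=
      mfderiv 𝓘(ℝ, E × (E →L[ℝ] ℝ)) (CotangentModel E) φ₀.symm (φ₀ η) c with hd
    -- in the chart at `η₀`, too, the symplectic form at `η` is the canonical one
    have h1 := canonicalForm_mfderiv_of_preserves (F := id) (η := η) contMDiffAt_id
      (mem_chart_source E η.1) (mem_chart_source_cotangent.1 hη)
      (Filter.Eventually.of_forall fun ζ ξ => by rw [mfderiv_id]; rfl)
      (hamiltonianVectorField 𝓘(ℝ, E) f η) d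
    rw [mfderiv_id] at h1
    simp only [mfderiv_extChartAt_self_apply] at h1
    have h2 := canonicalForm_hamiltonianVectorField f η d
    have h3 := fderiv_comp_extChartAt_symm ((hf η).mdifferentiableAt (by simp)) hη c
    rw [canonicalForm_inverse_apply, h3]
    have h4 : mfderiv (CotangentModel E) 𝓘(ℝ, E × (E →L[ℝ] ℝ)) (extChartAt (CotangentModel E) η) η d
        = d := mfderiv_extChartAt_self_apply rfl d
    refine Eq.trans ?_ ((h1.trans (congrArg _ h4)).trans h2)
    exact congrArg (fun w : E × (E →L[ℝ] ℝ) => canonicalForm E (mfderiv (CotangentModel E)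
      𝓘(ℝ, E × (E →L[ℝ] ℝ)) φ₀ η (hamiltonianVectorField 𝓘(ℝ, E) f η)) w) hc.symm
  refine ContMDiffAt.congr_of_eventuallyEq ?_ key
  have h5 : ContDiffAt ℝ ∞ (f ∘ φ₀.symm) (φ₀ η₀) := by
    rw [← contMDiffAt_iff_contDiffAt]
    exact (hf _).comp _ ((contMDiffOn_extChartAt_symm η₀).contMDiffAt
      (extChartAt_target_mem_nhds η₀))
  have h6 : ContDiffAt ℝ ∞ (fun y => (canonicalForm E).inverse (fderiv ℝ (f ∘ φ₀.symm) y))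
      (φ₀ η₀) := contDiffAt_clm_fderiv _ h5
  exact h6.contMDiffAt.comp η₀ contMDiffAt_extChartAt

end Symplectic

/-! ### Noether's theorem -/

section Noether

lemma canonicalForm_swap {E : Type*} [NormedAddCommGroup E] [NormedSpace ℝ E]
    (a b : E × (E →L[ℝ] ℝ)) : canonicalForm E a b = -canonicalForm E b a := by
  rw [canonicalForm_apply, canonicalForm_apply, neg_sub]

lemma eventually_differentiableAt_of_contDiffAt {V W : Type*} [NormedAddCommGroup V]
    [NormedSpace ℝ V] [NormedAddCommGroup W] [NormedSpace ℝ W] {F : V → W} {x : V}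
    (hF : ContDiffAt ℝ 2 F x) : ∀ᶠ y in 𝓝 x, DifferentiableAt ℝ F y :=
  (hF.eventually (by simp)).mono fun _ h => h.differentiableAt (by simp)

lemma HasFDerivAt.apply_partial_left {V W : Type*} [NormedAddCommGroup V]
    [NormedSpace ℝ V] [NormedAddCommGroup W] [NormedSpace ℝ W] {Φ : ℝ × V → W} {s : ℝ} {y : V}
    {L : ℝ →L[ℝ] W} (hΦ : DifferentiableAt ℝ Φ (s, y)) (hL : HasFDerivAt (fun s => Φ (s, y)) L s) :
    fderiv ℝ Φ (s, y) (1, 0) = L 1 := by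
  have := (hΦ.hasFDerivAt.comp s (hasFDerivAt_prodMk_left s y)).unique hL
  rw [← this]
  rfl

lemma HasFDerivAt.apply_partial_right {V W : Type*} [NormedAddCommGroup V]
    [NormedSpace ℝ V] [NormedAddCommGroup W] [NormedSpace ℝ W] {Φ : ℝ × V → W} {s : ℝ} {y : V}
    {L : V →L[ℝ] W} (hΦ : DifferentiableAt ℝ Φ (s, y)) (hL : HasFDerivAt (fun y => Φ (s, y)) L y)
    (v : V) : fderiv ℝ Φ (s, y) (0, v) = L v := by
  have := (hΦ.hasFDerivAt.comp y (hasFDerivAt_prodMk_right s y)).unique hL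
  rw [← this]
  rfl

variable {E : Type*} [NormedAddCommGroup E] [NormedSpace ℝ E]
  {M : Type*} [TopologicalSpace M] [ChartedSpace E M]
  [IsManifold 𝓘(ℝ, E) ∞ M] [IsManifold 𝓘(ℝ, E) 1 M]

/-- If the maps `Ψ s` of `T*M` preserve the Liouville form `θ`, and `Z = ∂Ψ/∂s` at `s = 0`, then
`d(θ(Z)) = Ω(Z, ·)`. -/
lemma mfderiv_momentum_of_preserves {Ψ : ℝ → Cotangent 𝓘(ℝ, E) M → Cotangent 𝓘(ℝ, E) M}
    {η : Cotangent 𝓘(ℝ, E) M}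
    (hΨ : ContMDiffAt (𝓘(ℝ, ℝ).prod (CotangentModel E)) (CotangentModel E) ∞
      (fun p : ℝ × Cotangent 𝓘(ℝ, E) M => Ψ p.1 p.2) (0, η))
    (hid : ∀ ζ, Ψ 0 ζ = ζ)
    (hθ : ∀ᶠ p in 𝓝 ((0 : ℝ), η), ∀ ξ : TangentSpace (CotangentModel E) p.2,
      liouvilleForm 𝓘(ℝ, E) (Ψ p.1 p.2)
        (mfderiv (CotangentModel E) (CotangentModel E) (Ψ p.1) p.2 ξ) =
          liouvilleForm 𝓘(ℝ, E) p.2 ξ)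
    {J : Cotangent 𝓘(ℝ, E) M → ℝ}
    (hJ : ∀ᶠ ζ in 𝓝 η, J ζ = liouvilleForm 𝓘(ℝ, E) (Ψ 0 ζ)
      (mfderiv 𝓘(ℝ, ℝ) (CotangentModel E) (fun s => Ψ s ζ) 0 (1 : ℝ))) :
    MDifferentiableAt (CotangentModel E) 𝓘(ℝ, ℝ) J η ∧
    ∀ ξ : TangentSpace (CotangentModel E) η, mfderiv (CotangentModel E) 𝓘(ℝ, ℝ) J η ξ =
      canonicalForm E (mfderiv 𝓘(ℝ, ℝ) (CotangentModel E) (fun s => Ψ s η) 0 (1 : ℝ))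
        (ξ : E × (E →L[ℝ] ℝ)) := by
  set φ := extChartAt (CotangentModel E) η with hφ
  have hηs : η ∈ φ.source := mem_extChartAt_source η
  have hl : φ.symm (φ η) = η := φ.left_inv hηs
  let Φ : ℝ × (E × (E →L[ℝ] ℝ)) → E × (E →L[ℝ] ℝ) := fun p => φ (Ψ p.1 (φ.symm p.2))
  have hsymm : ContMDiffAt 𝓘(ℝ, E × (E →L[ℝ] ℝ)) (CotangentModel E) ∞ φ.symm (φ η) :=
    (contMDiffOn_extChartAt_symm η).contMDiffAt (extChartAt_target_mem_nhds η)
  have hprod : ContMDiffAt 𝓘(ℝ, ℝ × (E × (E →L[ℝ] ℝ))) (𝓘(ℝ, ℝ).prod (CotangentModel E)) ∞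
      (fun p : ℝ × (E × (E →L[ℝ] ℝ)) => (p.1, φ.symm p.2)) ((0 : ℝ), φ η) :=
    ContMDiffAt.prodMk contDiff_fst.contMDiff.contMDiffAt
      (ContMDiffAt.comp ((0 : ℝ), φ η) hsymm contDiff_snd.contMDiff.contMDiffAt)
  have hΦ : ContDiffAt ℝ 2 Φ (0, φ η) := by
    rw [← contMDiffAt_iff_contDiffAt]
    refine ContMDiffAt.of_le (n := ∞) ?_ (WithTop.coe_le_coe.2 le_top)
    have hA : ContMDiffAt 𝓘(ℝ, ℝ × (E × (E →L[ℝ] ℝ))) (CotangentModel E) ∞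
        (fun p : ℝ × (E × (E →L[ℝ] ℝ)) => Ψ p.1 (φ.symm p.2)) ((0 : ℝ), φ η) :=
      ContMDiffAt.comp (g := fun p : ℝ × Cotangent 𝓘(ℝ, E) M => Ψ p.1 p.2) (0, φ η)
        (by dsimp only; rw [hl]; exact hΨ) hprod
    exact ContMDiffAt.comp (g := φ) ((0 : ℝ), φ η)
      (by dsimp only; rw [hl, hid]; exact contMDiffAt_extChartAt) hA
  have hdiff := eventually_differentiableAt_of_contDiffAt hΦ
  have hten : Filter.Tendsto (fun p : ℝ × (E × (E →L[ℝ] ℝ)) => (p.1, φ.symm p.2))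
      (𝓝 ((0 : ℝ), φ η)) (𝓝 ((0 : ℝ), η)) := by
    have := hprod.continuousAt.tendsto
    dsimp only at this
    rwa [hl] at this
  have htgt : ∀ᶠ z in 𝓝 (φ η), z ∈ φ.target := extChartAt_target_mem_nhds η
  have hΨe := (contMDiffAt_iff_contMDiffAt_nhds (n := 1) (by simp)).1
    (hΨ.of_le (show (1 : ℕ∞ω) ≤ ∞ by simp))
  have hsrc : ∀ᶠ p in 𝓝 ((0 : ℝ), η), Ψ p.1 p.2 ∈ (chartAt (ModelProd E (E →L[ℝ] ℝ)) η).source := by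
    apply hΨ.continuousAt.preimage_mem_nhds
    dsimp only
    rw [hid]
    exact (chartAt (ModelProd E (E →L[ℝ] ℝ)) η).open_source.mem_nhds (mem_chart_source _ η)
  have hinr : Filter.Tendsto (fun z : E × (E →L[ℝ] ℝ) => ((0 : ℝ), z)) (𝓝 (φ η))
      (𝓝 ((0 : ℝ), φ η)) := (Continuous.prodMk_right (0 : ℝ)).tendsto _
  -- the partial derivative of `Φ` with respect to time
  have htime : ∀ᶠ z in 𝓝 (φ η), fderiv ℝ Φ (0, z) (1, 0) =
      mfderiv (CotangentModel E) 𝓘(ℝ, E × (E →L[ℝ] ℝ)) φ (Ψ 0 (φ.symm z))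
        (mfderiv 𝓘(ℝ, ℝ) (CotangentModel E) (fun s => Ψ s (φ.symm z)) 0 (1 : ℝ)) := by
    filter_upwards [hinr.eventually hdiff, hinr.eventually (hten.eventually hΨe),
      hinr.eventually (hten.eventually hsrc)] with z hz1 hz2 hz3
    have h1 : MDifferentiableAt 𝓘(ℝ, ℝ) (CotangentModel E) (fun s => Ψ s (φ.symm z)) 0 := by
      have : ContMDiffAt 𝓘(ℝ, ℝ) (CotangentModel E) 1 (fun s => Ψ s (φ.symm z)) 0 :=
        ContMDiffAt.comp (g := fun p : ℝ × Cotangent 𝓘(ℝ, E) M => Ψ p.1 p.2)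
          (f := fun s : ℝ => (s, φ.symm z)) 0 hz2 (contMDiffAt_id.prodMk contMDiffAt_const)
      exact this.mdifferentiableAt (by simp)
    have h2 : HasMFDerivAt 𝓘(ℝ, ℝ) 𝓘(ℝ, E × (E →L[ℝ] ℝ)) (φ ∘ fun s => Ψ s (φ.symm z)) 0 _ :=
      HasMFDerivAt.comp (0 : ℝ) (mdifferentiableAt_extChartAt hz3).hasMFDerivAt h1.hasMFDerivAt
    exact HasFDerivAt.apply_partial_left hz1 h2.hasFDerivAt
  have hspace : ∀ᶠ p in 𝓝 ((0 : ℝ), φ η), ∀ v, (Φ p).2 ((fderiv ℝ Φ p (0, v)).1) = p.2.2 v.1 := by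
    filter_upwards [hdiff, hten.eventually hΨe, hten.eventually hsrc, hten.eventually hθ,
      (continuous_snd.tendsto ((0 : ℝ), φ η)).eventually htgt]
    rintro ⟨s, z⟩ h1 h2 h3 h4 h5 v
    have hzs : φ.symm z ∈ (chartAt (ModelProd E (E →L[ℝ] ℝ)) η).source := by
      have := φ.map_target h5
      rwa [hφ, extChartAt_source] at this
    have hr : φ (φ.symm z) = z := φ.right_inv h5
    have hm : MDifferentiableAt (CotangentModel E) (CotangentModel E) (Ψ s) (φ.symm z) := by
      have : ContMDiffAt (CotangentModel E) (CotangentModel E) 1 (Ψ s) (φ.symm z) :=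
        ContMDiffAt.comp (g := fun p : ℝ × Cotangent 𝓘(ℝ, E) M => Ψ p.1 p.2)
          (f := fun ζ => (s, ζ)) _ h2 (contMDiffAt_const.prodMk contMDiffAt_id)
      exact this.mdifferentiableAt (by simp)
    obtain ⟨L, hL, hL'⟩ := hasFDerivAt_writtenInCharts hm hzs h3
    have hL2 : HasFDerivAt (fun z => Φ (s, z)) L z := by
      have := hL
      rw [hr] at this
      exact this
    set d := mfderiv 𝓘(ℝ, E × (E →L[ℝ] ℝ)) (CotangentModel E) φ.symm z v with hd
    have hv : mfderiv (CotangentModel E) 𝓘(ℝ, E × (E →L[ℝ] ℝ)) φ (φ.symm z) d = v :=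
      mfderiv_extChartAt_apply_mfderiv_symm (I := CotangentModel E) h5 v
    have e0 := HasFDerivAt.apply_partial_right h1 hL2 v
    have e1 := liouvilleForm_eq_chart (mem_chart_source_cotangent.1 hzs) d
    have e2 := liouvilleForm_eq_chart (mem_chart_source_cotangent.1 h3)
      (mfderiv (CotangentModel E) (CotangentModel E) (Ψ s) (φ.symm z) d)
    have e3 := hL' d
    rw [e0]
    have e4 : L v = mfderiv (CotangentModel E) 𝓘(ℝ, E × (E →L[ℝ] ℝ)) φ (Ψ s (φ.symm z))
        (mfderiv (CotangentModel E) (CotangentModel E) (Ψ s) (φ.symm z) d) :=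
      (congrArg L hv.symm).trans e3
    refine (congrArg (fun w : E × (E →L[ℝ] ℝ) => (Φ (s, z)).2 w.1) e4).trans ?_
    refine e2.symm.trans ((h4 d).trans (e1.trans ?_))
    change (φ (φ.symm z)).2 (mfderiv (CotangentModel E) 𝓘(ℝ, E × (E →L[ℝ] ℝ)) φ (φ.symm z) d).1 = _
    rw [hr]
    exact congrArg (fun w : E × (E →L[ℝ] ℝ) => z.2 w.1) hv
  have hid' : ∀ᶠ z in 𝓝 (φ η), Φ (0, z) = z := by
    filter_upwards [htgt] with z hz
    change φ (Ψ 0 (φ.symm z)) = z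
    rw [hid, φ.right_inv hz]
  have hmain := hasFDerivAt_pairing_of_preserves (ContinuousLinearMap.id ℝ (E →L[ℝ] ℝ)) hΦ hid'
    hspace
  have hJφ : J =ᶠ[𝓝 η] (fun z : E × (E →L[ℝ] ℝ) => z.2 (fderiv ℝ Φ (0, z) (1, 0)).1) ∘ φ := by
    have hφc : Filter.Tendsto φ (𝓝 η) (𝓝 (φ η)) := continuousAt_extChartAt η
    have hs0 : ∀ᶠ ζ in 𝓝 η, ζ ∈ φ.source := extChartAt_source_mem_nhds η
    filter_upwards [hJ, hφc.eventually htime, hs0] with ζ h1 h2 h3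
    rw [φ.left_inv h3] at h2
    have h4 : (Ψ 0 ζ).1 ∈ (chartAt E η.1).source := by
      rw [hid, ← mem_chart_source_cotangent, ← extChartAt_source (CotangentModel E)]
      exact h3
    rw [h1, liouvilleForm_eq_chart h4, Function.comp_apply, h2]
    rw [hid]
  have hcomp : HasMFDerivAt (CotangentModel E) 𝓘(ℝ, ℝ) J η _ :=
    (HasMFDerivAt.comp η hmain.hasMFDerivAt
      (mdifferentiableAt_extChartAt (mem_chart_source _ η)).hasMFDerivAt).congr_of_eventuallyEq hJφ
  refine ⟨hcomp.mdifferentiableAt, fun ξ => ?_⟩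
  rw [hcomp.mfderiv]
  have h1 : mfderiv (CotangentModel E) 𝓘(ℝ, E × (E →L[ℝ] ℝ)) φ η ξ = ξ :=
    mfderiv_extChartAt_self_apply rfl ξ
  have h2 := htime.self_of_nhds
  rw [hl] at h2
  have h3 : fderiv ℝ Φ (0, φ η) (1, 0) =
      mfderiv 𝓘(ℝ, ℝ) (CotangentModel E) (fun s => Ψ s η) 0 (1 : ℝ) :=
    h2.trans (mfderiv_extChartAt_self_apply (hid η) _)
  exact congrArg₂ (fun a b : E × (E →L[ℝ] ℝ) => canonicalForm E a b) h3 h1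

/-- Noether's theorem at a point: the momentum function of a one-parameter family of maps
preserving the Liouville form is annihilated by the Hamiltonian vector field of every function
invariant under the family. -/
lemma mfderiv_momentum_hamiltonianVectorField [FiniteDimensional ℝ E]
    {Ψ : ℝ → Cotangent 𝓘(ℝ, E) M → Cotangent 𝓘(ℝ, E) M} {η : Cotangent 𝓘(ℝ, E) M}
    (hΨ : ContMDiffAt (𝓘(ℝ, ℝ).prod (CotangentModel E)) (CotangentModel E) ∞
      (fun p : ℝ × Cotangent 𝓘(ℝ, E) M => Ψ p.1 p.2) (0, η))
    (hid : ∀ ζ, Ψ 0 ζ = ζ)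
    (hθ : ∀ᶠ p in 𝓝 ((0 : ℝ), η), ∀ ξ : TangentSpace (CotangentModel E) p.2,
      liouvilleForm 𝓘(ℝ, E) (Ψ p.1 p.2)
        (mfderiv (CotangentModel E) (CotangentModel E) (Ψ p.1) p.2 ξ) =
          liouvilleForm 𝓘(ℝ, E) p.2 ξ)
    {J : Cotangent 𝓘(ℝ, E) M → ℝ}
    (hJ : ∀ᶠ ζ in 𝓝 η, J ζ = liouvilleForm 𝓘(ℝ, E) (Ψ 0 ζ)
      (mfderiv 𝓘(ℝ, ℝ) (CotangentModel E) (fun s => Ψ s ζ) 0 (1 : ℝ)))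
    {f : Cotangent 𝓘(ℝ, E) M → ℝ} (hf : MDifferentiableAt (CotangentModel E) 𝓘(ℝ, ℝ) f η)
    (hinv : ∀ᶠ s in 𝓝 (0 : ℝ), f (Ψ s η) = f η) :
    MDifferentiableAt (CotangentModel E) 𝓘(ℝ, ℝ) J η ∧
      mfderiv (CotangentModel E) 𝓘(ℝ, ℝ) J η (hamiltonianVectorField 𝓘(ℝ, E) f η) = 0 := by
  obtain ⟨h1, h2⟩ := mfderiv_momentum_of_preserves hΨ hid hθ hJ
  refine ⟨h1, ?_⟩
  set Z : E × (E →L[ℝ] ℝ) :=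
    mfderiv 𝓘(ℝ, ℝ) (CotangentModel E) (fun s => Ψ s η) 0 (1 : ℝ) with hZ
  have h3 := canonicalForm_hamiltonianVectorField f η Z
  have hd : MDifferentiableAt 𝓘(ℝ, ℝ) (CotangentModel E) (fun s => Ψ s η) 0 :=
    (ContMDiffAt.comp (g := fun p : ℝ × Cotangent 𝓘(ℝ, E) M => Ψ p.1 p.2)
      (f := fun s : ℝ => (s, η)) 0 hΨ
        (contMDiffAt_id.prodMk contMDiffAt_const)).mdifferentiableAt (by simp)
  have h4 : HasMFDerivAt 𝓘(ℝ, ℝ) 𝓘(ℝ, ℝ) (f ∘ fun s => Ψ s η) 0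
      ((mfderiv (CotangentModel E) 𝓘(ℝ, ℝ) f η).comp
        (mfderiv 𝓘(ℝ, ℝ) (CotangentModel E) (fun s => Ψ s η) 0)) :=
    HasMFDerivAt.comp (0 : ℝ) (by rw [hid]; exact hf.hasMFDerivAt) hd.hasMFDerivAt
  have h5 := hasMFDerivAt_unique h4 ((hasMFDerivAt_const (f η) (0 : ℝ)).congr_of_eventuallyEq hinv)
  have h6 : mfderiv (CotangentModel E) 𝓘(ℝ, ℝ) f η Z = 0 := DFunLike.congr_fun h5 (1 : ℝ)
  exact (h2 _).trans ((canonicalForm_swap _ _).trans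
    ((congrArg Neg.neg (h3.trans h6)).trans neg_zero))

end Noether

/-! ### Cotangent lifts -/

section CotangentLift

variable {E : Type*} [NormedAddCommGroup E] [NormedSpace ℝ E]
  {M : Type*} [TopologicalSpace M] [ChartedSpace E M]
  [IsManifold 𝓘(ℝ, E) ∞ M] [IsManifold 𝓘(ℝ, E) 1 M]
  {E' : Type*} [NormedAddCommGroup E'] [NormedSpace ℝ E'] {H' : Type*} [TopologicalSpace H']
  {J : ModelWithCorners ℝ E' H'} {N : Type*} [TopologicalSpace N] [ChartedSpace H' N]

lemma contMDiffAt_cotangent_iff {F : N → Cotangent 𝓘(ℝ, E) M} {y₀ : N} {k : ℕ∞ω} :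
    ContMDiffAt J (CotangentModel E) k F y₀ ↔ ContMDiffAt J 𝓘(ℝ, E) k (fun y => (F y).1) y₀ ∧
      ContMDiffAt J 𝓘(ℝ, E →L[ℝ] ℝ) k
        (fun y => (extChartAt (CotangentModel E) (F y₀) (F y)).2) y₀ :=
  contMDiffAt_hom_bundle F

/-- The cotangent lifts of a smooth family of local diffeomorphisms form a smooth family, also when
the covector varies with the parameter. -/
lemma contMDiffAt_cotangentLift [CompleteSpace E] [IsManifold J ∞ N] {Ψ : N → M → M}
    {G : N → Cotangent 𝓘(ℝ, E) M} {s₀ : N}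
    (hΨ : ContMDiffAt (J.prod 𝓘(ℝ, E)) 𝓘(ℝ, E) ∞ (Function.uncurry Ψ) (s₀, (G s₀).1))
    (hG : ContMDiffAt J (CotangentModel E) ∞ G s₀)
    (hinv : ∀ s x, (mfderiv 𝓘(ℝ, E) 𝓘(ℝ, E) (Ψ s) x).IsInvertible) :
    ContMDiffAt J (CotangentModel E) ∞ (fun s => cotangentLift 𝓘(ℝ, E) (Ψ s) (G s)) s₀ := by
  obtain ⟨hG1, hG2⟩ := contMDiffAt_cotangent_iff.1 hG
  have hbase : ContMDiffAt J 𝓘(ℝ, E) ∞ (fun s => Ψ s (G s).1) s₀ :=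
    ContMDiffAt.comp (g := Function.uncurry Ψ) s₀ hΨ (contMDiffAt_id.prodMk hG1)
  refine contMDiffAt_cotangent_iff.2 ⟨hbase, ?_⟩
  have hA := ContMDiffAt.mfderiv (m := ∞) (n := ∞) Ψ (fun s => (G s).1) hΨ hG1 (by simp)
  set A : N → E →L[ℝ] E := inTangentCoordinates 𝓘(ℝ, E) 𝓘(ℝ, E) (fun s => (G s).1)
    (fun s => Ψ s (G s).1) (fun s => mfderiv 𝓘(ℝ, E) 𝓘(ℝ, E) (Ψ s) (G s).1) s₀ with hAdef
  have hev1 : ∀ᶠ s in 𝓝 s₀, (G s).1 ∈ (chartAt E (G s₀).1).source :=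
    hG1.continuousAt.preimage_mem_nhds
      ((chartAt E (G s₀).1).open_source.mem_nhds (mem_chart_source E _))
  have hev2 : ∀ᶠ s in 𝓝 s₀, Ψ s (G s).1 ∈ (chartAt E (Ψ s₀ (G s₀).1)).source :=
    hbase.continuousAt.preimage_mem_nhds
      ((chartAt E (Ψ s₀ (G s₀).1)).open_source.mem_nhds (mem_chart_source E _))
  have hAeq : ∀ s, (G s).1 ∈ (chartAt E (G s₀).1).source →
      Ψ s (G s).1 ∈ (chartAt E (Ψ s₀ (G s₀).1)).source →
      A s = (mfderiv 𝓘(ℝ, E) 𝓘(ℝ, E) (extChartAt 𝓘(ℝ, E) (Ψ s₀ (G s₀).1)) (Ψ s (G s).1)) ∘L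
        (mfderiv 𝓘(ℝ, E) 𝓘(ℝ, E) (Ψ s) (G s).1) ∘L (mfderiv 𝓘(ℝ, E) 𝓘(ℝ, E)
          (extChartAt 𝓘(ℝ, E) (G s₀).1).symm (extChartAt 𝓘(ℝ, E) (G s₀).1 (G s).1)) := by
    intro s h1 h2
    refine (inTangentCoordinates_eq_mfderiv_comp (I := 𝓘(ℝ, E)) (I' := 𝓘(ℝ, E))
      (f := fun s => (G s).1) (g := fun s => Ψ s (G s).1)
      (ϕ := fun s => mfderiv 𝓘(ℝ, E) 𝓘(ℝ, E) (Ψ s) (G s).1) (x₀ := s₀) (x := s) h1 h2).trans ?_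
    rw [ModelWithCorners.range_eq_univ, mfderivWithin_univ]
  have hAinv : ∀ s, (G s).1 ∈ (chartAt E (G s₀).1).source →
      Ψ s (G s).1 ∈ (chartAt E (Ψ s₀ (G s₀).1)).source → (A s).IsInvertible := by
    intro s h1 h2
    rw [hAeq s h1 h2]
    have i1 := isInvertible_mfderiv_extChartAt (I := 𝓘(ℝ, E)) (x := Ψ s₀ (G s₀).1)
      (y := Ψ s (G s).1) (by rwa [extChartAt_source])
    have i2 := isInvertible_mfderivWithin_extChartAt_symm (I := 𝓘(ℝ, E)) (x := (G s₀).1)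
      (y := extChartAt 𝓘(ℝ, E) (G s₀).1 (G s).1)
      ((extChartAt 𝓘(ℝ, E) (G s₀).1).map_source (by rwa [extChartAt_source]))
    rw [ModelWithCorners.range_eq_univ, mfderivWithin_univ] at i2
    have i3 := hinv s (G s).1
    have hc : ∀ a b c : E →L[ℝ] E, a.IsInvertible → b.IsInvertible → c.IsInvertible →
      (a ∘L b ∘L c).IsInvertible := fun a b c ha hb hc => ha.comp (hb.comp hc)
    exact hc _ _ _ i1 i3 i2
  have hAi : ContMDiffAt J 𝓘(ℝ, E →L[ℝ] E) ∞ (fun s => (A s).inverse) s₀ := by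
    obtain ⟨e, he⟩ := hAinv s₀ (mem_chart_source E _) (mem_chart_source E _)
    have h1 : ContDiffAt ℝ ∞ (ContinuousLinearMap.inverse : (E →L[ℝ] E) → (E →L[ℝ] E)) (A s₀) := by
      rw [← he]
      exact contDiffAt_map_inverse e
    exact h1.contMDiffAt.comp s₀ hA
  refine ContMDiffAt.congr_of_eventuallyEq (hG2.clm_comp hAi) ?_
  filter_upwards [hev1, hev2] with s h1 h2
  have hA1 := hAinv s h1 h2
  obtain ⟨e, he⟩ := hA1
  rw [← he, ContinuousLinearMap.inverse_equiv]
  ext v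
  obtain ⟨w, rfl⟩ := e.surjective v
  have hew : e w = A s w := by rw [← he]; rfl
  rw [ContinuousLinearMap.comp_apply, ContinuousLinearEquiv.coe_coe, e.symm_apply_apply, hew,
    hAeq s h1 h2]
  rw [extChartAt_cotangent (G s₀) (G s) h1]
  refine (extChartAt_cotangent_snd_mfderiv (cotangentLift 𝓘(ℝ, E) (Ψ s₀) (G s₀))
    (cotangentLift 𝓘(ℝ, E) (Ψ s) (G s)) h2 _).trans ?_
  have i3 := hinv s (G s).1
  exact congrArg (G s).2 (i3.inverse_apply_self _)

/-- The cotangent lift of a local diffeomorphism preserves the Liouville form. -/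
lemma liouvilleForm_cotangentLift {f : M → M} {η : Cotangent 𝓘(ℝ, E) M}
    (hf : MDifferentiableAt 𝓘(ℝ, E) 𝓘(ℝ, E) f η.1)
    (hinv : (mfderiv 𝓘(ℝ, E) 𝓘(ℝ, E) f η.1).IsInvertible)
    (hF : MDifferentiableAt (CotangentModel E) (CotangentModel E) (cotangentLift 𝓘(ℝ, E) f) η)
    (ξ : TangentSpace (CotangentModel E) η) :
    liouvilleForm 𝓘(ℝ, E) (cotangentLift 𝓘(ℝ, E) f η)
      (mfderiv (CotangentModel E) (CotangentModel E) (cotangentLift 𝓘(ℝ, E) f) η ξ) =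
        liouvilleForm 𝓘(ℝ, E) η ξ := by
  have hτ : ∀ ζ : Cotangent 𝓘(ℝ, E) M, MDifferentiableAt (CotangentModel E) 𝓘(ℝ, E)
      (fun η : Cotangent 𝓘(ℝ, E) M => η.1) ζ :=
    fun ζ => (contMDiff_cotangent_proj ζ).mdifferentiableAt (by simp)
  have h1 : HasMFDerivAt (CotangentModel E) 𝓘(ℝ, E)
      ((fun η : Cotangent 𝓘(ℝ, E) M => η.1) ∘ cotangentLift 𝓘(ℝ, E) f) η _ :=
    HasMFDerivAt.comp η (hτ _).hasMFDerivAt hF.hasMFDerivAt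
  have h2 : HasMFDerivAt (CotangentModel E) 𝓘(ℝ, E)
      (f ∘ (fun η : Cotangent 𝓘(ℝ, E) M => η.1)) η _ :=
    HasMFDerivAt.comp η hf.hasMFDerivAt (hτ η).hasMFDerivAt
  have h3 := DFunLike.congr_fun (hasMFDerivAt_unique h1 h2) ξ
  refine (congrArg (fun v : E => (η.2 : TangentSpace 𝓘(ℝ, E) η.1 →L[ℝ] ℝ)
    ((mfderiv 𝓘(ℝ, E) 𝓘(ℝ, E) f η.1).inverse v)) h3).trans ?_
  exact congrArg (η.2 : TangentSpace 𝓘(ℝ, E) η.1 →L[ℝ] ℝ) (hinv.inverse_apply_self _)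

lemma cotangentLift_apply_mfderiv {f : M → M} {η : Cotangent 𝓘(ℝ, E) M}
    (hinv : (mfderiv 𝓘(ℝ, E) 𝓘(ℝ, E) f η.1).IsInvertible) (v : TangentSpace 𝓘(ℝ, E) η.1) :
    ((cotangentLift 𝓘(ℝ, E) f η).2 : TangentSpace 𝓘(ℝ, E) (f η.1) →L[ℝ] ℝ)
      (mfderiv 𝓘(ℝ, E) 𝓘(ℝ, E) f η.1 v) = (η.2 : TangentSpace 𝓘(ℝ, E) η.1 →L[ℝ] ℝ) v :=
  congrArg (η.2 : TangentSpace 𝓘(ℝ, E) η.1 →L[ℝ] ℝ) (hinv.inverse_apply_self v)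

lemma cotangent_ext {η ζ : Cotangent 𝓘(ℝ, E) M} (h : η.1 = ζ.1)
    (h' : ∀ v : E, (η.2 : E →L[ℝ] ℝ) v = (ζ.2 : E →L[ℝ] ℝ) v) : η = ζ := by
  obtain ⟨x, α⟩ := η
  obtain ⟨x', α'⟩ := ζ
  obtain rfl : x = x' := h
  congr 1
  exact ContinuousLinearMap.ext h'

lemma cotangentLift_id (η : Cotangent 𝓘(ℝ, E) M) : cotangentLift 𝓘(ℝ, E) id η = η := by
  refine cotangent_ext rfl fun v => ?_
  have h : (mfderiv 𝓘(ℝ, E) 𝓘(ℝ, E) (id : M → M) η.1).IsInvertible := by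
    rw [mfderiv_id]
    exact ⟨ContinuousLinearEquiv.refl ℝ _, rfl⟩
  have := cotangentLift_apply_mfderiv (f := id) (η := η) h v
  rw [mfderiv_id] at this
  exact this

lemma cotangentLift_comp {f g : M → M} {η : Cotangent 𝓘(ℝ, E) M}
    (hg : MDifferentiableAt 𝓘(ℝ, E) 𝓘(ℝ, E) g η.1)
    (hf : MDifferentiableAt 𝓘(ℝ, E) 𝓘(ℝ, E) f (g η.1))
    (hig : (mfderiv 𝓘(ℝ, E) 𝓘(ℝ, E) g η.1).IsInvertible) :
    cotangentLift 𝓘(ℝ, E) f (cotangentLift 𝓘(ℝ, E) g η) = cotangentLift 𝓘(ℝ, E) (f ∘ g) η := by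
  refine cotangent_ext rfl fun v => ?_
  have h1 : (mfderiv 𝓘(ℝ, E) 𝓘(ℝ, E) (f ∘ g) η.1).inverse =
      (mfderiv 𝓘(ℝ, E) 𝓘(ℝ, E) g η.1).inverse ∘L (mfderiv 𝓘(ℝ, E) 𝓘(ℝ, E) f (g η.1)).inverse := by
    rw [mfderiv_comp η.1 hf hg]
    exact hig.inverse_comp_of_right
  exact congrArg (η.2 : TangentSpace 𝓘(ℝ, E) η.1 →L[ℝ] ℝ) (DFunLike.congr_fun h1 v).symm

end CotangentLift

section Inverse

variable {E : Type*} [NormedAddCommGroup E] [NormedSpace ℝ E] {H : Type*} [TopologicalSpace H]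
  {I : ModelWithCorners ℝ E H} {M : Type*} [TopologicalSpace M] [ChartedSpace H M]

lemma isInvertible_mfderiv_of_inverse {f g : M → M} {x : M}
    (hgf : Function.LeftInverse g f) (hfg : Function.RightInverse g f)
    (hf : MDifferentiable I I f) (hg : MDifferentiable I I g) :
    (mfderiv I I f x).IsInvertible := by
  have h1 : (mfderiv I I g (f x)).comp (mfderiv I I f x) = ContinuousLinearMap.id ℝ _ := by
    rw [← mfderiv_comp x (hg _) (hf x), hgf.comp_eq_id, mfderiv_id]
  have h2 : (mfderiv I I f (g (f x))).comp (mfderiv I I g (f x)) = ContinuousLinearMap.id ℝ _ := by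
    rw [← mfderiv_comp (f x) (hf _) (hg _), hfg.comp_eq_id, mfderiv_id]
  rw [hgf x] at h2
  exact ContinuousLinearMap.IsInvertible.of_inverse h2 h1

end Inverse

/-! ### Integral curves and tangency -/

section Tangency

variable {E : Type*} [NormedAddCommGroup E] [NormedSpace ℝ E] {H : Type*} [TopologicalSpace H]
  {I : ModelWithCorners ℝ E H} {M : Type*} [TopologicalSpace M] [ChartedSpace H M]
  [IsManifold I ∞ M] [IsManifold I 1 M]
  {E' : Type*} [NormedAddCommGroup E'] [NormedSpace ℝ E'] {H' : Type*} [TopologicalSpace H']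
  {I' : ModelWithCorners ℝ E' H'} {M' : Type*} [TopologicalSpace M'] [ChartedSpace H' M']
  [IsManifold I' ∞ M'] [IsManifold I' 1 M']
  {E'' : Type*} [NormedAddCommGroup E''] [NormedSpace ℝ E''] {H'' : Type*} [TopologicalSpace H'']
  {J : ModelWithCorners ℝ E'' H''} {N : Type*} [TopologicalSpace N] [ChartedSpace H'' N]
  [IsManifold J ∞ N] [IsManifold J 1 N]

lemma contMDiffAt_mfderiv_apply {f : N → M → M'} {g : N → M} {V : ∀ y, TangentSpace I (g y)}
    {y₀ : N} (hf : ContMDiffAt (J.prod I) I' ∞ (Function.uncurry f) (y₀, g y₀))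
    (hV : ContMDiffAt J I.tangent ∞ (fun y => (⟨g y, V y⟩ : TangentBundle I M)) y₀) :
    ContMDiffAt J I'.tangent ∞
      (fun y => (⟨f y (g y), mfderiv I I' (f y) (g y) (V y)⟩ : TangentBundle I' M')) y₀ := by
  have hg : ContMDiffAt J I ∞ g y₀ := (contMDiffAt_totalSpace.1 hV).1
  have h1 := ContMDiffAt.mfderiv (m := ∞) f g hf hg (by simp)
  exact ContMDiffAt.clm_apply_of_inCoordinates h1 hV
    (ContMDiffAt.comp (g := Function.uncurry f) (f := fun y => (y, g y)) y₀ hf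
      (contMDiffAt_id.prodMk hg))

variable [I.Boundaryless]

/-- Integral curves of a smooth vector field are smooth: their velocity is as regular as they are
themselves. -/
lemma contMDiffAt_of_isMIntegralCurveAt {v : ∀ x : M, TangentSpace I x}
    (hv : ContMDiff I I.tangent ∞ (fun x => (⟨x, v x⟩ : TangentBundle I M)))
    {γ : ℝ → M} {s : Set ℝ} (hγ : ∀ t ∈ s, IsMIntegralCurveAt γ v t) {t : ℝ} (ht : t ∈ s) :
    ContMDiffAt 𝓘(ℝ, ℝ) I ∞ γ t := by
  rw [contMDiffAt_infty]
  intro k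
  induction k generalizing t with
  | zero =>
    refine contMDiffAt_iff_target.2 ⟨(hγ t ht).continuousAt, ?_⟩
    rw [contMDiffAt_iff_contDiffAt]
    refine contDiffAt_zero.2 ⟨_, (hγ t ht).and ((hγ t ht).continuousAt.eventually_mem
      ((chartAt H (γ t)).open_source.mem_nhds (mem_chart_source _ _))), fun t' ht' => ?_⟩
    exact ((continuousAt_extChartAt' (by rw [extChartAt_source]; exact ht'.2)).comp
      ht'.1.continuousAt).continuousWithinAt
  | succ k ih =>
    have hc : ContinuousAt γ t := (hγ t ht).continuousAt
    refine contMDiffAt_iff_target.2 ⟨hc, ?_⟩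
    rw [contMDiffAt_iff_contDiffAt]
    have h1 : ContMDiffAt 𝓘(ℝ, ℝ) I.tangent k (fun t => (⟨γ t, v (γ t)⟩ : TangentBundle I M)) t :=
      ((hv (γ t)).of_le (by exact_mod_cast le_top)).comp t (ih ht)
    have h2 := (contMDiffAt_tangentBundle_iff (ih ht)).1 h1
    have h3 : ContDiffAt ℝ (k + 1 : ℕ) (extChartAt I (γ t) ∘ γ) t := by
      refine contDiffAt_succ_iff_hasFDerivAt.2 ⟨fun t' => (1 : ℝ →L[ℝ] ℝ).smulRight
        (mfderiv I 𝓘(ℝ, E) (extChartAt I (γ t)) (γ t') (v (γ t')) : E), ?_, ?_⟩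
      · have h4 : ∀ᶠ t' in 𝓝 t, HasMFDerivAt 𝓘(ℝ, ℝ) I γ t'
          ((1 : ℝ →L[ℝ] ℝ).smulRight (v (γ t'))) ∧ γ t' ∈ (chartAt H (γ t)).source := by
          refine (hγ t ht).and (hc.eventually_mem ?_)
          exact (chartAt H (γ t)).open_source.mem_nhds (mem_chart_source _ _)
        refine ⟨_, h4, fun t' ht' => ?_⟩
        have h5 := (mdifferentiableAt_extChartAt (I := I) ht'.2).hasMFDerivAt.comp t' ht'.1
        have h6 := hasMFDerivAt_iff_hasFDerivAt.1 h5
        refine Eq.mpr ?_ h6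
        refine congrArg (fun L => HasFDerivAt _ L t') (ContinuousLinearMap.ext fun r => ?_)
        exact ((mfderiv I 𝓘(ℝ, E) (extChartAt I (γ t)) (γ t')).map_smul r (v (γ t'))).symm
      · exact (contDiffAt_const (c := (1 : ℝ →L[ℝ] ℝ))).smulRight h2.contDiffAt
    exact h3

lemma exists_integralCurve {v : ∀ x : M, TangentSpace I x} [CompleteSpace E]
    (hv : ContMDiff I I.tangent ∞ (fun x => (⟨x, v x⟩ : TangentBundle I M))) (x : M) :
    ∃ ε > 0, ∃ γ : ℝ → M, γ 0 = x ∧ IsMIntegralCurveOn γ v (Set.Ioo (-ε) ε) ∧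
      ContMDiffOn 𝓘(ℝ, ℝ) I ∞ γ (Set.Ioo (-ε) ε) := by
  obtain ⟨γ, h0, hγ⟩ := exists_isMIntegralCurveAt_of_contMDiffAt_boundaryless (t₀ := 0)
    ((hv x).of_le (by simp) : ContMDiffAt I I.tangent 1 _ x)
  obtain ⟨ε, hε, h⟩ := isMIntegralCurveAt_iff'.1 hγ
  rw [Real.ball_eq_Ioo, zero_sub, zero_add] at h
  refine ⟨ε, hε, γ, h0, h, fun t ht => ?_⟩
  exact (contMDiffAt_of_isMIntegralCurveAt hv
    ((isMIntegralCurveOn_iff_isMIntegralCurveAt isOpen_Ioo).1 h) ht).contMDiffWithinAt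

/-- A local integral curve can be replaced by a smooth curve on all of `ℝ` with the same velocity at
time `0` and values among those of the integral curve. -/
lemma isTangentTo_of_integralCurve {v : ∀ x : M, TangentSpace I x} {γ : ℝ → M} {ε : ℝ} (hε : 0 < ε)
    (hγ : IsMIntegralCurveOn γ v (Set.Ioo (-ε) ε))
    (hs : ContMDiffOn 𝓘(ℝ, ℝ) I ∞ γ (Set.Ioo (-ε) ε)) :
    ∃ c : ℝ → M, ContMDiff 𝓘(ℝ, ℝ) I ∞ c ∧ (∀ t, ∃ t' ∈ Set.Ioo (-ε) ε, c t = γ t') ∧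
      (⟨c 0, mfderiv 𝓘(ℝ, ℝ) I c 0 (1 : ℝ)⟩ : TangentBundle I M) = ⟨γ 0, v (γ 0)⟩ := by
  -- the new time has values in `(-ε, ε)`, and `s 0 = 0`, `s' 0 = 1`
  set s : ℝ → ℝ := fun t => (ε / 2) * Real.sin (2 / ε * t) with hsdef
  have hmem : ∀ t, s t ∈ Set.Ioo (-ε) ε := by
    intro t
    have h1 := Real.neg_one_le_sin (2 / ε * t)
    have h2 := Real.sin_le_one (2 / ε * t)
    constructor <;> simp only [hsdef] <;> nlinarith
  have hsm : ContDiff ℝ ∞ s :=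
    contDiff_const.mul (Real.contDiff_sin.comp (contDiff_const.mul contDiff_id))
  have hs0 : s 0 = 0 := by simp [hsdef]
  have hder : HasDerivAt s 1 0 := by
    have h1 : HasDerivAt (fun t : ℝ => 2 / ε * t) (2 / ε) 0 := by
      simpa using (hasDerivAt_id (0 : ℝ)).const_mul (2 / ε)
    have h2 := (h1.sin).const_mul (ε / 2)
    refine h2.congr_deriv ?_
    rw [mul_zero, Real.cos_zero]
    field_simp
  have h0 : (0 : ℝ) ∈ Set.Ioo (-ε) ε := ⟨by linarith, hε⟩
  refine ⟨γ ∘ s, fun t => ?_, fun t => ⟨s t, hmem t, rfl⟩, ?_⟩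
  · exact (hs.contMDiffAt (isOpen_Ioo.mem_nhds (hmem t))).comp t hsm.contMDiff.contMDiffAt
  · have h1 := (hγ.isMIntegralCurveAt (isOpen_Ioo.mem_nhds h0)).hasMFDerivAt
    rw [← hs0] at h1
    have h2 := h1.comp (0 : ℝ) hder.hasFDerivAt.hasMFDerivAt
    rw [h2.mfderiv]
    have : ∀ (y : M), y = γ 0 → (⟨y, v y⟩ : TangentBundle I M) = ⟨γ 0, v (γ 0)⟩ := by
      rintro _ rfl; rfl
    refine Eq.trans ?_ (this (γ (s 0)) (by rw [hs0]))
    refine congrArg (fun w : E => (⟨γ (s 0), w⟩ : TangentBundle I M)) ?_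
    exact (congrArg (fun c : ℝ => c • (v (γ (s 0)) : E))
      (show ((1 : ℝ) • (1 : ℝ)) = (1 : ℝ) by simp)).trans (one_smul _ _)

/-- A smooth vector field is tangent to a set that its integral curves do not leave. It is also
tangent to the connected components of the set, since integral curves are connected. -/
lemma isTangentTo_of_invariant [CompleteSpace E] {v : ∀ x : M, TangentSpace I x}
    (hv : ContMDiff I I.tangent ∞ (fun x => (⟨x, v x⟩ : TangentBundle I M))) {Z : Set M}
    (hZ : ∀ (γ : ℝ → M) (ε : ℝ), 0 < ε → IsMIntegralCurveOn γ v (Set.Ioo (-ε) ε) →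
      γ 0 ∈ Z → ∀ t ∈ Set.Ioo (-ε) ε, γ t ∈ Z) {x : M} (hx : x ∈ Z) :
    IsTangentTo I Z x (v x) ∧ ∀ ζ, x ∈ connectedComponentIn Z ζ →
      IsTangentTo I (connectedComponentIn Z ζ) x (v x) := by
  obtain ⟨ε, hε, γ, h0, hγ, hs⟩ := exists_integralCurve hv x
  obtain ⟨c, hc, hcγ, hd⟩ := isTangentTo_of_integralCurve hε hγ hs
  have hcZ : ∀ t, c t ∈ Z := by
    intro t
    obtain ⟨t', ht', h⟩ := hcγ t
    rw [h]
    exact hZ γ ε hε hγ (h0 ▸ hx) t' ht'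
  have hd' : (⟨c 0, mfderiv 𝓘(ℝ, ℝ) I c 0 (1 : ℝ)⟩ : TangentBundle I M) = ⟨x, v x⟩ := by
    rw [hd, h0]
  have hc0 : c 0 = x := congrArg TotalSpace.proj hd'
  refine ⟨⟨c, hc, hcZ, hd'⟩, fun ζ hζ => ⟨c, hc, fun t => ?_, hd'⟩⟩
  have h1 : Set.range c ⊆ connectedComponentIn Z x :=
    (isPreconnected_range hc.continuous).subset_connectedComponentIn ⟨0, hc0⟩
      (by rintro _ ⟨t, rfl⟩; exact hcZ t)
  rw [connectedComponentIn_eq hζ]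
  exact h1 ⟨t, rfl⟩

end Tangency

/-! ### Operators on initial submanifolds -/

section InitialSubmanifolds

universe u

variable {E : Type*} [NormedAddCommGroup E] [NormedSpace ℝ E] {H : Type*} [TopologicalSpace H]
  {I : ModelWithCorners ℝ E H} {M : Type u} [TopologicalSpace M] [ChartedSpace H M]
  [IsManifold I ∞ M] [IsManifold I 1 M]

/-- An immersion has smooth local left inverses. -/
lemma exists_localLeftInverse {k : ℕ} {Z' : Type*} [TopologicalSpace Z'] [ChartedSpace (Eucl k) Z']
    [IsManifold 𝓘(ℝ, Eucl k) ∞ Z'] {ι : Z' → M} {p : Z'}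
    (hι : Manifold.IsImmersionAt 𝓘(ℝ, Eucl k) I ∞ ι p) :
    ∃ r : M → Z', ContMDiffAt I 𝓘(ℝ, Eucl k) ∞ r (ι p) ∧ ∀ᶠ q in 𝓝 p, r (ι q) = q := by
  obtain ⟨F, _, _, h⟩ := hι
  have hw : ∀ q ∈ h.domChart.source,
      (h.equiv.symm (h.codChart.extend I (ι q))).1 = h.domChart q := by
    intro q hq
    have h0 : h.domChart q ∈ (h.domChart.extend 𝓘(ℝ, Eucl k)).target := by
      simpa using h.domChart.map_source hq
    have h1 := h.writtenInCharts h0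
    have h2 : h.codChart.extend I (ι q) = h.equiv (h.domChart q, 0) := by
      simpa [h.domChart.left_inv hq] using h1
    rw [h2, h.equiv.symm_apply_apply]
  refine ⟨fun x => h.domChart.symm (h.equiv.symm (h.codChart.extend I x)).1, ?_, ?_⟩
  · refine ContMDiffAt.comp (g := h.domChart.symm) (I' := 𝓘(ℝ, Eucl k)) (ι p) ?_ ?_
    · rw [hw p h.mem_domChart_source]
      exact contMDiffAt_symm_of_mem_maximalAtlas h.domChart_mem_maximalAtlas
        (h.domChart.map_source h.mem_domChart_source)
    · exact ((ContinuousLinearMap.fst ℝ (Eucl k) F).contDiff.comp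
        h.equiv.symm.contDiff).contMDiff.contMDiffAt.comp (ι p)
          (OpenPartialHomeomorph.contMDiffAt_extend h.codChart_mem_maximalAtlas
            h.mem_codChart_source)
  · filter_upwards [h.domChart.open_source.mem_nhds h.mem_domChart_source] with q hq
    rw [hw q hq, h.domChart.left_inv hq]

variable {E' : Type*} [NormedAddCommGroup E'] [NormedSpace ℝ E'] {H' : Type*} [TopologicalSpace H']
  {J : ModelWithCorners ℝ E' H'} {N : Type*} [TopologicalSpace N] [ChartedSpace H' N]
  [IsManifold J ∞ N] [IsManifold J 1 N]

/-- A vector tangent to the image of an initial submanifold comes from the submanifold. -/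
lemma exists_mfderiv_eq_of_isTangentTo {k : ℕ} {Z' : Type*} [TopologicalSpace Z']
    [ChartedSpace (Eucl k) Z'] [IsManifold 𝓘(ℝ, Eucl k) ∞ Z'] {ι : Z' → M}
    (hι : ContMDiff 𝓘(ℝ, Eucl k) I ∞ ι) (hinj : Function.Injective ι)
    (hini : ∀ c : ℝ → Z', ContMDiff 𝓘(ℝ, ℝ) I ∞ (ι ∘ c) → ContMDiff 𝓘(ℝ, ℝ) 𝓘(ℝ, Eucl k) ∞ c)
    {p : Z'} {ξ : TangentSpace I (ι p)} (hξ : IsTangentTo I (Set.range ι) (ι p) ξ) :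
    ∃ w : TangentSpace 𝓘(ℝ, Eucl k) p, mfderiv 𝓘(ℝ, Eucl k) I ι p w = ξ := by
  obtain ⟨c, hc, hcZ, hd⟩ := hξ
  choose c' hc' using hcZ
  obtain rfl : ι ∘ c' = c := funext hc'
  have hs := hini c' hc
  have h0 : c' 0 = p := hinj (congrArg TotalSpace.proj hd)
  subst h0
  refine ⟨mfderiv 𝓘(ℝ, ℝ) 𝓘(ℝ, Eucl k) c' 0 (1 : ℝ), ?_⟩
  have h1 := mfderiv_comp (0 : ℝ) ((hι (c' 0)).mdifferentiableAt (by simp))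
    ((hs 0).mdifferentiableAt (by simp))
  have h2 : (mfderiv 𝓘(ℝ, ℝ) I (ι ∘ c') 0 (1 : ℝ) : E) = ξ :=
    eq_of_heq (TotalSpace.mk.inj hd).2
  exact (DFunLike.congr_fun h1 (1 : ℝ)).symm.trans h2

/-- For the second half of `RestrictsTo`, tangency alone suffices: if `r` is a local left inverse of
`ι` near `p`, then `T r ∘ S` is the only possible lift of `S` near `p`, and it is smooth. -/
lemma restrictsTo_of_isTangentTo {S : ∀ (x : M) (y : N), TangentSpace J y →L[ℝ] TangentSpace I x}
    (hS : IsStratonovichOperator I J S) {Z : Set M}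
    (hZ : ∀ x ∈ Z, ∀ (y : N) (v : TangentSpace J y), IsTangentTo I Z x (S x y v)) :
    RestrictsTo I J S Z := by
  refine ⟨hZ, ?_⟩
  rintro k Z' _ _ _ ι hι hinj rfl hini
  have hιs : ContMDiff 𝓘(ℝ, Eucl k) I ∞ ι := hι.contMDiff
  have hι' : ∀ p, ∃ r : M → Z', ContMDiffAt I 𝓘(ℝ, Eucl k) ∞ r (ι p) ∧
      ∀ᶠ q in 𝓝 p, r (ι q) = q := fun p => exists_localLeftInverse (hι.isImmersionAt p)
  have hretr : ∀ (r : M → Z') (q : Z'), MDifferentiableAt I 𝓘(ℝ, Eucl k) r (ι q) →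
      (∀ᶠ q' in 𝓝 q, r (ι q') = q') → ∀ w : TangentSpace 𝓘(ℝ, Eucl k) q,
      (mfderiv I 𝓘(ℝ, Eucl k) r (ι q) (mfderiv 𝓘(ℝ, Eucl k) I ι q w) : Eucl k) = w := by
    intro r q hr hrq w
    have h1 := mfderiv_comp q hr ((hιs q).mdifferentiableAt (by simp))
    have h2 : mfderiv 𝓘(ℝ, Eucl k) 𝓘(ℝ, Eucl k) (r ∘ ι) q =
        mfderiv 𝓘(ℝ, Eucl k) 𝓘(ℝ, Eucl k) id q :=
      Filter.EventuallyEq.mfderiv_eq (show r ∘ ι =ᶠ[𝓝 q] id from hrq)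
    have h3 : (mfderiv 𝓘(ℝ, Eucl k) 𝓘(ℝ, Eucl k) (r ∘ ι) q : Eucl k →L[ℝ] Eucl k) w = w := by
      rw [h2, mfderiv_id]; rfl
    exact (DFunLike.congr_fun h1 w).symm.trans h3
  choose r hr hrι using hι'
  have htan : ∀ (p : Z') (y : N) (v : TangentSpace J y), ∃ w : TangentSpace 𝓘(ℝ, Eucl k) p,
      mfderiv 𝓘(ℝ, Eucl k) I ι p w = S (ι p) y v := fun p y v =>
    exists_mfderiv_eq_of_isTangentTo hιs hinj hini (hZ _ ⟨p, rfl⟩ y v)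
  -- the local left inverse is chosen anew at each point; `hS'ι` shows that the lift does not depend
  -- on the choice, which is what makes it smooth
  let S' : ∀ (p : Z') (y : N), TangentSpace J y →L[ℝ] TangentSpace 𝓘(ℝ, Eucl k) p := fun p y =>
    let D : E →L[ℝ] Eucl k := mfderiv I 𝓘(ℝ, Eucl k) (r p) (ι p)
    let T : E' →L[ℝ] E := S (ι p) y
    D.comp T
  have hS' : ∀ p y v, S' p y v =
    (mfderiv I 𝓘(ℝ, Eucl k) (r p) (ι p) (S (ι p) y v) : Eucl k) := fun _ _ _ => rfl
  have hS'ι : ∀ (p : Z') (y : N) (v : TangentSpace J y) (w : TangentSpace 𝓘(ℝ, Eucl k) p),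
      mfderiv 𝓘(ℝ, Eucl k) I ι p w = S (ι p) y v → S' p y v = w := by
    intro p y v w hw
    rw [hS', ← hw]
    exact hretr (r p) p ((hr p).mdifferentiableAt (by simp)) (hrι p) w
  refine ⟨S', ?_, fun p y v => ?_⟩
  · rintro ⟨p₀, z₀⟩
    have hA : ContMDiffAt (𝓘(ℝ, Eucl k).prod J.tangent) I.tangent ∞
        (fun x : Z' × TangentBundle J N =>
          (⟨ι x.1, S (ι x.1) x.2.1 x.2.2⟩ : TangentBundle I M)) (p₀, z₀) :=
      ContMDiffAt.comp (g := fun p : M × TangentBundle J N =>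
        (⟨p.1, S p.1 p.2.1 p.2.2⟩ : TangentBundle I M))
        (f := fun x : Z' × TangentBundle J N => (ι x.1, x.2)) (p₀, z₀) (hS _)
        (((hιs p₀).comp (p₀, z₀) contMDiffAt_fst).prodMk contMDiffAt_snd)
    have hB : ContMDiffAt (𝓘(ℝ, Eucl k).prod J.tangent) 𝓘(ℝ, Eucl k).tangent ∞
        (fun x : Z' × TangentBundle J N =>
          (⟨r p₀ (ι x.1), mfderiv I 𝓘(ℝ, Eucl k) (r p₀) (ι x.1) (S (ι x.1) x.2.1 x.2.2)⟩ :
            TangentBundle 𝓘(ℝ, Eucl k) Z')) (p₀, z₀) := by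
      refine contMDiffAt_mfderiv_apply (f := fun _ => r p₀)
        (g := fun x : Z' × TangentBundle J N => ι x.1) (V := fun x => S (ι x.1) x.2.1 x.2.2) ?_ hA
      exact (hr p₀).comp ((p₀, z₀), ι p₀) contMDiffAt_snd
    refine hB.congr_of_eventuallyEq ?_
    have h1 : ∀ᶠ q in 𝓝 p₀, MDifferentiableAt I 𝓘(ℝ, Eucl k) (r p₀) (ι q) := by
      have h2 : ∀ᶠ x in 𝓝 (ι p₀), ContMDiffAt I 𝓘(ℝ, Eucl k) 1 (r p₀) x :=
        (contMDiffAt_iff_contMDiffAt_nhds (n := 1) (by simp)).1 ((hr p₀).of_le (by simp))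
      exact (hιs.continuous.continuousAt.eventually h2).mono
        fun q hq => hq.mdifferentiableAt (by simp)
    have h2 : ∀ᶠ q in 𝓝 p₀, MDifferentiableAt I 𝓘(ℝ, Eucl k) (r p₀) (ι q) ∧
        ∀ᶠ q' in 𝓝 q, r p₀ (ι q') = q' := h1.and (hrι p₀).eventually_nhds
    filter_upwards [continuousAt_fst.eventually h2] with x hx
    obtain ⟨w, hw⟩ := htan x.1 x.2.1 x.2.2
    have h3 : (S' x.1 x.2.1 x.2.2 : Eucl k) =
        mfderiv I 𝓘(ℝ, Eucl k) (r p₀) (ι x.1) (S (ι x.1) x.2.1 x.2.2) := by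
      rw [← hw]
      exact (hS'ι _ _ _ _ hw).trans (hretr (r p₀) x.1 hx.1 hx.2 w).symm
    have h4 : r p₀ (ι x.1) = x.1 := hx.2.self_of_nhds
    refine Eq.trans (congrArg (fun w : Eucl k =>
      (⟨x.1, w⟩ : TangentBundle 𝓘(ℝ, Eucl k) Z')) h3) ?_
    rw [h4]
  · obtain ⟨w, hw⟩ := htan p y v
    rw [hS'ι p y v w hw, hw]

end InitialSubmanifolds

/-! ### Vector fields along maps -/

section SectionsAlongMaps

variable {E : Type*} [NormedAddCommGroup E] [NormedSpace ℝ E] {H : Type*} [TopologicalSpace H]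
  {I : ModelWithCorners ℝ E H} {M : Type*} [TopologicalSpace M] [ChartedSpace H M]
  [IsManifold I ∞ M] [IsManifold I 1 M]
  {E'' : Type*} [NormedAddCommGroup E''] [NormedSpace ℝ E''] {H'' : Type*} [TopologicalSpace H'']
  {J : ModelWithCorners ℝ E'' H''} {N : Type*} [TopologicalSpace N] [ChartedSpace H'' N]
  [IsManifold J 1 N]

lemma contMDiffAt_sum_smul {ι : Type*} [Fintype ι] {b : N → M}
    {f : ι → N → ℝ} {V : ι → ∀ y, TangentSpace I (b y)} {y₀ : N}
    (hb : ContMDiffAt J I ∞ b y₀) (hf : ∀ i, ContMDiffAt J 𝓘(ℝ, ℝ) ∞ (f i) y₀)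
    (hV : ∀ i, ContMDiffAt J I.tangent ∞ (fun y => (⟨b y, V i y⟩ : TangentBundle I M)) y₀) :
    ContMDiffAt J I.tangent ∞ (fun y => (⟨b y, ∑ i, f i y • V i y⟩ : TangentBundle I M)) y₀ := by
  rw [contMDiffAt_tangentBundle_iff hb]
  have h1 := fun i => (contMDiffAt_tangentBundle_iff hb).1 (hV i)
  have h2 : ContMDiffAt J 𝓘(ℝ, E) ∞ (fun y => ∑ i, f i y •
      (mfderiv I 𝓘(ℝ, E) (extChartAt I (b y₀)) (b y) (V i y) : E)) y₀ :=
    ContMDiffAt.sum fun i _ => (hf i).smul (h1 i)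
  refine h2.congr_of_eventuallyEq (Filter.Eventually.of_forall fun y => ?_)
  refine (map_sum _ _ _).trans (Finset.sum_congr rfl fun i _ => ?_)
  exact map_smul _ _ _

end SectionsAlongMaps

/-! ### Separation of bundles -/

section Separation

/-- A space over a Hausdorff space is Hausdorff when any two points of a fibre are separated by a
map to a fixed Hausdorff space that is continuous at both. -/
lemma t2Space_of_continuous {X Y : Type*} [TopologicalSpace X] [TopologicalSpace Y] [T2Space Y]
    {f : X → Y} (hf : Continuous f) {W : Type*} [TopologicalSpace W] [T2Space W]
    (h : ∀ x x', f x = f x' → ∃ g : X → W, ContinuousAt g x ∧ ContinuousAt g x' ∧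
      (g x = g x' → x = x')) : T2Space X := by
  refine t2_iff_nhds.2 fun {x y} hxy => ?_
  have h1 : f x = f y := tendsto_nhds_unique (hf.continuousAt.mono_left inf_le_left)
    (hf.continuousAt.mono_left (inf_le_right : 𝓝 x ⊓ 𝓝 y ≤ 𝓝 y))
  obtain ⟨g, hx, hy, hg⟩ := h x y h1
  exact hg (tendsto_nhds_unique (hx.mono_left inf_le_left)
    (hy.mono_left (inf_le_right : 𝓝 x ⊓ 𝓝 y ≤ 𝓝 y)))

variable {E : Type*} [NormedAddCommGroup E] [NormedSpace ℝ E] {M : Type*} [TopologicalSpace M]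
  [ChartedSpace E M] [IsManifold 𝓘(ℝ, E) ∞ M] [IsManifold 𝓘(ℝ, E) 1 M]

lemma t2Space_cotangent [T2Space M] : T2Space (Cotangent 𝓘(ℝ, E) M) := by
  refine t2Space_of_continuous (f := fun η : Cotangent 𝓘(ℝ, E) M => η.1)
    (contMDiff_cotangent_proj (E := E)).continuous (W := M × (E →L[ℝ] ℝ)) fun η ζ h => ?_
  let e := trivializationAt (E →L[ℝ] ℝ)
    (fun x : M => TangentSpace 𝓘(ℝ, E) x →L[ℝ] Trivial M ℝ x) η.1
  have hη : η ∈ e.source := FiberBundle.mem_trivializationAt_proj_source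
  have hζ : ζ ∈ e.source := by
    rw [e.mem_source] at hη ⊢
    exact h ▸ hη
  exact ⟨e, e.continuousAt hη, e.continuousAt hζ, fun h => e.injOn hη hζ h⟩

end Separation

/-! ### Smoothness of maps into the frame bundle -/

section Frames

variable {n : ℕ} {Q : Type*} [TopologicalSpace Q] [ChartedSpace (Eucl n) Q]
  [IsManifold 𝓘(ℝ, Eucl n) ∞ Q]
  [RiemannianBundle (fun q : Q => TangentSpace 𝓘(ℝ, Eucl n) q)]
  [IsContMDiffRiemannianBundle 𝓘(ℝ, Eucl n) ∞ (Eucl n)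
    (fun q : Q => TangentSpace 𝓘(ℝ, Eucl n) q)]

lemma eucl_eq_sum (v : Eucl n) : ∑ i, v i • EuclideanSpace.single i (1 : ℝ) = v := by
  simpa using (EuclideanSpace.basisFun (Fin n) ℝ).sum_repr v

lemma extChartAt_orthoFrame (u w : OrthoFrame n Q) :
    extChartAt 𝓘(ℝ, FrameModel n) u w = ((chartAt (Eucl n) u.pt w.pt,
      skewOfOrth ((u.coords u.pt)⁻¹ * w.coords u.pt)) : Eucl n × SkewEnd n) := rfl

lemma extChartAt_orthoFrame_source (u : OrthoFrame n Q) :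
    (extChartAt 𝓘(ℝ, FrameModel n) u).source = {w | w.pt ∈ (chartAt (Eucl n) u.pt).source ∧
      IsUnit (1 + ((u.coords u.pt)⁻¹ * w.coords u.pt).endo)} := by
  rw [extChartAt_source]
  rfl

lemma contDiff_fst_frameModel : ContDiff ℝ ∞ (fun y : FrameModel n => (y.1 : Eucl n)) :=
  (ContinuousLinearMap.fst ℝ (Eucl n) (SkewEnd n)).contDiff

lemma contDiff_snd_frameModel : ContDiff ℝ ∞ (fun y : FrameModel n => (y.2 : SkewEnd n)) :=
  (ContinuousLinearMap.snd ℝ (Eucl n) (SkewEnd n)).contDiff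

lemma contMDiff_pt : ContMDiff 𝓘(ℝ, FrameModel n) 𝓘(ℝ, Eucl n) ∞
    (fun w : OrthoFrame n Q => w.pt) := by
  intro u
  have h1 : ContMDiffAt 𝓘(ℝ, FrameModel n) 𝓘(ℝ, Eucl n) ∞ (fun w : OrthoFrame n Q =>
      (chartAt (Eucl n) u.pt).symm (extChartAt 𝓘(ℝ, FrameModel n) u w).1) u := by
    refine ContMDiffAt.comp (g := (chartAt (Eucl n) u.pt).symm) (I' := 𝓘(ℝ, Eucl n)) u ?_ ?_
    · exact contMDiffAt_symm_of_mem_maximalAtlas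
        (IsManifold.chart_mem_maximalAtlas (I := 𝓘(ℝ, Eucl n)) u.pt)
        ((chartAt (Eucl n) u.pt).map_source (mem_chart_source _ _))
    · exact contDiff_fst_frameModel.contMDiff.contMDiffAt.comp u contMDiffAt_extChartAt
  refine h1.congr_of_eventuallyEq ?_
  filter_upwards [extChartAt_source_mem_nhds (I := 𝓘(ℝ, FrameModel n)) u] with w hw
  rw [extChartAt_orthoFrame_source] at hw
  exact ((chartAt (Eucl n) u.pt).left_inv hw.1).symm

lemma contDiff_endo_orthOfSkew :
    ContDiff ℝ ∞ (fun X : SkewEnd n => (orthOfSkew X).endo) := by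
  rw [contDiff_iff_contDiffAt]
  intro X
  exact (contDiffAt_cayleyInv (isUnit_one_sub X)).comp X
    (f := fun y : SkewEnd n => (y : EndEucl n)) (SkewEnd n).subtypeL.contDiff.contDiffAt

/-- The vectors of a frame, expanded in the local orthonormal frame around `q₀`. -/
lemma iso_eq_sum (q₀ : Q) (u : OrthoFrame n Q) (a : Eucl n) :
    u.iso a = ∑ i, (u.coords q₀).endo a i • localFrame q₀ u.pt i := by
  have : u.iso a = (localFrame q₀ u.pt).repr.symm ((u.coords q₀) a) := by
    simp [OrthoFrame.coords]
  rw [this, ← OrthonormalBasis.sum_repr_symm]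
  rfl

lemma coords_apply (q₀ : Q) (u : OrthoFrame n Q) (a : Eucl n) (i : Fin n) :
    (u.coords q₀).endo a i = inner ℝ (localFrame q₀ u.pt i) (u.iso a) :=
  OrthonormalBasis.repr_apply_apply (localFrame q₀ u.pt) (u.iso a) i

lemma contMDiffAt_localFrame_pt {q₀ : Q} {u : OrthoFrame n Q}
    (hu : u.pt ∈ (chartAt (Eucl n) q₀).source) (i : Fin n) :
    ContMDiffAt 𝓘(ℝ, FrameModel n) 𝓘(ℝ, Eucl n).tangent ∞ (fun w : OrthoFrame n Q =>
      (⟨w.pt, localFrame q₀ w.pt i⟩ : TangentBundle 𝓘(ℝ, Eucl n) Q)) u :=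
  ContMDiffAt.comp (g := fun q => (⟨q, localFrame q₀ q i⟩ : TangentBundle 𝓘(ℝ, Eucl n) Q))
    (f := fun w : OrthoFrame n Q => w.pt) u
    ((contMDiffOn_localFrame q₀ i).contMDiffAt ((chartAt (Eucl n) q₀).open_source.mem_nhds hu))
    (contMDiff_pt u)

lemma contMDiff_iso (a : Eucl n) :
    ContMDiff 𝓘(ℝ, FrameModel n) 𝓘(ℝ, Eucl n).tangent ∞ (fun w : OrthoFrame n Q =>
      (⟨w.pt, w.iso a⟩ : TangentBundle 𝓘(ℝ, Eucl n) Q)) := by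
  intro u
  have h1 : ContMDiffAt 𝓘(ℝ, FrameModel n) 𝓘(ℝ, Eucl n) ∞ (fun w : OrthoFrame n Q =>
      ((u.coords u.pt).endo * (orthOfSkew (extChartAt 𝓘(ℝ, FrameModel n) u w).2).endo) a) u := by
    have h2 : ContDiff ℝ ∞ (fun y : FrameModel n =>
        ((u.coords u.pt).endo * (orthOfSkew y.2).endo) a) :=
      ((contDiff_const (c := (u.coords u.pt).endo)).mul
        (contDiff_endo_orthOfSkew.comp contDiff_snd_frameModel)).clm_apply contDiff_const
    exact h2.contMDiff.contMDiffAt.comp u contMDiffAt_extChartAt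
  have h3 := fun i => (EuclideanSpace.proj i : Eucl n →L[ℝ] ℝ).contMDiff.contMDiffAt.comp u h1
  refine (contMDiffAt_sum_smul (contMDiff_pt u) h3
    (fun i => contMDiffAt_localFrame_pt (mem_chart_source _ _) i)).congr_of_eventuallyEq ?_
  filter_upwards [extChartAt_source_mem_nhds (I := 𝓘(ℝ, FrameModel n)) u] with w hw
  rw [extChartAt_orthoFrame_source] at hw
  refine congrArg (fun v => (⟨w.pt, v⟩ : TangentBundle 𝓘(ℝ, Eucl n) Q)) ?_
  rw [iso_eq_sum u.pt w a]
  refine Finset.sum_congr rfl fun i _ => ?_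
  have : w.coords u.pt = u.coords u.pt * orthOfSkew (extChartAt 𝓘(ℝ, FrameModel n) u w).2 := by
    rw [extChartAt_orthoFrame, orthOfSkew_skewOfOrth hw.2, mul_inv_cancel_left]
  rw [this]
  rfl

variable {E : Type*} [NormedAddCommGroup E] [NormedSpace ℝ E] {H : Type*} [TopologicalSpace H]
  {J : ModelWithCorners ℝ E H} {N : Type*} [TopologicalSpace N] [ChartedSpace H N]
  [IsManifold J 1 N]

lemma contMDiffAt_endEucl_iff {f : N → EndEucl n} {x : N} :
    ContMDiffAt J 𝓘(ℝ, EndEucl n) ∞ f x ↔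
      ∀ a i, ContMDiffAt J 𝓘(ℝ, ℝ) ∞ (fun y => f y a i) x := by
  constructor
  · intro h a i
    exact ((EuclideanSpace.proj i : Eucl n →L[ℝ] ℝ).comp
      (ContinuousLinearMap.apply ℝ (Eucl n) a)).contMDiff.contMDiffAt.comp x h
  · intro h
    have h1 : ContMDiffAt J 𝓘(ℝ, EndEucl n) ∞ (fun y => ∑ j : Fin n, ∑ i : Fin n,
        f y (EuclideanSpace.single j 1) i • (innerSL ℝ (EuclideanSpace.single j (1 : ℝ))).smulRight
          (EuclideanSpace.single i (1 : ℝ))) x :=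
      ContMDiffAt.sum fun j _ => ContMDiffAt.sum fun i _ => (h _ i).smul contMDiffAt_const
    refine h1.congr_of_eventuallyEq (Filter.Eventually.of_forall fun y => ?_)
    refine ContinuousLinearMap.ext fun v => ?_
    conv_lhs => rw [← eucl_eq_sum v, map_sum]
    simp only [sum_apply, smul_apply, ContinuousLinearMap.smulRight_apply, map_smul,
      innerSL_apply_apply]
    refine Finset.sum_congr rfl fun j _ => ?_
    conv_lhs => rw [← eucl_eq_sum (f y (EuclideanSpace.single j 1)), Finset.smul_sum]
    refine Finset.sum_congr rfl fun i _ => ?_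
    rw [EuclideanSpace.inner_single_left, smul_comm]
    simp

lemma contMDiffAt_coords {F : N → OrthoFrame n Q} {x : N} {q₀ : Q}
    (hx : (F x).pt ∈ (chartAt (Eucl n) q₀).source)
    (h : ∀ a, ContMDiffAt J 𝓘(ℝ, Eucl n).tangent ∞
      (fun y => (⟨(F y).pt, (F y).iso a⟩ : TangentBundle 𝓘(ℝ, Eucl n) Q)) x)
    (hb : ContMDiffAt J 𝓘(ℝ, Eucl n) ∞ (fun y => (F y).pt) x) :
    ContMDiffAt J 𝓘(ℝ, EndEucl n) ∞ (fun y => ((F y).coords q₀).endo) x := by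
  refine contMDiffAt_endEucl_iff.2 fun a i => ?_
  simp_rw [coords_apply]
  refine ContMDiffAt.inner_bundle ?_ (h a)
  exact ContMDiffAt.comp (g := fun q => (⟨q, localFrame q₀ q i⟩ : TangentBundle 𝓘(ℝ, Eucl n) Q))
    (f := fun y => (F y).pt) x ((contMDiffOn_localFrame q₀ i).contMDiffAt
      ((chartAt (Eucl n) q₀).open_source.mem_nhds hx)) hb

/-- A map into the frame bundle is smooth when its base point and all the vectors of its frames
are. -/
lemma contMDiffAt_orthoFrame_of_iso {F : N → OrthoFrame n Q} {x : N}
    (hb : ContMDiffAt J 𝓘(ℝ, Eucl n) ∞ (fun y => (F y).pt) x)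
    (h : ∀ a, ContMDiffAt J 𝓘(ℝ, Eucl n).tangent ∞
      (fun y => (⟨(F y).pt, (F y).iso a⟩ : TangentBundle 𝓘(ℝ, Eucl n) Q)) x) :
    ContMDiffAt J 𝓘(ℝ, FrameModel n) ∞ F x := by
  set u := F x with hu
  have hx : (F x).pt ∈ (chartAt (Eucl n) u.pt).source := mem_chart_source _ _
  have hm : ContMDiffAt J 𝓘(ℝ, EndEucl n) ∞
      (fun y => ((u.coords u.pt)⁻¹ * (F y).coords u.pt).endo) x :=
    ContMDiffAt.comp (g := fun A : EndEucl n => ((u.coords u.pt)⁻¹).endo * A)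
      (f := fun y => ((F y).coords u.pt).endo) x
      (contDiff_const.mul contDiff_id).contMDiff.contMDiffAt (contMDiffAt_coords hx h hb)
  have h0 : IsUnit (1 + ((u.coords u.pt)⁻¹ * (F x).coords u.pt).endo) := by
    rw [← hu, inv_mul_cancel]
    exact isUnit_one_add_one (A := EndEucl n)
  have hG2 : ContMDiffAt J 𝓘(ℝ, SkewEnd n) ∞
      (fun y => skewOfOrth ((u.coords u.pt)⁻¹ * (F y).coords u.pt)) x :=
    ContMDiffAt.comp (g := fun A : EndEucl n => skewPart (cayley A))
      (f := fun y => ((u.coords u.pt)⁻¹ * (F y).coords u.pt).endo) x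
      (contDiff_skewPart.contDiffAt.comp _ (contDiffAt_cayley h0)).contMDiffAt hm
  have hG1 : ContMDiffAt J 𝓘(ℝ, Eucl n) ∞ (fun y => chartAt (Eucl n) u.pt (F y).pt) x :=
    ContMDiffAt.comp (g := chartAt (Eucl n) u.pt) (I' := 𝓘(ℝ, Eucl n)) (f := fun y => (F y).pt) x
      (contMDiffAt_of_mem_maximalAtlas
        (IsManifold.chart_mem_maximalAtlas (I := 𝓘(ℝ, Eucl n)) u.pt) hx) hb
  have hG : ContMDiffAt J 𝓘(ℝ, FrameModel n) ∞
      (fun y => extChartAt 𝓘(ℝ, FrameModel n) u (F y)) x := by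
    have : ContMDiffAt J 𝓘(ℝ, Eucl n × SkewEnd n) ∞ (fun y => (chartAt (Eucl n) u.pt (F y).pt,
      skewOfOrth ((u.coords u.pt)⁻¹ * (F y).coords u.pt))) x := hG1.prodMk_space hG2
    exact this
  have hs : ContMDiffAt 𝓘(ℝ, FrameModel n) 𝓘(ℝ, FrameModel n) ∞
      (extChartAt 𝓘(ℝ, FrameModel n) u).symm (extChartAt 𝓘(ℝ, FrameModel n) u (F x)) :=
    (contMDiffOn_extChartAt_symm u).contMDiffAt (extChartAt_target_mem_nhds u)
  refine (hs.comp x hG).congr_of_eventuallyEq ?_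
  have h2 : ∀ᶠ y in 𝓝 x, (F y).pt ∈ (chartAt (Eucl n) u.pt).source :=
    hb.continuousAt.eventually_mem ((chartAt (Eucl n) u.pt).open_source.mem_nhds hx)
  have h3 : ∀ᶠ y in 𝓝 x, IsUnit (1 + ((u.coords u.pt)⁻¹ * (F y).coords u.pt).endo) :=
    (continuousAt_const.add hm.continuousAt).eventually_mem (Units.isOpen.mem_nhds h0)
  filter_upwards [h2, h3] with y hy hy'
  refine ((extChartAt 𝓘(ℝ, FrameModel n) u).left_inv ?_).symm
  rw [extChartAt_orthoFrame_source]
  exact ⟨hy, hy'⟩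

lemma t2Space_orthoFrame [T2Space Q] : T2Space (OrthoFrame n Q) := by
  refine t2Space_of_continuous (f := fun w : OrthoFrame n Q => w.pt) contMDiff_pt.continuous
    (W := EndEucl n) fun u w h => ⟨fun v => (v.coords u.pt).endo, ?_, ?_, fun hg => ?_⟩
  · exact (contMDiffAt_coords (F := id) (mem_chart_source _ _) (fun a => contMDiff_iso a u)
      (contMDiff_pt u)).continuousAt
  · refine (contMDiffAt_coords (F := id) ?_ (fun a => contMDiff_iso a w)
      (contMDiff_pt w)).continuousAt
    exact h ▸ mem_chart_source (Eucl n) u.pt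
  · refine OrthoFrame.ext_of h fun a => ?_
    rw [iso_eq_sum u.pt u, iso_eq_sum u.pt w]
    dsimp only at hg h
    rw [hg, h]

end Frames

/-! ### The action on frames -/

section Actions

variable {n : ℕ} {Q : Type*} [TopologicalSpace Q] [ChartedSpace (Eucl n) Q]
  [IsManifold 𝓘(ℝ, Eucl n) ∞ Q]
  [RiemannianBundle (fun q : Q => TangentSpace 𝓘(ℝ, Eucl n) q)]
  [IsContMDiffRiemannianBundle 𝓘(ℝ, Eucl n) ∞ (Eucl n)
    (fun q : Q => TangentSpace 𝓘(ℝ, Eucl n) q)]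
  {EG : Type*} [NormedAddCommGroup EG] [NormedSpace ℝ EG]
  {G : Type*} [TopologicalSpace G] [ChartedSpace EG G] [Group G] [LieGroup 𝓘(ℝ, EG) ∞ G]
  [MulAction G Q] [ContMDiffSMul 𝓘(ℝ, EG) 𝓘(ℝ, Eucl n) ∞ G Q]

lemma contMDiff_smul_left (h : ContMDiff (𝓘(ℝ, EG).prod 𝓘(ℝ, Eucl n)) 𝓘(ℝ, Eucl n) ∞
      (fun p : G × Q => p.1 • p.2)) (g : G) :
    ContMDiff 𝓘(ℝ, Eucl n) 𝓘(ℝ, Eucl n) ∞ (fun q : Q => g • q) :=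
  h.comp (contMDiff_const.prodMk contMDiff_id)

variable (hG : ActsByIsometries n Q G)

lemma frameAct_one (u : OrthoFrame n Q) : frameAct hG (1 : OrthGroup n × G) u = u := by
  refine OrthoFrame.ext_of (one_smul G u.pt) fun a => ?_
  have h1 : (fun x : Q => (1 : G) • x) = id := funext fun x => one_smul G x
  have h2 : (mfderiv 𝓘(ℝ, Eucl n) 𝓘(ℝ, Eucl n) (fun x : Q => (1 : G) • x) u.pt :
      Eucl n →L[ℝ] Eucl n) = ContinuousLinearMap.id ℝ (Eucl n) := by
    rw [h1]; exact mfderiv_id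
  exact DFunLike.congr_fun h2 (u.iso a)

lemma frameAct_frameAct (hs : ∀ g : G, ContMDiff 𝓘(ℝ, Eucl n) 𝓘(ℝ, Eucl n) ∞ (fun q : Q => g • q))
    (h h' : OrthGroup n × G) (u : OrthoFrame n Q) :
    frameAct hG h (frameAct hG h' u) = frameAct hG (h * h') u := by
  refine OrthoFrame.ext_of (smul_smul _ _ _) fun a => ?_
  have h1 : (fun x : Q => (h * h').2 • x) = (fun x : Q => h.2 • x) ∘ (fun x : Q => h'.2 • x) :=
    funext fun x => mul_smul h.2 h'.2 x
  have h2 : (mfderiv 𝓘(ℝ, Eucl n) 𝓘(ℝ, Eucl n) (fun x : Q => (h * h').2 • x) u.pt :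
      Eucl n →L[ℝ] Eucl n) =
      (mfderiv 𝓘(ℝ, Eucl n) 𝓘(ℝ, Eucl n) (fun x : Q => h.2 • x) (h'.2 • u.pt)).comp
      (mfderiv 𝓘(ℝ, Eucl n) 𝓘(ℝ, Eucl n) (fun x : Q => h'.2 • x) u.pt) := by
    rw [h1]
    exact mfderiv_comp u.pt
      ((hs h.2).mdifferentiable (by simp) _)
      ((hs h'.2).mdifferentiable (by simp) _)
  have h3 : (h * h').1⁻¹ a = h'.1⁻¹ (h.1⁻¹ a) := by
    rw [Prod.fst_mul, mul_inv_rev]; rfl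
  have h4 : (u.iso ((h * h').1⁻¹ a) : Eucl n) = u.iso (h'.1⁻¹ (h.1⁻¹ a)) := by rw [h3]
  exact (DFunLike.congr_fun h2 (u.iso ((h * h').1⁻¹ a))).trans (congrArg _ h4) |>.symm

lemma contMDiff_frameAct_prod (k : OrthGroup n) :
    ContMDiff (𝓘(ℝ, EG).prod 𝓘(ℝ, FrameModel n)) 𝓘(ℝ, FrameModel n) ∞
      (fun p : G × OrthoFrame n Q => frameAct hG (k, p.1) p.2) := by
  have : IsManifold 𝓘(ℝ, EG) ∞ G := LieGroup.toContMDiffMul.toIsManifold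
  have : IsManifold 𝓘(ℝ, EG) 1 G := IsManifold.of_le (n := ∞) (by norm_cast)
  have hs : ContMDiff (𝓘(ℝ, EG).prod 𝓘(ℝ, Eucl n)) 𝓘(ℝ, Eucl n) ∞
      (fun p : G × Q => p.1 • p.2) := ContMDiffSMul.contMDiff_smul
  intro p
  refine contMDiffAt_orthoFrame_of_iso ?_ fun a => ?_
  · exact hs.contMDiffAt.comp p (contMDiffAt_fst.prodMk ((contMDiff_pt _).comp p contMDiffAt_snd))
  · refine contMDiffAt_mfderiv_apply (f := fun (p : G × OrthoFrame n Q) (x : Q) => p.1 • x)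
      (g := fun p : G × OrthoFrame n Q => p.2.pt) (V := fun p => p.2.iso (k⁻¹ a)) ?_ ?_
    · exact hs.contMDiffAt.comp (p, p.2.pt)
        ((contMDiffAt_fst.comp (p, p.2.pt) contMDiffAt_fst).prodMk contMDiffAt_snd)
    · exact (contMDiff_iso (k⁻¹ a) p.2).comp p contMDiffAt_snd

lemma contMDiff_frameAct (hs : ∀ g : G, ContMDiff 𝓘(ℝ, Eucl n) 𝓘(ℝ, Eucl n) ∞ (fun q : Q => g • q))
    (h : OrthGroup n × G) :
    ContMDiff 𝓘(ℝ, FrameModel n) 𝓘(ℝ, FrameModel n) ∞ (frameAct (Q := Q) hG h) :=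
  fun u => contMDiffAt_orthoFrame_of_iso (((hs h.2) _).comp u (contMDiff_pt u)) fun a =>
    contMDiffAt_mfderiv_apply (f := fun (_ : OrthoFrame n Q) (x : Q) => h.2 • x)
      (g := fun u : OrthoFrame n Q => u.pt) (V := fun u => u.iso (h.1⁻¹ a))
      ((hs h.2).contMDiffAt.comp (u, u.pt) contMDiffAt_snd) (contMDiff_iso _ u)

lemma isInvertible_mfderiv_frameAct
    (hs : ∀ g : G, ContMDiff 𝓘(ℝ, Eucl n) 𝓘(ℝ, Eucl n) ∞ (fun q : Q => g • q))
    (h : OrthGroup n × G) (u : OrthoFrame n Q) :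
    (mfderiv 𝓘(ℝ, FrameModel n) 𝓘(ℝ, FrameModel n) (frameAct hG h) u).IsInvertible := by
  refine isInvertible_mfderiv_of_inverse (g := frameAct hG h⁻¹) (fun w => ?_) (fun w => ?_)
    ((contMDiff_frameAct hG hs h).mdifferentiable (by simp))
    ((contMDiff_frameAct hG hs h⁻¹).mdifferentiable (by simp))
  · rw [frameAct_frameAct hG hs, inv_mul_cancel, frameAct_one]
  · rw [frameAct_frameAct hG hs, mul_inv_cancel, frameAct_one]

lemma cotangentAct_one (η : CotangentFrame n Q) : cotangentAct hG (1 : OrthGroup n × G) η = η := by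
  have : frameAct (Q := Q) hG (1 : OrthGroup n × G) = id := funext (frameAct_one hG)
  rw [cotangentAct, this, cotangentLift_id]

lemma cotangentAct_cotangentAct
    (hs : ∀ g : G, ContMDiff 𝓘(ℝ, Eucl n) 𝓘(ℝ, Eucl n) ∞ (fun q : Q => g • q))
    (h h' : OrthGroup n × G) (η : CotangentFrame n Q) :
    cotangentAct hG h (cotangentAct hG h' η) = cotangentAct hG (h * h') η := by
  rw [cotangentAct, cotangentAct, cotangentLift_comp
    ((contMDiff_frameAct hG hs h').mdifferentiable (by simp) _)
    ((contMDiff_frameAct hG hs h).mdifferentiable (by simp) _)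
    (isInvertible_mfderiv_frameAct hG hs h' _), cotangentAct]
  congr 2
  exact funext (frameAct_frameAct hG hs h h')

end Actions

/-! ### The connection form -/

section Connection

variable {n : ℕ} {Q : Type*} [TopologicalSpace Q] [ChartedSpace (Eucl n) Q]
  [IsManifold 𝓘(ℝ, Eucl n) ∞ Q]
  [RiemannianBundle (fun q : Q => TangentSpace 𝓘(ℝ, Eucl n) q)]
  [IsContMDiffRiemannianBundle 𝓘(ℝ, Eucl n) ∞ (Eucl n)
    (fun q : Q => TangentSpace 𝓘(ℝ, Eucl n) q)]

lemma mdifferentiableAt_pt (u : OrthoFrame n Q) :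
    MDifferentiableAt 𝓘(ℝ, FrameModel n) 𝓘(ℝ, Eucl n) (fun w : OrthoFrame n Q => w.pt) u :=
  (contMDiff_pt u).mdifferentiableAt (by simp)

/-- A vector field on `Q` is *differentiable at* `q` when it is so as a map into `TQ`. -/
abbrev DiffField (X : ∀ q : Q, TangentSpace 𝓘(ℝ, Eucl n) q) (q : Q) : Prop :=
  MDifferentiableAt 𝓘(ℝ, Eucl n) 𝓘(ℝ, Eucl n).tangent
    (fun q => (⟨q, X q⟩ : TangentBundle 𝓘(ℝ, Eucl n) Q)) q

lemma mdifferentiableAt_inner_iso {X : ∀ q : Q, TangentSpace 𝓘(ℝ, Eucl n) q} {u : OrthoFrame n Q}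
    (hX : DiffField X u.pt) (b : Eucl n) :
    MDifferentiableAt 𝓘(ℝ, FrameModel n) 𝓘(ℝ, ℝ)
      (fun w : OrthoFrame n Q => inner ℝ (X w.pt) (w.iso b)) u := by
  refine MDifferentiableAt.inner_bundle (IB := 𝓘(ℝ, Eucl n)) ?_
    ((contMDiff_iso b u).mdifferentiableAt (by simp))
  exact MDifferentiableAt.comp (g := fun q => (⟨q, X q⟩ : TangentBundle 𝓘(ℝ, Eucl n) Q)) u hX
    (mdifferentiableAt_pt u)

lemma iso_symm_eq_sum (w : OrthoFrame n Q) (v : TangentSpace 𝓘(ℝ, Eucl n) w.pt) :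
    w.iso.symm v = ∑ j, (inner ℝ v (w.iso (EuclideanSpace.single j 1)) : ℝ) •
      EuclideanSpace.single j (1 : ℝ) := by
  conv_lhs => rw [← eucl_eq_sum (w.iso.symm v)]
  refine Finset.sum_congr rfl fun j _ => ?_
  rw [← w.iso.symm.inner_map_map, LinearIsometryEquiv.symm_apply_apply, real_inner_comm,
    EuclideanSpace.inner_single_left]
  simp

lemma mdifferentiableAt_iso_symm {X : ∀ q : Q, TangentSpace 𝓘(ℝ, Eucl n) q} {u : OrthoFrame n Q}
    (hX : DiffField X u.pt) :
    MDifferentiableAt 𝓘(ℝ, FrameModel n) 𝓘(ℝ, Eucl n)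
      (fun w : OrthoFrame n Q => w.iso.symm (X w.pt)) u := by
  simp_rw [iso_symm_eq_sum]
  refine MDifferentiableAt.congr_of_eventuallyEq (MDifferentiableAt.sum (t := Finset.univ)
    (f := fun (j : Fin n) (w : OrthoFrame n Q) =>
      (inner ℝ (X w.pt) (w.iso (EuclideanSpace.single j 1)) : ℝ) • EuclideanSpace.single j (1 : ℝ))
    fun j _ => MDifferentiableAt.smul (mdifferentiableAt_inner_iso hX _)
      (mdifferentiableAt_const (c := EuclideanSpace.single j (1 : ℝ))))
    (Filter.Eventually.of_forall fun w => by simp only [Finset.sum_apply])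

variable (cov : CovariantDerivative 𝓘(ℝ, Eucl n) (Eucl n)
  (TangentSpace 𝓘(ℝ, Eucl n) : Q → Type _))

/-- The expression `⟨∇_{Tρ ξ} X, u b⟩ - d(w ↦ ⟨X(ρ w), w b⟩)_u(ξ)`, which is tensorial in `X` and
equals `⟨ω_u(ξ) a, b⟩` when `X(ρ u) = u a`. -/
def connectionPairing (u : OrthoFrame n Q) (b : Eucl n)
    (X : ∀ q : Q, TangentSpace 𝓘(ℝ, Eucl n) q) : TangentSpace 𝓘(ℝ, FrameModel n) u →L[ℝ] ℝ :=
  (innerSL ℝ (u.iso b)).comp ((cov X u.pt).comp (projDeriv u)) -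
    mvfderiv 𝓘(ℝ, FrameModel n) (fun w : OrthoFrame n Q => (inner ℝ (X w.pt) (w.iso b) : ℝ)) u

lemma connectionPairing_apply (u : OrthoFrame n Q) (b : Eucl n)
    (X : ∀ q : Q, TangentSpace 𝓘(ℝ, Eucl n) q) (ξ : TangentSpace 𝓘(ℝ, FrameModel n) u) :
    connectionPairing cov u b X ξ = inner ℝ (cov X u.pt (projDeriv u ξ)) (u.iso b) -
      mvfderiv 𝓘(ℝ, FrameModel n)
        (fun w : OrthoFrame n Q => (inner ℝ (X w.pt) (w.iso b) : ℝ)) u ξ := by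
  rw [real_inner_comm]
  rfl

lemma mvfderiv_comp_pt {f : Q → ℝ} {u : OrthoFrame n Q}
    (hf : MDifferentiableAt 𝓘(ℝ, Eucl n) 𝓘(ℝ, ℝ) f u.pt) (ξ : TangentSpace 𝓘(ℝ, FrameModel n) u) :
    mvfderiv 𝓘(ℝ, FrameModel n) (fun w : OrthoFrame n Q => f w.pt) u ξ =
      mvfderiv 𝓘(ℝ, Eucl n) f u.pt (projDeriv u ξ) :=
  DFunLike.congr_fun (mvfderiv_comp (f := fun w : OrthoFrame n Q => w.pt) (g := f) u hf
    (mdifferentiableAt_pt u)) ξ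

lemma tensorialAt_connectionPairing (u : OrthoFrame n Q) (b : Eucl n) :
    TensorialAt 𝓘(ℝ, Eucl n) (Eucl n) (connectionPairing cov u b) u.pt where
  smul := by
    intro f X hf hX
    refine ContinuousLinearMap.ext fun ξ => ?_
    have h1 : cov (f • X) u.pt (projDeriv u ξ) = _ :=
      DFunLike.congr_fun (cov.isCovariantDerivativeOn.leibniz hX hf) (projDeriv u ξ)
    have hf' : MDifferentiableAt 𝓘(ℝ, FrameModel n) 𝓘(ℝ, ℝ) (fun w : OrthoFrame n Q => f w.pt) u :=
      MDifferentiableAt.comp (g := f) u hf (mdifferentiableAt_pt u)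
    have h2 := DFunLike.congr_fun (mvfderiv_fun_mul hf' (mdifferentiableAt_inner_iso hX b)) ξ
    have h3 : (fun w : OrthoFrame n Q => (inner ℝ ((f • X) w.pt) (w.iso b) : ℝ)) =
        fun w => f w.pt * inner ℝ (X w.pt) (w.iso b) :=
      funext fun w => real_inner_smul_left _ _ _
    rw [connectionPairing_apply, h1, h3, h2]
    simp only [smul_apply, add_apply, ContinuousLinearMap.smulRight_apply, inner_add_left,
      real_inner_smul_left, smul_eq_mul, connectionPairing_apply, mvfderiv_comp_pt hf]
    ring
  add := by
    intro X Y hX hY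
    refine ContinuousLinearMap.ext fun ξ => ?_
    have h1 : cov (X + Y) u.pt (projDeriv u ξ) = _ :=
      DFunLike.congr_fun (cov.isCovariantDerivativeOn.add hX hY) (projDeriv u ξ)
    have h2 := DFunLike.congr_fun (mvfderiv_fun_add (mdifferentiableAt_inner_iso hX b)
      (mdifferentiableAt_inner_iso hY b)) ξ
    have h3 : (fun w : OrthoFrame n Q => (inner ℝ ((X + Y) w.pt) (w.iso b) : ℝ)) =
        fun w => inner ℝ (X w.pt) (w.iso b) + inner ℝ (Y w.pt) (w.iso b) :=
      funext fun w => inner_add_left _ _ _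
    rw [connectionPairing_apply, h1, h3, h2]
    simp only [add_apply, inner_add_left, connectionPairing_apply]
    ring

lemma inner_connectionFormApply (u : OrthoFrame n Q) (a b : Eucl n)
    (ξ : TangentSpace 𝓘(ℝ, FrameModel n) u) :
    inner ℝ (connectionFormApply cov u a ξ) b =
      connectionPairing cov u b (FiberBundle.extend (Eucl n) (u.iso a)) ξ := by
  set X : ∀ q : Q, TangentSpace 𝓘(ℝ, Eucl n) q := FiberBundle.extend (Eucl n) (u.iso a) with hXdef
  have hX : DiffField X u.pt := FiberBundle.mdifferentiableAt_extend ..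
  have h1 : connectionFormApply cov u a ξ = u.iso.symm (cov X u.pt (projDeriv u ξ)) -
      mvfderiv 𝓘(ℝ, FrameModel n) (fun w : OrthoFrame n Q => w.iso.symm (X w.pt)) u ξ := rfl
  have h2 : (fun w : OrthoFrame n Q => (inner ℝ (X w.pt) (w.iso b) : ℝ)) =
      (innerSL ℝ b) ∘ fun w : OrthoFrame n Q => w.iso.symm (X w.pt) := by
    funext w
    simp only [Function.comp_apply, innerSL_apply_apply]
    rw [← w.iso.inner_map_map, LinearIsometryEquiv.apply_symm_apply, real_inner_comm]
  have h3 : mvfderiv 𝓘(ℝ, FrameModel n)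
      (fun w : OrthoFrame n Q => (inner ℝ (X w.pt) (w.iso b) : ℝ)) u ξ =
      inner ℝ b (mvfderiv 𝓘(ℝ, FrameModel n)
        (fun w : OrthoFrame n Q => w.iso.symm (X w.pt)) u ξ) := by
    rw [h2]
    have h4 := mfderiv_comp u ((innerSL ℝ b).hasMFDerivAt.mdifferentiableAt
      (x := u.iso.symm (X u.pt))) (mdifferentiableAt_iso_symm hX)
    rw [(innerSL ℝ b).hasMFDerivAt.mfderiv] at h4
    exact DFunLike.congr_fun h4 ξ
  rw [h1, connectionPairing_apply, h3, inner_sub_left, real_inner_comm _ b]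
  congr 1
  rw [← u.iso.inner_map_map, LinearIsometryEquiv.apply_symm_apply]

lemma connectionForm_apply (u : OrthoFrame n Q) (ξ : TangentSpace 𝓘(ℝ, FrameModel n) u)
    (a : Eucl n) : connectionForm cov u ξ a = connectionFormApply cov u a ξ := by
  refine ext_inner_right ℝ fun b => ?_
  have h1 : ∀ a, inner ℝ (connectionFormApply cov u a ξ) b =
      TensorialAt.mkHom _ _ (tensorialAt_connectionPairing cov u b) (u.iso a) ξ := by
    intro a
    rw [inner_connectionFormApply, TensorialAt.mkHom_apply_eq_extend]
  have h2 : connectionForm cov u ξ a =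
      ∑ j : Fin n, (a j) • connectionFormApply cov u (EuclideanSpace.single j 1) ξ := by
    rw [connectionForm]
    simp only [sum_apply]
    refine Finset.sum_congr rfl fun j _ => ?_
    have h3 : inner ℝ (EuclideanSpace.single j (1 : ℝ)) a = a j := by
      rw [EuclideanSpace.inner_single_left]
      simp
    rw [← h3]
    rfl
  rw [h2, h1, sum_inner]
  conv_rhs => rw [← eucl_eq_sum a]
  rw [map_sum, map_sum, sum_apply]
  refine Finset.sum_congr rfl fun j _ => ?_
  rw [real_inner_smul_left, h1, map_smul, map_smul]
  rfl

/-- The connection form computed with an arbitrary vector field. -/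
lemma inner_connectionForm {u : OrthoFrame n Q} {X : ∀ q : Q, TangentSpace 𝓘(ℝ, Eucl n) q}
    (hX : DiffField X u.pt) {a : Eucl n} (ha : X u.pt = u.iso a) (b : Eucl n)
    (ξ : TangentSpace 𝓘(ℝ, FrameModel n) u) :
    inner ℝ (connectionForm cov u ξ a) b = inner ℝ (cov X u.pt (projDeriv u ξ)) (u.iso b) -
      mvfderiv 𝓘(ℝ, FrameModel n)
        (fun w : OrthoFrame n Q => (inner ℝ (X w.pt) (w.iso b) : ℝ)) u ξ := by
  rw [connectionForm_apply, inner_connectionFormApply, ← connectionPairing_apply,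
    (tensorialAt_connectionPairing cov u b).pointwise (FiberBundle.mdifferentiableAt_extend ..) hX
      ((FiberBundle.extend_apply_self (Eucl n) (u.iso a)).trans ha.symm)]

end Connection

/-! ### Skewness of the connection form and charts of the frame bundle -/

section FrameCharts

variable {n : ℕ} {Q : Type*} [TopologicalSpace Q] [ChartedSpace (Eucl n) Q]
  [IsManifold 𝓘(ℝ, Eucl n) ∞ Q]
  [RiemannianBundle (fun q : Q => TangentSpace 𝓘(ℝ, Eucl n) q)]
  [IsContMDiffRiemannianBundle 𝓘(ℝ, Eucl n) ∞ (Eucl n)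
    (fun q : Q => TangentSpace 𝓘(ℝ, Eucl n) q)]

lemma inner_eq_sum_iso (w : OrthoFrame n Q) (v v' : TangentSpace 𝓘(ℝ, Eucl n) w.pt) :
    (inner ℝ v v' : ℝ) = ∑ j, inner ℝ v (w.iso (EuclideanSpace.single j 1)) *
      inner ℝ v' (w.iso (EuclideanSpace.single j 1)) := by
  conv_lhs => rw [← w.iso.apply_symm_apply v', iso_symm_eq_sum w v']
  rw [map_sum, inner_sum]
  refine Finset.sum_congr rfl fun j _ => ?_
  rw [map_smul, real_inner_smul_right, mul_comm]

lemma iso_eq_sum_single (w : OrthoFrame n Q) (b : Eucl n) :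
    w.iso b = ∑ j, b j • w.iso (EuclideanSpace.single j 1) := by
  conv_lhs => rw [← eucl_eq_sum b, map_sum]
  simp_rw [map_smul]

lemma mvfderiv_sum {E : Type*} [NormedAddCommGroup E] [NormedSpace ℝ E] {H : Type*}
    [TopologicalSpace H] {I : ModelWithCorners ℝ E H} {M : Type*} [TopologicalSpace M]
    [ChartedSpace H M] {ι : Type} (s : Finset ι) {f : ι → M → ℝ} {x : M}
    (hf : ∀ i, MDifferentiableAt I 𝓘(ℝ, ℝ) (f i) x) (v : TangentSpace I x) :
    mvfderiv I (fun y => ∑ i ∈ s, f i y) x v = ∑ i ∈ s, mvfderiv I (f i) x v := by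
  classical
  have hs : ∀ s : Finset ι, MDifferentiableAt I 𝓘(ℝ, ℝ) (fun y => ∑ i ∈ s, f i y) x := by
    intro s
    have h0 : MDifferentiableAt I 𝓘(ℝ, ℝ) (∑ i ∈ s, f i) x :=
      MDifferentiableAt.sum fun i _ => hf i
    exact h0.congr_of_eventuallyEq
      (Filter.Eventually.of_forall fun w => by simp only [Finset.sum_apply])
  induction s using Finset.induction_on with
  | empty => simp [mvfderiv_const]
  | insert i s hi ih =>
    simp_rw [Finset.sum_insert hi]
    rw [mvfderiv_fun_add (hf i) (hs s), add_apply, ih]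

lemma hasMFDerivAt_prodMk_space {E : Type*} [NormedAddCommGroup E] [NormedSpace ℝ E] {H : Type*}
    [TopologicalSpace H] {I : ModelWithCorners ℝ E H} {M : Type*} [TopologicalSpace M]
    [ChartedSpace H M] {V W : Type*} [NormedAddCommGroup V] [NormedSpace ℝ V]
    [NormedAddCommGroup W] [NormedSpace ℝ W] {f : M → V} {g : M → W} {x : M}
    {f' : TangentSpace I x →L[ℝ] V} {g' : TangentSpace I x →L[ℝ] W}
    (hf : HasMFDerivAt I 𝓘(ℝ, V) f x f') (hg : HasMFDerivAt I 𝓘(ℝ, W) g x g') :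
    HasMFDerivAt I 𝓘(ℝ, V × W) (fun y => (f y, g y)) x (f'.prod g') :=
  ⟨hf.1.prodMk hg.1, by simpa only [mfld_simps] using! hf.2.prodMk hg.2⟩

variable {cov : CovariantDerivative 𝓘(ℝ, Eucl n) (Eucl n)
  (TangentSpace 𝓘(ℝ, Eucl n) : Q → Type _)}

lemma mvfderiv_inner_iso {X : ∀ q : Q, TangentSpace 𝓘(ℝ, Eucl n) q} {u : OrthoFrame n Q}
    (hX : DiffField X u.pt) (b : Eucl n) (ξ : TangentSpace 𝓘(ℝ, FrameModel n) u) :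
    mvfderiv 𝓘(ℝ, FrameModel n)
        (fun w : OrthoFrame n Q => (inner ℝ (X w.pt) (w.iso b) : ℝ)) u ξ =
      ∑ j, b j * mvfderiv 𝓘(ℝ, FrameModel n) (fun w : OrthoFrame n Q =>
        (inner ℝ (X w.pt) (w.iso (EuclideanSpace.single j 1)) : ℝ)) u ξ := by
  have h1 : (fun w : OrthoFrame n Q => (inner ℝ (X w.pt) (w.iso b) : ℝ)) = fun w =>
      ∑ j, b j * (inner ℝ (X w.pt) (w.iso (EuclideanSpace.single j 1)) : ℝ) := by
    funext w
    rw [iso_eq_sum_single w b, inner_sum]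
    simp_rw [real_inner_smul_right]
  rw [h1]
  refine (mvfderiv_sum Finset.univ (f := fun j (w : OrthoFrame n Q) =>
    b j * (inner ℝ (X w.pt) (w.iso (EuclideanSpace.single j 1)) : ℝ))
    (fun j => mdifferentiableAt_const.mul (mdifferentiableAt_inner_iso hX _)) ξ).trans ?_
  refine Finset.sum_congr rfl fun j _ => ?_
  rw [mvfderiv_fun_mul mdifferentiableAt_const (mdifferentiableAt_inner_iso hX _), mvfderiv_const]
  simp

/-- The connection form of a metric covariant derivative is skew-symmetric. -/
lemma connectionForm_skew (hm : cov.IsMetricCompatible) (u : OrthoFrame n Q)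
    (ξ : TangentSpace 𝓘(ℝ, FrameModel n) u) (a b : Eucl n) :
    (inner ℝ (connectionForm cov u ξ a) b : ℝ) = -inner ℝ a (connectionForm cov u ξ b) := by
  set X : ∀ q : Q, TangentSpace 𝓘(ℝ, Eucl n) q := FiberBundle.extend (Eucl n) (u.iso a) with hXd
  set Y : ∀ q : Q, TangentSpace 𝓘(ℝ, Eucl n) q := FiberBundle.extend (Eucl n) (u.iso b) with hYd
  have hX : DiffField X u.pt := FiberBundle.mdifferentiableAt_extend ..
  have hY : DiffField Y u.pt := FiberBundle.mdifferentiableAt_extend ..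
  have hXu : X u.pt = u.iso a := FiberBundle.extend_apply_self (Eucl n) (u.iso a)
  have hYu : Y u.pt = u.iso b := FiberBundle.extend_apply_self (Eucl n) (u.iso b)
  have h1 := inner_connectionForm cov hX hXu b ξ
  have h2 := inner_connectionForm cov hY hYu a ξ
  have h3 := hm.mvfderiv_inner_eq (FiberBundle.extend (Eucl n) (projDeriv u ξ)) hX hY
  have h4 : FiberBundle.extend (Eucl n) (projDeriv u ξ) u.pt = projDeriv u ξ :=
    FiberBundle.extend_apply_self (Eucl n) (projDeriv u ξ)
  simp only [h4, hXu, hYu] at h3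
  have h5 : mvfderiv 𝓘(ℝ, Eucl n) (fun x => (inner ℝ (X x) (Y x) : ℝ)) u.pt (projDeriv u ξ) =
      ∑ j, (a j * mvfderiv 𝓘(ℝ, FrameModel n) (fun w : OrthoFrame n Q =>
        (inner ℝ (Y w.pt) (w.iso (EuclideanSpace.single j 1)) : ℝ)) u ξ +
        b j * mvfderiv 𝓘(ℝ, FrameModel n) (fun w : OrthoFrame n Q =>
        (inner ℝ (X w.pt) (w.iso (EuclideanSpace.single j 1)) : ℝ)) u ξ) := by
    rw [← mvfderiv_comp_pt (f := fun x => (inner ℝ (X x) (Y x) : ℝ))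
      (MDifferentiableAt.inner_bundle hX hY)]
    simp_rw [fun w : OrthoFrame n Q => inner_eq_sum_iso w (X w.pt) (Y w.pt)]
    refine (mvfderiv_sum Finset.univ (f := fun j (w : OrthoFrame n Q) =>
      (inner ℝ (X w.pt) (w.iso (EuclideanSpace.single j 1)) : ℝ) *
        inner ℝ (Y w.pt) (w.iso (EuclideanSpace.single j 1)))
      (fun j => (mdifferentiableAt_inner_iso hX _).mul
        (mdifferentiableAt_inner_iso hY _)) ξ).trans ?_
    refine Finset.sum_congr rfl fun j _ => ?_
    rw [mvfderiv_fun_mul (mdifferentiableAt_inner_iso hX _) (mdifferentiableAt_inner_iso hY _),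
      hXu, hYu, u.iso.inner_map_map, u.iso.inner_map_map, EuclideanSpace.inner_single_right,
      EuclideanSpace.inner_single_right]
    simp
  rw [Finset.sum_add_distrib, ← mvfderiv_inner_iso hX, ← mvfderiv_inner_iso hY] at h5
  rw [real_inner_comm] at h2
  have h6 : (inner ℝ (cov X u.pt (projDeriv u ξ)) (u.iso b) : ℝ) +
      inner ℝ (u.iso a) (cov Y u.pt (projDeriv u ξ)) = _ := h3.symm.trans h5
  rw [real_inner_comm (u.iso a)] at h2
  linarith

lemma contMDiffAt_coords_self {q₀ : Q} {u : OrthoFrame n Q}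
    (hu : u.pt ∈ (chartAt (Eucl n) q₀).source) :
    ContMDiffAt 𝓘(ℝ, FrameModel n) 𝓘(ℝ, EndEucl n) ∞
      (fun w : OrthoFrame n Q => (w.coords q₀).endo) u :=
  contMDiffAt_coords (F := fun w => w) hu (fun a => contMDiff_iso a u) (contMDiff_pt u)

/-- The chart of the frame bundle at `u₀`, as a smooth function of the base point in the chart of
`Q` and of the matrix of the frame. -/
def chartOfMatrix (u₀ : OrthoFrame n Q) (p : Eucl n × EndEucl n) : FrameModel n :=
  ((p.1, skewPart (cayley (((u₀.coords u₀.pt)⁻¹).endo * p.2))) : Eucl n × SkewEnd n)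

/-- The base point of a frame in the chart of `Q` at `q₀`, and the matrix of the frame in the local
orthonormal frame around `q₀`. -/
def matrixChart (q₀ : Q) (w : OrthoFrame n Q) : Eucl n × EndEucl n :=
  (extChartAt 𝓘(ℝ, Eucl n) q₀ w.pt, (w.coords q₀).endo)

lemma contMDiffAt_matrixChart {q₀ : Q} {u : OrthoFrame n Q}
    (hu : u.pt ∈ (chartAt (Eucl n) q₀).source) :
    ContMDiffAt 𝓘(ℝ, FrameModel n) 𝓘(ℝ, Eucl n × EndEucl n) ∞ (matrixChart q₀) u :=
  ContMDiffAt.prodMk_space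
    (ContMDiffAt.comp (g := extChartAt 𝓘(ℝ, Eucl n) q₀) u (contMDiffAt_extChartAt' hu)
      (contMDiff_pt u)) (contMDiffAt_coords_self hu)

lemma extChartAt_eq_chartOfMatrix (u₀ : OrthoFrame n Q) :
    (extChartAt 𝓘(ℝ, FrameModel n) u₀ : OrthoFrame n Q → FrameModel n) =
      chartOfMatrix u₀ ∘ matrixChart u₀.pt := rfl

lemma contDiffAt_chartOfMatrix (u₀ : OrthoFrame n Q) {w : OrthoFrame n Q}
    (hw : w ∈ (chartAt (FrameModel n) u₀).source) :
    ContDiffAt ℝ ∞ (chartOfMatrix u₀) (matrixChart u₀.pt w) := by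
  rw [← extChartAt_source 𝓘(ℝ, FrameModel n), extChartAt_orthoFrame_source] at hw
  have h1 : ContDiffAt ℝ ∞ (fun p : Eucl n × EndEucl n =>
      ((p.1, skewPart (cayley (((u₀.coords u₀.pt)⁻¹).endo * p.2))) : Eucl n × SkewEnd n))
      (matrixChart u₀.pt w) := by
    refine contDiff_fst.contDiffAt.prodMk (contDiff_skewPart.contDiffAt.comp _ ?_)
    refine ContDiffAt.comp (g := cayley)
      (f := fun p : Eucl n × EndEucl n => ((u₀.coords u₀.pt)⁻¹).endo * p.2) (matrixChart u₀.pt w)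
      (contDiffAt_cayley hw.2) (contDiff_const.mul contDiff_snd).contDiffAt
  exact h1

lemma mem_source_pt {u₀ w : OrthoFrame n Q} (hw : w ∈ (chartAt (FrameModel n) u₀).source) :
    w.pt ∈ (chartAt (Eucl n) u₀.pt).source := by
  rw [← extChartAt_source 𝓘(ℝ, FrameModel n), extChartAt_orthoFrame_source] at hw
  exact hw.1

/-- A tangent vector in the chart of `P`, in terms of its effect on the base point and on the
matrix. -/
lemma mfderiv_extChartAt_orthoFrame {u₀ w : OrthoFrame n Q}
    (hw : w ∈ (chartAt (FrameModel n) u₀).source) (ξ : TangentSpace 𝓘(ℝ, FrameModel n) w) :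
    mfderiv 𝓘(ℝ, FrameModel n) 𝓘(ℝ, FrameModel n) (extChartAt 𝓘(ℝ, FrameModel n) u₀) w ξ =
      fderiv ℝ (chartOfMatrix u₀) (matrixChart u₀.pt w)
        (mfderiv 𝓘(ℝ, Eucl n) 𝓘(ℝ, Eucl n) (extChartAt 𝓘(ℝ, Eucl n) u₀.pt) w.pt (projDeriv w ξ),
          mfderiv 𝓘(ℝ, FrameModel n) 𝓘(ℝ, EndEucl n)
            (fun w : OrthoFrame n Q => (w.coords u₀.pt).endo) w ξ) := by
  have hpt := mem_source_pt hw
  have h1 := mfderiv_comp w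
    ((contDiffAt_chartOfMatrix u₀ hw).differentiableAt (by simp)).mdifferentiableAt
    ((contMDiffAt_matrixChart hpt).mdifferentiableAt (by simp))
  rw [mfderiv_eq_fderiv] at h1
  have h2 := ((mdifferentiableAt_extChartAt (I := 𝓘(ℝ, Eucl n)) hpt).hasMFDerivAt).comp w
    (mdifferentiableAt_pt w).hasMFDerivAt
  have h3 := hasMFDerivAt_prodMk_space h2
    ((contMDiffAt_coords_self hpt).mdifferentiableAt (by simp)).hasMFDerivAt
  rw [extChartAt_eq_chartOfMatrix]
  refine (DFunLike.congr_fun h1 ξ).trans ?_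
  exact congrArg (fderiv ℝ (chartOfMatrix u₀) (matrixChart u₀.pt w))
    (DFunLike.congr_fun h3.mfderiv ξ)

end FrameCharts

/-! ### Horizontal lifts and the metric of the frame bundle -/

section HorizontalLift

variable {n : ℕ} {Q : Type*} [TopologicalSpace Q] [ChartedSpace (Eucl n) Q]
  [IsManifold 𝓘(ℝ, Eucl n) ∞ Q]
  [RiemannianBundle (fun q : Q => TangentSpace 𝓘(ℝ, Eucl n) q)]
  [IsContMDiffRiemannianBundle 𝓘(ℝ, Eucl n) ∞ (Eucl n)
    (fun q : Q => TangentSpace 𝓘(ℝ, Eucl n) q)]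
  {cov : CovariantDerivative 𝓘(ℝ, Eucl n) (Eucl n)
  (TangentSpace 𝓘(ℝ, Eucl n) : Q → Type _)}

/-- The derivative of the matrix of a frame, in terms of the connection form. -/
lemma mfderiv_coords_apply {q₀ : Q} {u : OrthoFrame n Q}
    (hu : u.pt ∈ (chartAt (Eucl n) q₀).source) {i : Fin n}
    {X : ∀ q : Q, TangentSpace 𝓘(ℝ, Eucl n) q} (hX : DiffField X u.pt)
    (hXi : ∀ᶠ q in 𝓝 u.pt, X q = localFrame q₀ q i) (b : Eucl n)
    (ξ : TangentSpace 𝓘(ℝ, FrameModel n) u) :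
    mvfderiv 𝓘(ℝ, FrameModel n) (fun w : OrthoFrame n Q => (w.coords q₀).endo) u ξ b i =
      inner ℝ (cov X u.pt (projDeriv u ξ)) (u.iso b) -
        inner ℝ (connectionForm cov u ξ (u.iso.symm (X u.pt))) b := by
  rw [inner_connectionForm cov hX (u.iso.apply_symm_apply _).symm, sub_sub_cancel]
  let L : EndEucl n →L[ℝ] ℝ := (EuclideanSpace.proj i : Eucl n →L[ℝ] ℝ).comp
    (ContinuousLinearMap.apply ℝ (Eucl n) b)
  have h1 := mfderiv_comp u (L.hasMFDerivAt.mdifferentiableAt (x := (u.coords q₀).endo))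
    ((contMDiffAt_coords_self hu).mdifferentiableAt (by simp))
  rw [L.hasMFDerivAt.mfderiv] at h1
  have h2 : (fun w : OrthoFrame n Q => (inner ℝ (X w.pt) (w.iso b) : ℝ)) =ᶠ[𝓝 u]
      L ∘ fun w : OrthoFrame n Q => (w.coords q₀).endo := by
    filter_upwards [(contMDiff_pt u).continuousAt.eventually hXi] with w hw
    rw [hw]
    exact (coords_apply q₀ w b i).symm
  have h3 : mvfderiv 𝓘(ℝ, FrameModel n)
      (fun w : OrthoFrame n Q => (inner ℝ (X w.pt) (w.iso b) : ℝ)) u ξ =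
      mfderiv 𝓘(ℝ, FrameModel n) 𝓘(ℝ, ℝ) (L ∘ fun w : OrthoFrame n Q => (w.coords q₀).endo) u ξ :=
    DFunLike.congr_fun (h2.mfderiv_eq (I := 𝓘(ℝ, FrameModel n)) (I' := 𝓘(ℝ, ℝ))) ξ
  rw [h3]
  exact (DFunLike.congr_fun h1 ξ).symm

/-- The forms `σ` and `ω` together are injective on tangent spaces. -/
lemma eq_zero_of_projDeriv_of_connectionForm {u : OrthoFrame n Q}
    {ξ : TangentSpace 𝓘(ℝ, FrameModel n) u} (h1 : projDeriv u ξ = 0)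
    (h2 : connectionForm cov u ξ = 0) : ξ = 0 := by
  have hM : mvfderiv 𝓘(ℝ, FrameModel n)
      (fun w : OrthoFrame n Q => (w.coords u.pt).endo) u ξ = 0 := by
    refine ContinuousLinearMap.ext fun b => ?_
    ext i
    have hX : DiffField (fun q => localFrame u.pt q i) u.pt :=
      ((contMDiffOn_localFrame u.pt i).contMDiffAt ((chartAt (Eucl n) u.pt).open_source.mem_nhds
        (mem_chart_source _ _))).mdifferentiableAt (by simp)
    rw [mfderiv_coords_apply (cov := cov) (mem_chart_source _ _) hX
      (Filter.Eventually.of_forall fun _ => rfl), h1, h2]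
    simp
  have h3 := mfderiv_extChartAt_orthoFrame (mem_chart_source (FrameModel n) u) ξ
  have h4 : (ξ : FrameModel n) = _ := (mfderiv_extChartAt_self_apply rfl ξ).symm.trans h3
  rw [h1] at h4
  refine h4.trans ?_
  refine (congrArg (fderiv ℝ (chartOfMatrix u) (matrixChart u.pt u)) (a₂ := 0) ?_).trans
    (map_zero _)
  exact Prod.ext (map_zero _) hM

lemma mem_skewEnd_of_inner {A : EndEucl n}
    (hA : ∀ a b, (inner ℝ (A a) b : ℝ) = -inner ℝ a (A b)) : A ∈ SkewEnd n := by
  refine mem_skewEnd.2 (ContinuousLinearMap.ext fun a => ext_inner_right ℝ fun b => ?_)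
  rw [ContinuousLinearMap.star_eq_adjoint, ContinuousLinearMap.adjoint_inner_left,
    neg_apply, inner_neg_left, hA, neg_neg]

lemma connectionForm_mem (hm : cov.IsMetricCompatible) (u : OrthoFrame n Q)
    (ξ : TangentSpace 𝓘(ℝ, FrameModel n) u) : connectionForm cov u ξ ∈ SkewEnd n :=
  mem_skewEnd_of_inner (connectionForm_skew hm u ξ)

/-- Horizontal lifts exist: `(Tρ, ω)` is injective on `T_uP`, which has the dimension of
`ℝⁿ × 𝔬(n)`. -/
lemma exists_horizontal (hm : cov.IsMetricCompatible) (u : OrthoFrame n Q)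
    (v : TangentSpace 𝓘(ℝ, Eucl n) u.pt) :
    ∃ ξ, projDeriv u ξ = v ∧ connectionForm cov u ξ = 0 := by
  let T : FrameModel n →ₗ[ℝ] Eucl n × SkewEnd n :=
    { toFun := fun ξ => ((projDeriv u ξ : Eucl n),
        ⟨connectionForm cov u ξ, connectionForm_mem hm u ξ⟩)
      map_add' := fun ξ ζ => Prod.ext (map_add (projDeriv u) ξ ζ)
        (Subtype.ext (map_add (connectionForm cov u) ξ ζ))
      map_smul' := fun c ξ => Prod.ext (map_smul (projDeriv u) c ξ)
        (Subtype.ext (map_smul (connectionForm cov u) c ξ)) }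
  have hinj : Function.Injective T := by
    rw [injective_iff_map_eq_zero]
    intro ξ hξ
    exact eq_zero_of_projDeriv_of_connectionForm (cov := cov) (congrArg Prod.fst hξ)
      (congrArg (fun p : Eucl n × SkewEnd n => (p.2 : EndEucl n)) hξ)
  have hdim : Module.finrank ℝ (FrameModel n) = Module.finrank ℝ (Eucl n × SkewEnd n) := rfl
  have hfin : FiniteDimensional ℝ (Eucl n × SkewEnd n) :=
    inferInstanceAs (FiniteDimensional ℝ (FrameModel n))
  obtain ⟨ξ, hξ⟩ := (LinearMap.injective_iff_surjective_of_finrank_eq_finrank hdim).1 hinj (v, 0)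
  exact ⟨ξ, congrArg Prod.fst hξ,
    congrArg (fun p : Eucl n × SkewEnd n => (p.2 : EndEucl n)) hξ⟩

lemma projDeriv_horizontalLift (hm : cov.IsMetricCompatible) (u : OrthoFrame n Q)
    (v : TangentSpace 𝓘(ℝ, Eucl n) u.pt) : projDeriv u (horizontalLift cov u v) = v :=
  (Classical.epsilon_spec (exists_horizontal hm u v)).1

lemma connectionForm_horizontalLift (hm : cov.IsMetricCompatible) (u : OrthoFrame n Q)
    (v : TangentSpace 𝓘(ℝ, Eucl n) u.pt) : connectionForm cov u (horizontalLift cov u v) = 0 :=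
  (Classical.epsilon_spec (exists_horizontal hm u v)).2

lemma eq_horizontalLift (hm : cov.IsMetricCompatible) {u : OrthoFrame n Q}
    {v : TangentSpace 𝓘(ℝ, Eucl n) u.pt} {ξ : TangentSpace 𝓘(ℝ, FrameModel n) u}
    (h1 : projDeriv u ξ = v) (h2 : connectionForm cov u ξ = 0) : ξ = horizontalLift cov u v := by
  rw [← sub_eq_zero]
  refine eq_zero_of_projDeriv_of_connectionForm (cov := cov) ?_ ?_
  · rw [map_sub, h1, projDeriv_horizontalLift hm, sub_self]
  · rw [map_sub, h2, connectionForm_horizontalLift hm, sub_self]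

lemma horizontalLift_sum_smul (hm : cov.IsMetricCompatible) (u : OrthoFrame n Q) (c : Fin n → ℝ)
    (v : Fin n → TangentSpace 𝓘(ℝ, Eucl n) u.pt) :
    horizontalLift cov u (∑ i, c i • v i) = ∑ i, c i • horizontalLift cov u (v i) := by
  refine (eq_horizontalLift hm ?_ ?_).symm
  · simp_rw [map_sum, map_smul, projDeriv_horizontalLift hm]
  · refine (map_sum (connectionForm cov u) _ _).trans (Finset.sum_eq_zero fun i _ => ?_)
    exact ((connectionForm cov u).map_smul _ _).trans
      ((congrArg _ (connectionForm_horizontalLift hm u (v i))).trans (smul_zero _))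

lemma soldering_apply (u : OrthoFrame n Q) (ξ : TangentSpace 𝓘(ℝ, FrameModel n) u) :
    soldering u ξ = u.iso.symm (projDeriv u ξ) := rfl

lemma sum_bilinearComp_apply {W : Type*} [NormedAddCommGroup W] [NormedSpace ℝ W]
    (s : W →L[ℝ] Eucl n) (c : Fin n → W →L[ℝ] Eucl n) (x y : W) :
    ((innerSL ℝ).bilinearComp s s + ∑ j : Fin n, (innerSL ℝ).bilinearComp (c j) (c j) :
      W →L[ℝ] W →L[ℝ] ℝ) x y = inner ℝ (s x) (s y) + ∑ j, inner ℝ (c j x) (c j y) := by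
  rw [add_apply, add_apply, sum_apply, sum_apply]
  rfl

lemma frameMetric_apply (u : OrthoFrame n Q) (ξ ζ : TangentSpace 𝓘(ℝ, FrameModel n) u) :
    frameMetric cov u ξ ζ = inner ℝ (soldering u ξ) (soldering u ζ) +
      ∑ j, inner ℝ (connectionForm cov u ξ (EuclideanSpace.single j 1))
        (connectionForm cov u ζ (EuclideanSpace.single j 1)) :=
  sum_bilinearComp_apply (W := FrameModel n) _ _ ξ ζ

lemma frameMetric_isInvertible (u : OrthoFrame n Q) :
    ContinuousLinearMap.IsInvertible
      (frameMetric cov u : FrameModel n →L[ℝ] FrameModel n →L[ℝ] ℝ) := by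
  refine isInvertible_of_injective (W := FrameModel n) _
    ((injective_iff_map_eq_zero (frameMetric cov u)).2 fun ξ hξ => ?_)
  have h1 : frameMetric cov u ξ ξ = 0 := DFunLike.congr_fun hξ ξ
  rw [frameMetric_apply] at h1
  have h2 : 0 ≤ (inner ℝ (soldering u ξ) (soldering u ξ) : ℝ) := real_inner_self_nonneg
  have h3 : ∀ j ∈ Finset.univ, 0 ≤ (inner ℝ (connectionForm cov u ξ (EuclideanSpace.single j 1))
      (connectionForm cov u ξ (EuclideanSpace.single j 1)) : ℝ) := fun j _ => real_inner_self_nonneg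
  have h4 := Finset.sum_nonneg h3
  have h5 : soldering u ξ = 0 := by
    rw [← inner_self_eq_zero (𝕜 := ℝ)]
    linarith
  have h6 := (Finset.sum_eq_zero_iff_of_nonneg h3).1 (by linarith)
  refine eq_zero_of_projDeriv_of_connectionForm (cov := cov) ?_
    (ContinuousLinearMap.ext fun a => ?_)
  · rw [soldering_apply] at h5
    simpa using h5
  · rw [← eucl_eq_sum a, map_sum]
    simp_rw [map_smul]
    refine (Finset.sum_eq_zero fun j hj => ?_).trans rfl
    rw [inner_self_eq_zero.1 (h6 j hj), smul_zero]

lemma frameMetric_inverse (u : OrthoFrame n Q) (α : TangentSpace 𝓘(ℝ, FrameModel n) u →L[ℝ] ℝ)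
    (ζ : TangentSpace 𝓘(ℝ, FrameModel n) u) :
    frameMetric cov u ((frameMetric cov u).inverse α) ζ = α ζ := by
  obtain ⟨e, he⟩ := frameMetric_isInvertible (cov := cov) u
  have h1 : (frameMetric cov u).inverse α = e.symm α := by
    have := ContinuousLinearMap.inverse_equiv e
    rw [he] at this
    exact DFunLike.congr_fun this α
  rw [h1]
  exact DFunLike.congr_fun ((DFunLike.congr_fun he.symm (e.symm α)).trans (e.apply_symm_apply α)) ζ

/-- `B(L_i, ζ) = ⟨e_i, σ ζ⟩`, since `L_i` is horizontal. -/
lemma frameMetric_canonicalHorizontal (hm : cov.IsMetricCompatible) (i : Fin n)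
    (u : OrthoFrame n Q) (ζ : TangentSpace 𝓘(ℝ, FrameModel n) u) :
    frameMetric cov u ζ (canonicalHorizontal cov i u) = soldering u ζ i := by
  rw [frameMetric_apply, canonicalHorizontal, connectionForm_horizontalLift hm, soldering_apply u
    (horizontalLift _ _ _), projDeriv_horizontalLift hm, LinearIsometryEquiv.symm_apply_apply,
    EuclideanSpace.inner_single_right]
  simp

/-- The map `T*P → T*Q` in terms of the momenta of the canonical horizontal fields. -/
lemma cotangentProj_eq (hm : cov.IsMetricCompatible) (η : CotangentFrame n Q) :
    cotangentProj cov η =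
      ⟨η.1.pt, innerSL ℝ (η.1.iso (WithLp.toLp 2 fun i => momentum cov i η))⟩ := by
  have h1 : projDeriv η.1 ((frameMetric cov η.1).inverse η.2) =
      η.1.iso (WithLp.toLp 2 fun i => momentum cov i η) := by
    rw [← η.1.iso.symm_apply_eq, ← soldering_apply]
    ext i
    rw [← frameMetric_canonicalHorizontal hm, frameMetric_inverse]
    rfl
  rw [cotangentProj, h1]

end HorizontalLift

/-! ### Smoothness of the momenta -/

section Smoothness

variable {n : ℕ} {Q : Type*} [TopologicalSpace Q] [ChartedSpace (Eucl n) Q]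
  [IsManifold 𝓘(ℝ, Eucl n) ∞ Q]
  [RiemannianBundle (fun q : Q => TangentSpace 𝓘(ℝ, Eucl n) q)]
  [IsContMDiffRiemannianBundle 𝓘(ℝ, Eucl n) ∞ (Eucl n)
    (fun q : Q => TangentSpace 𝓘(ℝ, Eucl n) q)]
  {cov : CovariantDerivative 𝓘(ℝ, Eucl n) (Eucl n)
  (TangentSpace 𝓘(ℝ, Eucl n) : Q → Type _)}

/-- A local frame field agrees near its base point with a smooth field on all of `Q`. -/
lemma exists_contMDiff_eq_localFrame [T2Space Q] (q₀ : Q) (i : Fin n) :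
    ∃ X : ∀ q : Q, TangentSpace 𝓘(ℝ, Eucl n) q,
      ContMDiff 𝓘(ℝ, Eucl n) 𝓘(ℝ, Eucl n).tangent ∞
        (fun q => (⟨q, X q⟩ : TangentBundle 𝓘(ℝ, Eucl n) Q)) ∧
      ∀ᶠ q in 𝓝 q₀, X q = localFrame q₀ q i := by
  obtain ⟨f⟩ : Nonempty (SmoothBumpFunction 𝓘(ℝ, Eucl n) q₀) := inferInstance
  refine ⟨fun q => f q • localFrame q₀ q i,
    ContMDiffOn.smul_section_of_tsupport f.contMDiff.contMDiffOn (chartAt (Eucl n) q₀).open_source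
      f.tsupport_subset_chartAt_source (contMDiffOn_localFrame q₀ i), ?_⟩
  filter_upwards [f.eventuallyEq_one] with q hq
  rw [hq, Pi.one_apply, one_smul]

lemma contMDiff_covariantDerivative
    (hs : CovariantDerivative.ContMDiffCovariantDerivative cov ∞)
    {X : ∀ q : Q, TangentSpace 𝓘(ℝ, Eucl n) q}
    (hX : ContMDiff 𝓘(ℝ, Eucl n) 𝓘(ℝ, Eucl n).tangent ∞
      (fun q => (⟨q, X q⟩ : TangentBundle 𝓘(ℝ, Eucl n) Q))) :
    ContMDiff 𝓘(ℝ, Eucl n) (𝓘(ℝ, Eucl n).prod 𝓘(ℝ, Eucl n →L[ℝ] Eucl n)) ∞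
      (fun q => (⟨q, cov X q⟩ : TotalSpace (Eucl n →L[ℝ] Eucl n)
        fun q : Q => TangentSpace 𝓘(ℝ, Eucl n) q →L[ℝ] TangentSpace 𝓘(ℝ, Eucl n) q)) :=
  contMDiffOn_univ.1 (hs.contMDiff.contMDiff hX.contMDiffOn)

/-- The field `u ↦ hl_u(u a)` is smooth: in the chart at `u₀` it is determined by its effect `u a`
on the base point and by the derivatives of the matrix of the frame, whose entries are
`⟨∇_{u a} Xᵢ, u b⟩` for the local frame `Xᵢ`. -/
lemma contMDiff_horizontalLift_iso [T2Space Q]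
    (hs : CovariantDerivative.ContMDiffCovariantDerivative cov ∞)
    (hm : cov.IsMetricCompatible) (a : Eucl n) :
    ContMDiff 𝓘(ℝ, FrameModel n) 𝓘(ℝ, FrameModel n).tangent ∞
      (fun u : OrthoFrame n Q => (⟨u, horizontalLift cov u (u.iso a)⟩ :
        TangentBundle 𝓘(ℝ, FrameModel n) (OrthoFrame n Q))) := by
  intro u₀
  refine (contMDiffAt_tangentBundle_iff (b := fun u : OrthoFrame n Q => u) contMDiffAt_id).2 ?_
  have h1 : ContMDiffAt 𝓘(ℝ, FrameModel n) 𝓘(ℝ, Eucl n) ∞ (fun u : OrthoFrame n Q =>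
      mfderiv 𝓘(ℝ, Eucl n) 𝓘(ℝ, Eucl n) (extChartAt 𝓘(ℝ, Eucl n) u₀.pt) u.pt (u.iso a)) u₀ :=
    (contMDiffAt_tangentBundle_iff (contMDiff_pt u₀)).1 (contMDiff_iso a u₀)
  have h2 : ContMDiffAt 𝓘(ℝ, FrameModel n) 𝓘(ℝ, EndEucl n) ∞ (fun u : OrthoFrame n Q =>
      mvfderiv 𝓘(ℝ, FrameModel n) (fun w : OrthoFrame n Q => (w.coords u₀.pt).endo) u
        (horizontalLift cov u (u.iso a))) u₀ := by
    refine contMDiffAt_endEucl_iff.2 fun b i => ?_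
    obtain ⟨X, hX, hXi⟩ := exists_contMDiff_eq_localFrame u₀.pt i
    have h3 : ContMDiffAt 𝓘(ℝ, FrameModel n) 𝓘(ℝ, Eucl n).tangent ∞ (fun u : OrthoFrame n Q =>
        (⟨u.pt, cov X u.pt (u.iso a)⟩ : TangentBundle 𝓘(ℝ, Eucl n) Q)) u₀ :=
      ContMDiffAt.clm_bundle_apply
        (((contMDiff_covariantDerivative hs hX) u₀.pt).comp u₀ (contMDiff_pt u₀))
        (contMDiff_iso a u₀)
    have h4 : ContMDiffAt 𝓘(ℝ, FrameModel n) 𝓘(ℝ, ℝ) ∞ (fun u : OrthoFrame n Q =>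
        (inner ℝ (cov X u.pt (u.iso a)) (u.iso b) : ℝ)) u₀ :=
      ContMDiffAt.inner_bundle (IB := 𝓘(ℝ, Eucl n)) h3 (contMDiff_iso b u₀)
    refine h4.congr_of_eventuallyEq ?_
    have hpt := (contMDiff_pt u₀).continuousAt
    filter_upwards [hpt.eventually hXi.eventually_nhds, hpt.eventually
      ((chartAt (Eucl n) u₀.pt).open_source.mem_nhds (mem_chart_source _ _))] with u hu hu'
    rw [mfderiv_coords_apply (cov := cov) hu' ((hX u.pt).mdifferentiableAt (by simp)) hu,
      projDeriv_horizontalLift hm, connectionForm_horizontalLift hm]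
    simp
  have h3 : ContMDiffAt 𝓘(ℝ, FrameModel n) 𝓘(ℝ, Eucl n × EndEucl n →L[ℝ] FrameModel n) ∞
      (fun u : OrthoFrame n Q => fderiv ℝ (chartOfMatrix u₀) (matrixChart u₀.pt u)) u₀ := by
    have h5 : ContDiffAt ℝ ∞ (fderiv ℝ (chartOfMatrix u₀)) (matrixChart u₀.pt u₀) :=
      (contDiffAt_chartOfMatrix u₀ (mem_chart_source _ _)).fderiv_right (m := ∞) (by simp)
    exact h5.contMDiffAt.comp u₀ (contMDiffAt_matrixChart (mem_chart_source _ _))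
  refine (h3.clm_apply (h1.prodMk_space h2)).congr_of_eventuallyEq ?_
  filter_upwards [(chartAt (FrameModel n) u₀).open_source.mem_nhds (mem_chart_source _ _)] with u hu
  rw [mfderiv_extChartAt_orthoFrame hu, projDeriv_horizontalLift hm]
  rfl

lemma contMDiff_momentum [T2Space Q] (hc : IsLeviCivita cov) (i : Fin n) :
    ContMDiff (CotangentFrameModel n) 𝓘(ℝ, ℝ) ∞ (momentum (Q := Q) cov i) := by
  intro η
  have h1 : ContMDiffAt (CotangentFrameModel n) (CotangentFrameModel n) ∞
      (fun ζ : CotangentFrame n Q => ζ) η := contMDiffAt_id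
  have hL := (contMDiff_horizontalLift_iso hc.smooth hc.metric
    (EuclideanSpace.single i (1 : ℝ)) η.1).comp η
    (contMDiff_cotangent_proj (E := FrameModel n) η)
  have h2 : ContMDiffAt (CotangentFrameModel n) (𝓘(ℝ, FrameModel n).prod 𝓘(ℝ, ℝ)) ∞
      (fun ζ : CotangentFrame n Q => (⟨ζ.1, ζ.2 (canonicalHorizontal cov i ζ.1)⟩ :
        TotalSpace ℝ (Trivial (OrthoFrame n Q) ℝ))) η :=
    ContMDiffAt.clm_bundle_apply (E₁ := fun x : OrthoFrame n Q => TangentSpace 𝓘(ℝ, FrameModel n) x)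
      (F₁ := FrameModel n) (F₂ := ℝ) (E₂ := Trivial (OrthoFrame n Q) ℝ)
      (b := fun ζ : CotangentFrame n Q => ζ.1)
      (ϕ := fun ζ => ζ.2) (v := fun ζ => canonicalHorizontal cov i ζ.1) h1 hL
  exact (contMDiffAt_totalSpace.1 h2).2

lemma contMDiff_cotangentProj [T2Space Q] (hc : IsLeviCivita cov) :
    ContMDiff (CotangentFrameModel n) (𝓘(ℝ, Eucl n).prod 𝓘(ℝ, Eucl n →L[ℝ] ℝ)) ∞
      (cotangentProj (Q := Q) cov) := by
  intro η
  obtain ⟨g, hg, hg'⟩ := IsContMDiffRiemannianBundle.exists_contMDiff (IB := 𝓘(ℝ, Eucl n))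
    (n := ∞) (F := Eucl n) (E := fun q : Q => TangentSpace 𝓘(ℝ, Eucl n) q)
  have hpt : ContMDiffAt (CotangentFrameModel n) 𝓘(ℝ, Eucl n) ∞
      (fun ζ : CotangentFrame n Q => ζ.1.pt) η :=
    (contMDiff_pt η.1).comp η (contMDiff_cotangent_proj (E := FrameModel n) η)
  have h1 : ContMDiffAt (CotangentFrameModel n) 𝓘(ℝ, Eucl n).tangent ∞
      (fun ζ : CotangentFrame n Q => (⟨ζ.1.pt, ∑ i, momentum cov i ζ •
        ζ.1.iso (EuclideanSpace.single i 1)⟩ : TangentBundle 𝓘(ℝ, Eucl n) Q)) η :=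
    contMDiffAt_sum_smul hpt (fun i => contMDiff_momentum hc i η)
      fun i => (contMDiff_iso (EuclideanSpace.single i (1 : ℝ)) η.1).comp η
        (contMDiff_cotangent_proj (E := FrameModel n) η)
  have h2 : ContMDiffAt (CotangentFrameModel n) (𝓘(ℝ, Eucl n).prod 𝓘(ℝ, Eucl n →L[ℝ] ℝ)) ∞
      (fun ζ : CotangentFrame n Q => (⟨ζ.1.pt, g ζ.1.pt (∑ i, momentum cov i ζ •
        ζ.1.iso (EuclideanSpace.single i 1))⟩ : Cotangent 𝓘(ℝ, Eucl n) Q)) η :=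
    ContMDiffAt.clm_bundle_apply (E₁ := fun q : Q => TangentSpace 𝓘(ℝ, Eucl n) q) (F₁ := Eucl n)
      (F₂ := Eucl n →L[ℝ] ℝ) (E₂ := fun q : Q => TangentSpace 𝓘(ℝ, Eucl n) q →L[ℝ] Trivial Q ℝ q)
      (b := fun ζ : CotangentFrame n Q => ζ.1.pt) (ϕ := fun ζ => g ζ.1.pt)
      ((hg η.1.pt).comp η hpt) h1
  refine h2.congr_of_eventuallyEq (Filter.Eventually.of_forall fun ζ => ?_)
  rw [cotangentProj_eq hc.metric, iso_eq_sum_single]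
  refine cotangent_ext rfl fun v => ?_
  exact hg' _ _ _

end Smoothness

/-! ### Isometries preserve the connection -/

section Isometries

variable {n : ℕ} {Q : Type*} [TopologicalSpace Q] [ChartedSpace (Eucl n) Q]
  [IsManifold 𝓘(ℝ, Eucl n) ∞ Q]
  [RiemannianBundle (fun q : Q => TangentSpace 𝓘(ℝ, Eucl n) q)]
  [IsContMDiffRiemannianBundle 𝓘(ℝ, Eucl n) ∞ (Eucl n)
    (fun q : Q => TangentSpace 𝓘(ℝ, Eucl n) q)]
  {cov : CovariantDerivative 𝓘(ℝ, Eucl n) (Eucl n)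
  (TangentSpace 𝓘(ℝ, Eucl n) : Q → Type _)}
  {G : Type*} [Group G] [MulAction G Q]

lemma isInvertible_mfderiv_smul
    (hs : ∀ g : G, ContMDiff 𝓘(ℝ, Eucl n) 𝓘(ℝ, Eucl n) ∞ (fun q : Q => g • q)) (g : G) (q : Q) :
    (mfderiv 𝓘(ℝ, Eucl n) 𝓘(ℝ, Eucl n) (fun x : Q => g • x) q).IsInvertible :=
  isInvertible_mfderiv_of_inverse (g := fun x : Q => g⁻¹ • x) (inv_smul_smul g) (smul_inv_smul g)
    ((hs g).mdifferentiable (by simp)) ((hs g⁻¹).mdifferentiable (by simp))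

/-- The vector field `X` on `Q`, pulled back by the action of `g`. -/
abbrev smulPullback (g : G) (X : ∀ q : Q, TangentSpace 𝓘(ℝ, Eucl n) q) :
    ∀ q : Q, TangentSpace 𝓘(ℝ, Eucl n) q :=
  VectorField.mpullback 𝓘(ℝ, Eucl n) 𝓘(ℝ, Eucl n) (fun x : Q => g • x) X

lemma mfderiv_smulPullback
    (hs : ∀ g : G, ContMDiff 𝓘(ℝ, Eucl n) 𝓘(ℝ, Eucl n) ∞ (fun q : Q => g • q)) (g : G)
    (X : ∀ q : Q, TangentSpace 𝓘(ℝ, Eucl n) q) (q : Q) :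
    mfderiv 𝓘(ℝ, Eucl n) 𝓘(ℝ, Eucl n) (fun x : Q => g • x) q (smulPullback g X q) = X (g • q) :=
  (isInvertible_mfderiv_smul hs g q).self_apply_inverse _

lemma diffField_smulPullback
    (hs : ∀ g : G, ContMDiff 𝓘(ℝ, Eucl n) 𝓘(ℝ, Eucl n) ∞ (fun q : Q => g • q)) {g : G}
    {X : ∀ q : Q, TangentSpace 𝓘(ℝ, Eucl n) q} {q : Q} (hX : DiffField X (g • q)) :
    DiffField (smulPullback g X) q :=
  MDifferentiableAt.mpullback_vectorField (n := ∞) hX ((hs g) q) (isInvertible_mfderiv_smul hs g q)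
    (WithTop.coe_le_coe.2 le_top)

variable [TopologicalSpace G]

lemma inner_smulPullback (hG : ActsByIsometries n Q G)
    (hs : ∀ g : G, ContMDiff 𝓘(ℝ, Eucl n) 𝓘(ℝ, Eucl n) ∞ (fun q : Q => g • q)) (g : G)
    (X : ∀ q : Q, TangentSpace 𝓘(ℝ, Eucl n) q) (q : Q) (v : TangentSpace 𝓘(ℝ, Eucl n) q) :
    (inner ℝ (smulPullback g X q) v : ℝ) = inner ℝ (X (g • q))
      (mfderiv 𝓘(ℝ, Eucl n) 𝓘(ℝ, Eucl n) (fun x : Q => g • x) q v) := by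
  rw [← hG g q, mfderiv_smulPullback hs]

/-- `⟨Tg (∇_{g^*X} g^*Y) - ∇_X Y, Z⟩` at `g q`, the failure of `g` to preserve the connection. The
first term is written with `g^*Z` at `q`, which is the same for an isometry `g`. -/
def covDefect (cov : CovariantDerivative 𝓘(ℝ, Eucl n) (Eucl n)
    (TangentSpace 𝓘(ℝ, Eucl n) : Q → Type _)) (g : G) (q : Q)
    (X Y Z : ∀ q : Q, TangentSpace 𝓘(ℝ, Eucl n) q) : ℝ :=
  inner ℝ (cov (smulPullback g Y) q (smulPullback g X q)) (smulPullback g Z q) -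
    inner ℝ (cov Y (g • q) (X (g • q))) (Z (g • q))

/-- By freeness of torsion, the defect is symmetric in the first two fields. -/
lemma covDefect_symm (hG : ActsByIsometries n Q G) (ht : cov.torsion = 0)
    (hs : ∀ g : G, ContMDiff 𝓘(ℝ, Eucl n) 𝓘(ℝ, Eucl n) ∞ (fun q : Q => g • q)) (g : G) (q : Q)
    {X Y : ∀ q : Q, TangentSpace 𝓘(ℝ, Eucl n) q} (hX : DiffField X (g • q))
    (hY : DiffField Y (g • q)) (Z : ∀ q : Q, TangentSpace 𝓘(ℝ, Eucl n) q) :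
    covDefect cov g q X Y Z = covDefect cov g q Y X Z := by
  have h1 := cov.torsion_eq_zero_iff.1 ht hX hY
  have h2 := cov.torsion_eq_zero_iff.1 ht (diffField_smulPullback hs hX)
    (diffField_smulPullback hs hY)
  have : IsManifold 𝓘(ℝ, Eucl n) (minSmoothness ℝ 2) Q := by
    rw [minSmoothness_of_isRCLikeNormedField]
    exact IsManifold.of_le (n := ∞) (WithTop.coe_le_coe.2 le_top)
  have h3 := VectorField.mpullback_mlieBracket (I := 𝓘(ℝ, Eucl n)) (I' := 𝓘(ℝ, Eucl n)) (n := ∞)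
    hX hY ((hs g) q) (by
      simp only [minSmoothness_of_isRCLikeNormedField]
      exact WithTop.coe_le_coe.2 le_top)
  have h4 := inner_smulPullback hG hs g (VectorField.mlieBracket 𝓘(ℝ, Eucl n) X Y) q
    (smulPullback g Z q)
  rw [mfderiv_smulPullback hs] at h4
  have h5 : (inner ℝ (cov (smulPullback g Y) q (smulPullback g X q) -
      cov (smulPullback g X) q (smulPullback g Y q)) (smulPullback g Z q) : ℝ) =
      inner ℝ (cov Y (g • q) (X (g • q)) - cov X (g • q) (Y (g • q))) (Z (g • q)) := by
    rw [h2, h1, ← h4, ← h3]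
  rw [inner_sub_left, inner_sub_left] at h5
  rw [covDefect, covDefect]
  linarith

/-- By metricity, the defect is skew-symmetric in the last two fields. -/
lemma covDefect_skew (hG : ActsByIsometries n Q G) (hm : cov.IsMetricCompatible)
    (hs : ∀ g : G, ContMDiff 𝓘(ℝ, Eucl n) 𝓘(ℝ, Eucl n) ∞ (fun q : Q => g • q)) (g : G) (q : Q)
    (X : ∀ q : Q, TangentSpace 𝓘(ℝ, Eucl n) q)
    {Y Z : ∀ q : Q, TangentSpace 𝓘(ℝ, Eucl n) q} (hY : DiffField Y (g • q))
    (hZ : DiffField Z (g • q)) :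
    covDefect cov g q X Y Z = -covDefect cov g q X Z Y := by
  have h1 := hm.mvfderiv_inner_eq X hY hZ
  have h2 := hm.mvfderiv_inner_eq (smulPullback g X) (diffField_smulPullback hs hY)
    (diffField_smulPullback hs hZ)
  have h3 : (fun x => (inner ℝ (smulPullback g Y x) (smulPullback g Z x) : ℝ)) =
      (fun x => (inner ℝ (Y x) (Z x) : ℝ)) ∘ fun x : Q => g • x := by
    funext x
    rw [inner_smulPullback hG hs, mfderiv_smulPullback hs]
    rfl
  have h4 := DFunLike.congr_fun (mvfderiv_comp (I := 𝓘(ℝ, Eucl n)) (I' := 𝓘(ℝ, Eucl n))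
    (f := fun x : Q => g • x) (g := fun x => (inner ℝ (Y x) (Z x) : ℝ)) q
    (MDifferentiableAt.inner_bundle hY hZ) ((hs g).mdifferentiable (by simp) q))
    (smulPullback g X q)
  rw [← h3] at h4
  have h5 : mvfderiv 𝓘(ℝ, Eucl n) (fun x => (inner ℝ (smulPullback g Y x) (smulPullback g Z x) : ℝ))
      q (smulPullback g X q) =
      mvfderiv 𝓘(ℝ, Eucl n) (fun x => (inner ℝ (Y x) (Z x) : ℝ)) (g • q) (X (g • q)) :=
    h4.trans (congrArg _ (mfderiv_smulPullback hs g X q))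
  have h6 := h2.symm.trans (h5.trans h1)
  rw [covDefect, covDefect, real_inner_comm (smulPullback g Y q), real_inner_comm (Y (g • q))]
  linarith

/-- The Levi-Civita connection is preserved by isometries. -/
lemma mfderiv_smul_covariantDerivative (hG : ActsByIsometries n Q G) (hc : IsLeviCivita cov)
    (hs : ∀ g : G, ContMDiff 𝓘(ℝ, Eucl n) 𝓘(ℝ, Eucl n) ∞ (fun q : Q => g • q)) (g : G) (q : Q)
    {Y : ∀ q : Q, TangentSpace 𝓘(ℝ, Eucl n) q} (hY : DiffField Y (g • q))
    (v w : TangentSpace 𝓘(ℝ, Eucl n) q) :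
    (inner ℝ (cov Y (g • q) (mfderiv 𝓘(ℝ, Eucl n) 𝓘(ℝ, Eucl n) (fun x : Q => g • x) q v))
      (mfderiv 𝓘(ℝ, Eucl n) 𝓘(ℝ, Eucl n) (fun x : Q => g • x) q w) : ℝ) =
      inner ℝ (cov (smulPullback g Y) q v) w := by
  have key : ∀ X Y Z : ∀ q : Q, TangentSpace 𝓘(ℝ, Eucl n) q, DiffField X (g • q) →
      DiffField Y (g • q) → DiffField Z (g • q) → covDefect cov g q X Y Z = 0 := by
    intro X Y Z hX hY hZ
    have hsym := fun X Y hX hY Z =>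
      covDefect_symm (cov := cov) hG hc.torsion_eq_zero hs g q (X := X) (Y := Y) hX hY Z
    have hskew := fun X Y Z hY hZ =>
      covDefect_skew (cov := cov) hG hc.metric hs g q X (Y := Y) (Z := Z) hY hZ
    -- `(X, Y, Z) → (Y, X, Z) → (Y, Z, X) → (Z, Y, X) → (Z, X, Y) → (X, Z, Y) → (X, Y, Z)` changes
    -- the sign three times
    linarith [hsym X Y hX hY Z, hskew Y X Z hX hZ, hsym Y Z hY hZ X, hskew Z Y X hY hX,
      hsym Z X hZ hX Y, hskew X Z Y hZ hY]
  let X : ∀ q : Q, TangentSpace 𝓘(ℝ, Eucl n) q := FiberBundle.extend (Eucl n)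
    (mfderiv 𝓘(ℝ, Eucl n) 𝓘(ℝ, Eucl n) (fun x : Q => g • x) q v)
  let Z : ∀ q : Q, TangentSpace 𝓘(ℝ, Eucl n) q := FiberBundle.extend (Eucl n)
    (mfderiv 𝓘(ℝ, Eucl n) 𝓘(ℝ, Eucl n) (fun x : Q => g • x) q w)
  have hXv : X (g • q) = mfderiv 𝓘(ℝ, Eucl n) 𝓘(ℝ, Eucl n) (fun x : Q => g • x) q v :=
    FiberBundle.extend_apply_self (Eucl n) _
  have hZw : Z (g • q) = mfderiv 𝓘(ℝ, Eucl n) 𝓘(ℝ, Eucl n) (fun x : Q => g • x) q w :=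
    FiberBundle.extend_apply_self (Eucl n) _
  have h1 := key X Y Z (FiberBundle.mdifferentiableAt_extend ..) hY
    (FiberBundle.mdifferentiableAt_extend ..)
  have hX' : smulPullback g X q = v :=
    (congrArg _ hXv).trans ((isInvertible_mfderiv_smul hs g q).inverse_apply_self v)
  have hZ' : smulPullback g Z q = w :=
    (congrArg _ hZw).trans ((isInvertible_mfderiv_smul hs g q).inverse_apply_self w)
  rw [covDefect, hX', hZ', hXv, hZw] at h1
  linarith

variable (hG : ActsByIsometries n Q G)

lemma projDeriv_mfderiv_frameAct
    (hs : ∀ g : G, ContMDiff 𝓘(ℝ, Eucl n) 𝓘(ℝ, Eucl n) ∞ (fun q : Q => g • q))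
    (h : OrthGroup n × G) (u : OrthoFrame n Q) (ξ : TangentSpace 𝓘(ℝ, FrameModel n) u) :
    projDeriv (frameAct hG h u)
      (mfderiv 𝓘(ℝ, FrameModel n) 𝓘(ℝ, FrameModel n) (frameAct hG h) u ξ) =
      mfderiv 𝓘(ℝ, Eucl n) 𝓘(ℝ, Eucl n) (fun x : Q => h.2 • x) u.pt (projDeriv u ξ) := by
  have h1 := mfderiv_comp (g := fun w : OrthoFrame n Q => w.pt) (f := frameAct hG h) u
    (mdifferentiableAt_pt _) ((contMDiff_frameAct hG hs h).mdifferentiable (by simp) u)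
  have h2 := mfderiv_comp (g := fun x : Q => h.2 • x) (f := fun w : OrthoFrame n Q => w.pt) u
    ((hs h.2).mdifferentiable (by simp) _) (mdifferentiableAt_pt u)
  exact (DFunLike.congr_fun h1 ξ).symm.trans (DFunLike.congr_fun h2 ξ)

/-- The connection form is equivariant: `(k, g)^* ω = k ω k⁻¹`. -/
lemma inner_connectionForm_frameAct (hc : IsLeviCivita cov)
    (hs : ∀ g : G, ContMDiff 𝓘(ℝ, Eucl n) 𝓘(ℝ, Eucl n) ∞ (fun q : Q => g • q))
    (h : OrthGroup n × G) (u : OrthoFrame n Q) (ξ : TangentSpace 𝓘(ℝ, FrameModel n) u)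
    (a b : Eucl n) :
    (inner ℝ (connectionForm cov (frameAct hG h u)
      (mfderiv 𝓘(ℝ, FrameModel n) 𝓘(ℝ, FrameModel n) (frameAct hG h) u ξ) a) b : ℝ) =
      inner ℝ (connectionForm cov u ξ (h.1⁻¹ a)) (h.1⁻¹ b) := by
  let X : ∀ q : Q, TangentSpace 𝓘(ℝ, Eucl n) q :=
    FiberBundle.extend (Eucl n) ((frameAct hG h u).iso a)
  have hX : DiffField X (h.2 • u.pt) := FiberBundle.mdifferentiableAt_extend ..
  have hXa : X (frameAct hG h u).pt = (frameAct hG h u).iso a :=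
    FiberBundle.extend_apply_self (Eucl n) _
  have hXa' : smulPullback h.2 X u.pt = u.iso (h.1⁻¹ a) :=
    (congrArg _ hXa).trans ((isInvertible_mfderiv_smul hs h.2 u.pt).inverse_apply_self _)
  rw [inner_connectionForm cov (diffField_smulPullback hs hX) hXa' (h.1⁻¹ b) ξ]
  refine (inner_connectionForm cov hX hXa b _).trans ?_
  have h1 : (fun w : OrthoFrame n Q => (inner ℝ (smulPullback h.2 X w.pt) (w.iso (h.1⁻¹ b)) : ℝ)) =
      (fun w : OrthoFrame n Q => (inner ℝ (X w.pt) (w.iso b) : ℝ)) ∘ frameAct hG h := by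
    funext w
    rw [inner_smulPullback hG hs]
    rfl
  have h2 := DFunLike.congr_fun (mvfderiv_comp (I := 𝓘(ℝ, FrameModel n))
    (I' := 𝓘(ℝ, FrameModel n)) (f := frameAct hG h)
    (g := fun w : OrthoFrame n Q => (inner ℝ (X w.pt) (w.iso b) : ℝ)) u
    (mdifferentiableAt_inner_iso hX b) ((contMDiff_frameAct hG hs h).mdifferentiable (by simp) u)) ξ
  rw [h1]
  refine congrArg₂ (· - ·) ?_ h2.symm
  rw [projDeriv_mfderiv_frameAct hG hs]
  exact mfderiv_smul_covariantDerivative hG hc hs h.2 u.pt hX _ _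

lemma mfderiv_frameAct_horizontalLift (hc : IsLeviCivita cov)
    (hs : ∀ g : G, ContMDiff 𝓘(ℝ, Eucl n) 𝓘(ℝ, Eucl n) ∞ (fun q : Q => g • q))
    (h : OrthGroup n × G) (u : OrthoFrame n Q) (v : TangentSpace 𝓘(ℝ, Eucl n) u.pt) :
    mfderiv 𝓘(ℝ, FrameModel n) 𝓘(ℝ, FrameModel n) (frameAct hG h) u (horizontalLift cov u v) =
      horizontalLift cov (frameAct hG h u)
        (mfderiv 𝓘(ℝ, Eucl n) 𝓘(ℝ, Eucl n) (fun x : Q => h.2 • x) u.pt v) := by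
  refine eq_horizontalLift hc.metric ?_ ?_
  · rw [projDeriv_mfderiv_frameAct hG hs, projDeriv_horizontalLift hc.metric]
  · refine ContinuousLinearMap.ext fun a => ext_inner_right ℝ fun b => ?_
    rw [inner_connectionForm_frameAct hG hc hs, connectionForm_horizontalLift hc.metric]
    exact inner_zero_left _ |>.trans (inner_zero_left _).symm

/-- The vector of momenta `(H^1(η), …, H^n(η))`. -/
def momentumVector (cov : CovariantDerivative 𝓘(ℝ, Eucl n) (Eucl n)
    (TangentSpace 𝓘(ℝ, Eucl n) : Q → Type _)) (η : CotangentFrame n Q) : Eucl n :=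
  WithLp.toLp 2 fun i => momentum cov i η

lemma inner_momentumVector (hm : cov.IsMetricCompatible) (η : CotangentFrame n Q) (a : Eucl n) :
    (inner ℝ (momentumVector cov η) a : ℝ) =
      (η.2 : TangentSpace 𝓘(ℝ, FrameModel n) η.1 →L[ℝ] ℝ) (horizontalLift cov η.1 (η.1.iso a)) := by
  rw [iso_eq_sum_single, horizontalLift_sum_smul hm, PiLp.inner_apply]
  refine Eq.trans ?_ (map_sum (η.2 : TangentSpace 𝓘(ℝ, FrameModel n) η.1 →L[ℝ] ℝ) _ _).symm
  refine Finset.sum_congr rfl fun i _ => ?_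
  exact ((η.2 : TangentSpace 𝓘(ℝ, FrameModel n) η.1 →L[ℝ] ℝ).map_smul _ _).symm

lemma momentumVector_cotangentAct (hc : IsLeviCivita cov)
    (hs : ∀ g : G, ContMDiff 𝓘(ℝ, Eucl n) 𝓘(ℝ, Eucl n) ∞ (fun q : Q => g • q))
    (h : OrthGroup n × G) (η : CotangentFrame n Q) :
    momentumVector cov (cotangentAct hG h η) = h.1 (momentumVector cov η) := by
  refine ext_inner_right ℝ fun a => ?_
  have h1 : (inner ℝ (h.1 (momentumVector cov η)) a : ℝ) =
      inner ℝ (momentumVector cov η) (h.1⁻¹ a) := by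
    rw [← h.1.inner_map_map (momentumVector cov η)]
    congr 1
    exact (h.1.apply_symm_apply a).symm
  rw [h1, inner_momentumVector hc.metric, inner_momentumVector hc.metric]
  have h2 := mfderiv_frameAct_horizontalLift hG hc hs h η.1 (η.1.iso (h.1⁻¹ a))
  have h3 := cotangentLift_apply_mfderiv (f := frameAct hG h) (η := η)
    (isInvertible_mfderiv_frameAct hG hs h η.1) (horizontalLift cov η.1 (η.1.iso (h.1⁻¹ a)))
  rw [h2] at h3
  exact h3

lemma cotangentProj_cotangentAct (hc : IsLeviCivita cov)
    (hs : ∀ g : G, ContMDiff 𝓘(ℝ, Eucl n) 𝓘(ℝ, Eucl n) ∞ (fun q : Q => g • q))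
    (h : OrthGroup n × G) (η : CotangentFrame n Q) :
    cotangentProj cov (cotangentAct hG h η) =
      cotangentLift 𝓘(ℝ, Eucl n) (fun q : Q => h.2 • q) (cotangentProj cov η) := by
  have hinv := isInvertible_mfderiv_smul hs h.2 η.1.pt
  have h1 := momentumVector_cotangentAct hG hc hs h η
  rw [cotangentProj_eq hc.metric, cotangentProj_eq hc.metric η]
  refine cotangent_ext rfl fun v => ?_
  obtain ⟨w, rfl⟩ := hinv.surjective v
  refine Eq.trans ?_ (congrArg (innerSL ℝ (η.1.iso (momentumVector cov η)))
    (hinv.inverse_apply_self w).symm)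
  change (inner ℝ (mfderiv 𝓘(ℝ, Eucl n) 𝓘(ℝ, Eucl n) (fun x : Q => h.2 • x) η.1.pt
    (η.1.iso (h.1⁻¹ (momentumVector cov (cotangentAct hG h η)))))
    (mfderiv 𝓘(ℝ, Eucl n) 𝓘(ℝ, Eucl n) (fun x : Q => h.2 • x) η.1.pt w) : ℝ) =
    inner ℝ (η.1.iso (momentumVector cov η)) w
  have h2 : h.1⁻¹ (momentumVector cov (cotangentAct hG h η)) = momentumVector cov η := by
    rw [h1]
    exact h.1.symm_apply_apply _
  rw [hG h.2, h2]

end Isometries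

/-! ### Linear combinations of Hamiltonian vector fields -/

section HamiltonianLinear

lemma clm_sum_smul_apply {W : Type*} [NormedAddCommGroup W] [NormedSpace ℝ W]
    (L : W →L[ℝ] W →L[ℝ] ℝ) {ι : Type*} [Fintype ι] (c : ι → ℝ) (X : ι → W) (b : W) :
    L (∑ i, c i • X i) b = ∑ i, c i * L (X i) b := by
  rw [map_sum, sum_apply]
  simp_rw [map_smul]
  rfl

variable {E : Type*} [NormedAddCommGroup E] [NormedSpace ℝ E] [FiniteDimensional ℝ E]
  {M : Type*} [TopologicalSpace M] [ChartedSpace E M]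
  [IsManifold 𝓘(ℝ, E) ∞ M] [IsManifold 𝓘(ℝ, E) 1 M]

lemma hamiltonianVectorField_sum_const_mul {ι : Type} [Fintype ι]
    {f : ι → Cotangent 𝓘(ℝ, E) M → ℝ} {η : Cotangent 𝓘(ℝ, E) M}
    (hf : ∀ i, MDifferentiableAt (CotangentModel E) 𝓘(ℝ, ℝ) (f i) η) (c : ι → ℝ) :
    hamiltonianVectorField 𝓘(ℝ, E) (fun ζ => ∑ i, c i * f i ζ) η =
      ∑ i, c i • hamiltonianVectorField 𝓘(ℝ, E) (f i) η := by
  refine canonicalForm_ext fun b => (canonicalForm_hamiltonianVectorField _ η b).trans ?_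
  have h1 := mvfderiv_sum Finset.univ (f := fun i ζ => c i * f i ζ) (x := η)
    (fun i => mdifferentiableAt_const.mul (hf i)) b
  refine h1.trans ?_
  refine Eq.trans ?_ (clm_sum_smul_apply (canonicalForm E) c
    (fun i => hamiltonianVectorField 𝓘(ℝ, E) (f i) η) b).symm
  refine Finset.sum_congr rfl fun i _ => ?_
  rw [mvfderiv_fun_mul mdifferentiableAt_const (hf i), mvfderiv_const]
  refine Eq.trans ?_ (congrArg (c i * ·) (canonicalForm_hamiltonianVectorField (f i) η b).symm)
  rw [smul_zero, add_zero]
  rfl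

end HamiltonianLinear

/-! ### The Stratonovich operator -/

section Operator

variable {n : ℕ} {Q : Type*} [TopologicalSpace Q] [ChartedSpace (Eucl n) Q]
  [IsManifold 𝓘(ℝ, Eucl n) ∞ Q]
  [RiemannianBundle (fun q : Q => TangentSpace 𝓘(ℝ, Eucl n) q)]
  [IsContMDiffRiemannianBundle 𝓘(ℝ, Eucl n) ∞ (Eucl n)
    (fun q : Q => TangentSpace 𝓘(ℝ, Eucl n) q)]

/-- The Hamiltonians `Ham ∘ ρ, H^1, …, H^n` that drive the Stratonovich operator. -/
def drivingHamiltonian (cov : CovariantDerivative 𝓘(ℝ, Eucl n) (Eucl n)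
    (TangentSpace 𝓘(ℝ, Eucl n) : Q → Type _)) (Ham : Cotangent 𝓘(ℝ, Eucl n) Q → ℝ) :
    Option (Fin n) → CotangentFrame n Q → ℝ
  | none => fun η => Ham (cotangentProj cov η)
  | some i => momentum cov i

/-- The components of a tangent vector of `ℝ × ℝⁿ`; `none` stands for the time component. -/
def noiseCoord (v : NoiseSpace n) : Option (Fin n) → ℝ
  | none => v.1
  | some i => v.2 i

/-- The function whose Hamiltonian vector field is `η ↦ S(η, y) v`. -/
def noiseHamiltonian (cov : CovariantDerivative 𝓘(ℝ, Eucl n) (Eucl n)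
    (TangentSpace 𝓘(ℝ, Eucl n) : Q → Type _)) (Ham : Cotangent 𝓘(ℝ, Eucl n) Q → ℝ)
    (v : NoiseSpace n) (η : CotangentFrame n Q) : ℝ :=
  ∑ j, noiseCoord v j * drivingHamiltonian cov Ham j η

variable {cov : CovariantDerivative 𝓘(ℝ, Eucl n) (Eucl n)
  (TangentSpace 𝓘(ℝ, Eucl n) : Q → Type _)} {Ham : Cotangent 𝓘(ℝ, Eucl n) Q → ℝ}

lemma noiseHamiltonian_eq (v : NoiseSpace n) (η : CotangentFrame n Q) :
    noiseHamiltonian cov Ham v η =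
      v.1 * Ham (cotangentProj cov η) + inner ℝ (momentumVector cov η) v.2 := by
  rw [noiseHamiltonian, Fintype.sum_option, PiLp.inner_apply]
  rfl

lemma smulRight_add_sum_smulRight_apply {W : Type*} [NormedAddCommGroup W] [NormedSpace ℝ W]
    (v : NoiseSpace n) (x : W) (z : Fin n → W) :
    ((ContinuousLinearMap.fst ℝ ℝ (Eucl n)).smulRight x +
      ∑ i : Fin n, ((innerSL ℝ (EuclideanSpace.single i (1 : ℝ))).comp
        (ContinuousLinearMap.snd ℝ ℝ (Eucl n))).smulRight (z i)) v =
      v.1 • x + ∑ i, v.2 i • z i := by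
  rw [add_apply, sum_apply]
  congr 1
  refine Finset.sum_congr rfl fun i _ => ?_
  have h1 : (inner ℝ (EuclideanSpace.single i (1 : ℝ)) v.2 : ℝ) = v.2 i := by
    rw [EuclideanSpace.inner_single_left]
    simp
  exact congrArg (· • z i) h1

lemma stratonovichOp_apply (η : CotangentFrame n Q) (y : NoiseSpace n)
    (v : TangentSpace 𝓘(ℝ, NoiseSpace n) y) :
    stratonovichOp cov Ham η y v = ∑ j, noiseCoord (v : NoiseSpace n) j •
      hamiltonianVectorField 𝓘(ℝ, FrameModel n) (drivingHamiltonian cov Ham j) η := by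
  rw [Fintype.sum_option]
  exact smulRight_add_sum_smulRight_apply (W := FrameModel n × (FrameModel n →L[ℝ] ℝ)) v _ _

lemma contMDiff_drivingHamiltonian [T2Space Q] (hc : IsLeviCivita cov)
    (hHam : ContMDiff (𝓘(ℝ, Eucl n).prod 𝓘(ℝ, Eucl n →L[ℝ] ℝ)) 𝓘(ℝ, ℝ) ∞ Ham) :
    ∀ j, ContMDiff (CotangentFrameModel n) 𝓘(ℝ, ℝ) ∞ (drivingHamiltonian cov Ham j)
  | none => hHam.comp (contMDiff_cotangentProj hc)
  | some i => contMDiff_momentum hc i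

lemma contMDiff_noiseHamiltonian [T2Space Q] (hc : IsLeviCivita cov)
    (hHam : ContMDiff (𝓘(ℝ, Eucl n).prod 𝓘(ℝ, Eucl n →L[ℝ] ℝ)) 𝓘(ℝ, ℝ) ∞ Ham) (v : NoiseSpace n) :
    ContMDiff (CotangentFrameModel n) 𝓘(ℝ, ℝ) ∞ (noiseHamiltonian cov Ham v) :=
  contMDiff_finsetSum fun j _ =>
    contMDiff_const.mul (contMDiff_drivingHamiltonian hc hHam j)

lemma hamiltonianVectorField_noiseHamiltonian [T2Space Q] (hc : IsLeviCivita cov)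
    (hHam : ContMDiff (𝓘(ℝ, Eucl n).prod 𝓘(ℝ, Eucl n →L[ℝ] ℝ)) 𝓘(ℝ, ℝ) ∞ Ham)
    (η : CotangentFrame n Q) (y : NoiseSpace n) (v : TangentSpace 𝓘(ℝ, NoiseSpace n) y) :
    stratonovichOp cov Ham η y v =
      hamiltonianVectorField 𝓘(ℝ, FrameModel n) (noiseHamiltonian cov Ham v) η := by
  rw [stratonovichOp_apply]
  exact (hamiltonianVectorField_sum_const_mul (fun j =>
    (contMDiff_drivingHamiltonian hc hHam j).mdifferentiable (by simp) η) _).symm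

lemma contDiff_noiseCoord :
    ∀ j : Option (Fin n), ContDiff ℝ ∞ fun v : NoiseSpace n => noiseCoord v j
  | none => contDiff_fst
  | some i => (EuclideanSpace.proj i : Eucl n →L[ℝ] ℝ).contDiff.comp contDiff_snd

lemma isStratonovichOperator_stratonovichOp [T2Space Q] (hc : IsLeviCivita cov)
    (hHam : ContMDiff (𝓘(ℝ, Eucl n).prod 𝓘(ℝ, Eucl n →L[ℝ] ℝ)) 𝓘(ℝ, ℝ) ∞ Ham) :
    IsStratonovichOperator (CotangentFrameModel n) 𝓘(ℝ, NoiseSpace n) (stratonovichOp cov Ham) := by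
  intro p
  have h1 : ∀ j, ContMDiff 𝓘(ℝ, NoiseSpace n).tangent 𝓘(ℝ, ℝ) ∞
      (fun w : TangentBundle 𝓘(ℝ, NoiseSpace n) (NoiseSpace n) =>
        noiseCoord (w.2 : NoiseSpace n) j) := fun j =>
    (contDiff_noiseCoord j).contMDiff.comp
      (contMDiff_snd_tangentBundle_modelSpace (NoiseSpace n) 𝓘(ℝ, NoiseSpace n))
  refine (contMDiffAt_sum_smul
    (b := fun p : CotangentFrame n Q × TangentBundle 𝓘(ℝ, NoiseSpace n) (NoiseSpace n) => p.1)
    (f := fun j p => noiseCoord (p.2.2 : NoiseSpace n) j)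
    (V := fun j p => hamiltonianVectorField 𝓘(ℝ, FrameModel n) (drivingHamiltonian cov Ham j) p.1)
    contMDiffAt_fst (fun j => (h1 j p.2).comp p contMDiffAt_snd) fun j =>
      (contMDiff_hamiltonianVectorField (contMDiff_drivingHamiltonian hc hHam j) p.1).comp p
        contMDiffAt_fst).congr_of_eventuallyEq (Filter.Eventually.of_forall fun p => ?_)
  exact congrArg (TotalSpace.mk p.1) (stratonovichOp_apply p.1 p.2.1 p.2.2)

variable {G : Type*} [Group G] [MulAction G Q] [TopologicalSpace G]
  (hG : ActsByIsometries n Q G)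

lemma contMDiff_cotangentAct
    (hs : ∀ g : G, ContMDiff 𝓘(ℝ, Eucl n) 𝓘(ℝ, Eucl n) ∞ (fun q : Q => g • q))
    (h : OrthGroup n × G) :
    ContMDiff (CotangentFrameModel n) (CotangentFrameModel n) ∞ (cotangentAct (Q := Q) hG h) :=
  fun η => contMDiffAt_cotangentLift (Ψ := fun (_ : CotangentFrame n Q) => frameAct hG h)
    (G := fun ζ => ζ) ((contMDiff_frameAct hG hs h).contMDiffAt.comp (η, η.1) contMDiffAt_snd)
    contMDiffAt_id (fun _ => isInvertible_mfderiv_frameAct hG hs h)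

lemma liouvilleForm_cotangentAct
    (hs : ∀ g : G, ContMDiff 𝓘(ℝ, Eucl n) 𝓘(ℝ, Eucl n) ∞ (fun q : Q => g • q))
    (h : OrthGroup n × G) (η : CotangentFrame n Q) (ξ : TangentSpace (CotangentFrameModel n) η) :
    liouvilleForm 𝓘(ℝ, FrameModel n) (cotangentAct hG h η)
      (mfderiv (CotangentFrameModel n) (CotangentFrameModel n) (cotangentAct hG h) η ξ) =
        liouvilleForm 𝓘(ℝ, FrameModel n) η ξ :=
  liouvilleForm_cotangentLift ((contMDiff_frameAct hG hs h).mdifferentiable (by simp) _)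
    (isInvertible_mfderiv_frameAct hG hs h _)
    ((contMDiff_cotangentAct hG hs h).mdifferentiable (by simp) η) ξ

lemma isInvertible_mfderiv_cotangentAct
    (hs : ∀ g : G, ContMDiff 𝓘(ℝ, Eucl n) 𝓘(ℝ, Eucl n) ∞ (fun q : Q => g • q))
    (h : OrthGroup n × G) (η : CotangentFrame n Q) :
    (mfderiv (CotangentFrameModel n) (CotangentFrameModel n)
      (cotangentAct hG h) η).IsInvertible := by
  refine isInvertible_mfderiv_of_inverse (g := cotangentAct hG h⁻¹) (fun w => ?_) (fun w => ?_)
    ((contMDiff_cotangentAct hG hs h).mdifferentiable (by simp))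
    ((contMDiff_cotangentAct hG hs h⁻¹).mdifferentiable (by simp))
  · rw [cotangentAct_cotangentAct hG hs, inv_mul_cancel, cotangentAct_one]
  · rw [cotangentAct_cotangentAct hG hs, mul_inv_cancel, cotangentAct_one]

lemma noiseHamiltonian_cotangentAct (hc : IsLeviCivita cov)
    (hs : ∀ g : G, ContMDiff 𝓘(ℝ, Eucl n) 𝓘(ℝ, Eucl n) ∞ (fun q : Q => g • q))
    (hHam' : ∀ (g : G) (α : Cotangent 𝓘(ℝ, Eucl n) Q),
      Ham (cotangentLift 𝓘(ℝ, Eucl n) (fun q => g • q) α) = Ham α)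
    (h : OrthGroup n × G) (v : NoiseSpace n) (η : CotangentFrame n Q) :
    noiseHamiltonian cov Ham (noiseAct h v) (cotangentAct hG h η) =
      noiseHamiltonian cov Ham v η := by
  rw [noiseHamiltonian_eq, noiseHamiltonian_eq, cotangentProj_cotangentAct hG hc hs, hHam',
    momentumVector_cotangentAct hG hc hs, noiseAct, h.1.inner_map_map]

lemma mfderiv_noiseAct (h : OrthGroup n × G) (y : NoiseSpace n)
    (v : TangentSpace 𝓘(ℝ, NoiseSpace n) y) :
    mfderiv 𝓘(ℝ, NoiseSpace n) 𝓘(ℝ, NoiseSpace n) (noiseAct h) y v =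
      noiseAct h (v : NoiseSpace n) := by
  let L : NoiseSpace n →L[ℝ] NoiseSpace n := (ContinuousLinearMap.id ℝ ℝ).prodMap
    (h.1.toContinuousLinearEquiv : Eucl n →L[ℝ] Eucl n)
  have h1 : (noiseAct h : NoiseSpace n → NoiseSpace n) = L := rfl
  rw [h1, L.hasMFDerivAt.mfderiv]
  rfl

/-- Under the action of `h`, the Hamiltonian vector field of the function belonging to `v` is mapped
to that of the function belonging to `h v`. -/
lemma hamiltonianVectorField_cotangentAct [T2Space Q] (hc : IsLeviCivita cov)
    (hHam : ContMDiff (𝓘(ℝ, Eucl n).prod 𝓘(ℝ, Eucl n →L[ℝ] ℝ)) 𝓘(ℝ, ℝ) ∞ Ham)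
    (hs : ∀ g : G, ContMDiff 𝓘(ℝ, Eucl n) 𝓘(ℝ, Eucl n) ∞ (fun q : Q => g • q))
    (hHam' : ∀ (g : G) (α : Cotangent 𝓘(ℝ, Eucl n) Q),
      Ham (cotangentLift 𝓘(ℝ, Eucl n) (fun q => g • q) α) = Ham α)
    (h : OrthGroup n × G) (v : NoiseSpace n) (η : CotangentFrame n Q) :
    hamiltonianVectorField 𝓘(ℝ, FrameModel n) (noiseHamiltonian cov Ham (noiseAct h v))
        (cotangentAct hG h η) =
      mfderiv (CotangentFrameModel n) (CotangentFrameModel n) (cotangentAct hG h) η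
        (hamiltonianVectorField 𝓘(ℝ, FrameModel n) (noiseHamiltonian cov Ham v) η) := by
  have h1 := hamiltonianVectorField_map (contMDiff_cotangentAct hG hs h η)
    (Filter.Eventually.of_forall (liouvilleForm_cotangentAct hG hs h))
    (isInvertible_mfderiv_cotangentAct hG hs h η).surjective
    ((contMDiff_noiseHamiltonian hc hHam (noiseAct h v)).mdifferentiable (by simp) _)
  have h2 : noiseHamiltonian cov Ham (noiseAct h v) ∘ cotangentAct hG h =
      noiseHamiltonian cov Ham v :=
    funext (noiseHamiltonian_cotangentAct hG hc hs hHam' h v)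
  rwa [h2] at h1

lemma stratonovichOp_equivariant [T2Space Q] (hc : IsLeviCivita cov)
    (hHam : ContMDiff (𝓘(ℝ, Eucl n).prod 𝓘(ℝ, Eucl n →L[ℝ] ℝ)) 𝓘(ℝ, ℝ) ∞ Ham)
    (hs : ∀ g : G, ContMDiff 𝓘(ℝ, Eucl n) 𝓘(ℝ, Eucl n) ∞ (fun q : Q => g • q))
    (hHam' : ∀ (g : G) (α : Cotangent 𝓘(ℝ, Eucl n) Q),
      Ham (cotangentLift 𝓘(ℝ, Eucl n) (fun q => g • q) α) = Ham α)
    (h : OrthGroup n × G) (η : CotangentFrame n Q) (y : NoiseSpace n)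
    (y' : TangentSpace 𝓘(ℝ, NoiseSpace n) y) :
    stratonovichOp cov Ham (cotangentAct hG h η) (noiseAct h y)
        (mfderiv 𝓘(ℝ, NoiseSpace n) 𝓘(ℝ, NoiseSpace n) (noiseAct h) y y') =
      mfderiv (CotangentFrameModel n) (CotangentFrameModel n) (cotangentAct hG h) η
        (stratonovichOp cov Ham η y y') := by
  rw [hamiltonianVectorField_noiseHamiltonian hc hHam,
    hamiltonianVectorField_noiseHamiltonian hc hHam, mfderiv_noiseAct]
  exact hamiltonianVectorField_cotangentAct hG hc hHam hs hHam' h y' η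

end Operator

/-! ### Invariants of integral curves -/

section IntegralCurves

variable {E : Type*} [NormedAddCommGroup E] [NormedSpace ℝ E] {H : Type*} [TopologicalSpace H]
  {I : ModelWithCorners ℝ E H} {M : Type*} [TopologicalSpace M] [ChartedSpace H M]
  [IsManifold I 1 M]

/-- A diffeomorphism that preserves a vector field and fixes a point of an integral curve fixes the
whole integral curve. -/
lemma isMIntegralCurveOn_fixed [T2Space M] [CompleteSpace E] [I.Boundaryless]
    {v : ∀ x : M, TangentSpace I x}
    (hv : ContMDiff I I.tangent ∞ (fun x => (⟨x, v x⟩ : TangentBundle I M)))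
    {F : M → M} (hF : MDifferentiable I I F) (hFv : ∀ x, mfderiv I I F x (v x) = v (F x))
    {γ : ℝ → M} {a b : ℝ} (hγ : IsMIntegralCurveOn γ v (Set.Ioo a b)) {t₀ : ℝ}
    (ht₀ : t₀ ∈ Set.Ioo a b) (h₀ : F (γ t₀) = γ t₀) {t : ℝ} (ht : t ∈ Set.Ioo a b) :
    F (γ t) = γ t := by
  have h1 : IsMIntegralCurveOn (F ∘ γ) v (Set.Ioo a b) := by
    intro s hs
    have h2 := (hF (γ s)).hasMFDerivAt.comp_hasMFDerivWithinAt s (hγ s hs)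
    refine h2.congr_mfderiv (ContinuousLinearMap.ext fun (r : ℝ) => ?_)
    exact ((mfderiv I I F (γ s)).map_smul r (v (γ s))).trans
      (congrArg (fun w : TangentSpace I (F (γ s)) => r • w) (hFv (γ s)))
  exact isMIntegralCurveOn_Ioo_eqOn_of_contMDiff_boundaryless ht₀ (hv.of_le (by simp)) h1 hγ h₀ ht

/-- A function annihilated by a vector field is constant along its integral curves. -/
lemma eq_of_isMIntegralCurveOn {v : ∀ x : M, TangentSpace I x} {f : M → ℝ}
    (hf : MDifferentiable I 𝓘(ℝ, ℝ) f) (hfv : ∀ x, mfderiv I 𝓘(ℝ, ℝ) f x (v x) = 0)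
    {γ : ℝ → M} {a b : ℝ} (hγ : IsMIntegralCurveOn γ v (Set.Ioo a b)) {t t' : ℝ}
    (ht : t ∈ Set.Ioo a b) (ht' : t' ∈ Set.Ioo a b) : f (γ t) = f (γ t') := by
  have h1 : ∀ s ∈ Set.Ioo a b, HasFDerivAt (f ∘ γ) (0 : ℝ →L[ℝ] ℝ) s := by
    intro s hs
    have h2 := (hf (γ s)).hasMFDerivAt.comp s ((hγ s hs).hasMFDerivAt (isOpen_Ioo.mem_nhds hs))
    refine hasMFDerivAt_iff_hasFDerivAt.1
      (h2.congr_mfderiv (ContinuousLinearMap.ext fun (r : ℝ) => ?_))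
    exact ((mfderiv I 𝓘(ℝ, ℝ) f (γ s)).map_smul r (v (γ s))).trans
      ((congrArg (fun w : ℝ => r • w) (hfv (γ s))).trans (smul_zero r))
  exact isOpen_Ioo.is_const_of_fderiv_eq_zero isPreconnected_Ioo
    (fun s hs => (h1 s hs).differentiableAt.differentiableWithinAt)
    (fun s hs => (h1 s hs).fderiv) ht ht'

end IntegralCurves

/-! ### Conservation of the momentum map -/

section Conservation

variable {n : ℕ} {Q : Type*} [TopologicalSpace Q] [ChartedSpace (Eucl n) Q]
  [IsManifold 𝓘(ℝ, Eucl n) ∞ Q]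
  [RiemannianBundle (fun q : Q => TangentSpace 𝓘(ℝ, Eucl n) q)]
  [IsContMDiffRiemannianBundle 𝓘(ℝ, Eucl n) ∞ (Eucl n)
    (fun q : Q => TangentSpace 𝓘(ℝ, Eucl n) q)]
  {EG : Type*} [NormedAddCommGroup EG] [NormedSpace ℝ EG]
  {G : Type*} [TopologicalSpace G] [ChartedSpace EG G] [Group G] [LieGroup 𝓘(ℝ, EG) ∞ G]
  [MulAction G Q] [ContMDiffSMul 𝓘(ℝ, EG) 𝓘(ℝ, Eucl n) ∞ G Q]
  (hG : ActsByIsometries n Q G)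

/-- Every element of the Lie algebra is the velocity of a curve through the identity, here a line in
the chart. -/
lemma exists_curve_one [IsManifold 𝓘(ℝ, EG) 1 G] (X : EG) :
    ∃ c : ℝ → G, c 0 = 1 ∧ ContMDiffAt 𝓘(ℝ, ℝ) 𝓘(ℝ, EG) ∞ c 0 ∧
      (mfderiv 𝓘(ℝ, ℝ) 𝓘(ℝ, EG) c 0 (1 : ℝ) : EG) = X := by
  have : IsManifold 𝓘(ℝ, EG) ∞ G := LieGroup.toContMDiffMul.toIsManifold
  set e := extChartAt 𝓘(ℝ, EG) (1 : G) with he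
  let l : ℝ → EG := fun s => e 1 + s • X
  have hl0 : l 0 = e 1 := by simp [l]
  have hl : ContDiff ℝ ∞ l := contDiff_const.add (contDiff_id.smul contDiff_const)
  have hld : HasFDerivAt l ((1 : ℝ →L[ℝ] ℝ).smulRight X) 0 := by
    have := ((1 : ℝ →L[ℝ] ℝ).smulRight X).hasFDerivAt (x := (0 : ℝ))
    exact this.const_add (e 1)
  have hes : ContMDiffAt 𝓘(ℝ, EG) 𝓘(ℝ, EG) ∞ e.symm (l 0) := by
    rw [hl0]
    exact (contMDiffOn_extChartAt_symm (1 : G)).contMDiffAt (extChartAt_target_mem_nhds (1 : G))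
  refine ⟨e.symm ∘ l, ?_, hes.comp 0 hl.contMDiff.contMDiffAt, ?_⟩
  · rw [Function.comp_apply, hl0, extChartAt_to_inv]
  · have h1 := (hes.mdifferentiableAt (by simp)).hasMFDerivAt.comp 0 hld.hasMFDerivAt
    refine (DFunLike.congr_fun h1.mfderiv (1 : ℝ)).trans ?_
    have h2 : mfderiv 𝓘(ℝ, EG) 𝓘(ℝ, EG) e.symm (l 0) X = X := by
      have h3 := mfderiv_extChartAt_symm_apply_mfderiv (I := 𝓘(ℝ, EG)) (x₀ := (1 : G))
        (mem_chart_source EG (1 : G)) X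
      rw [hl0]
      refine Eq.trans (congrArg _ ?_) h3
      exact (mfderiv_extChartAt_self_apply rfl X).symm
    exact (congrArg (mfderiv 𝓘(ℝ, EG) 𝓘(ℝ, EG) e.symm (l 0)) (one_smul ℝ X)).trans h2

/-- Noether's theorem for the action of `G`: the components of the momentum map are annihilated by
the Hamiltonian vector field of an invariant function. -/
lemma mfderiv_momentumMap_hamiltonianVectorField {f : CotangentFrame n Q → ℝ}
    (hf : MDifferentiable (CotangentFrameModel n) 𝓘(ℝ, ℝ) f)
    (hinv : ∀ (g : G) (η : CotangentFrame n Q), f (cotangentAct hG (1, g) η) = f η) (X : EG)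
    (η : CotangentFrame n Q) :
    MDifferentiableAt (CotangentFrameModel n) 𝓘(ℝ, ℝ)
      (fun ζ : CotangentFrame n Q => (momentumMap (EG := EG) hG ζ : EG →L[ℝ] ℝ) X) η ∧
    mfderiv (CotangentFrameModel n) 𝓘(ℝ, ℝ)
      (fun ζ : CotangentFrame n Q => (momentumMap (EG := EG) hG ζ : EG →L[ℝ] ℝ) X) η
      (hamiltonianVectorField 𝓘(ℝ, FrameModel n) f η) = 0 := by
  have : IsManifold 𝓘(ℝ, EG) ∞ G := LieGroup.toContMDiffMul.toIsManifold
  have : IsManifold 𝓘(ℝ, EG) 1 G := IsManifold.of_le (n := ∞) (by norm_cast)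
  have hs : ∀ g : G, ContMDiff 𝓘(ℝ, Eucl n) 𝓘(ℝ, Eucl n) ∞ (fun q : Q => g • q) :=
    contMDiff_smul_left (EG := EG) ContMDiffSMul.contMDiff_smul
  obtain ⟨c, hc0, hc, hcX⟩ := exists_curve_one (G := G) X
  have hact : ContMDiff (𝓘(ℝ, EG).prod 𝓘(ℝ, FrameModel n)) 𝓘(ℝ, FrameModel n) ∞
    (fun p : G × OrthoFrame n Q => frameAct hG (1, p.1) p.2) := contMDiff_frameAct_prod hG 1
  have hΨ : ∀ ζ : CotangentFrame n Q,
      ContMDiffAt (𝓘(ℝ, ℝ).prod (CotangentFrameModel n)) (CotangentFrameModel n) ∞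
        (fun p : ℝ × CotangentFrame n Q => cotangentAct hG (1, c p.1) p.2) (0, ζ) := by
    intro ζ
    refine contMDiffAt_cotangentLift
      (Ψ := fun p : ℝ × CotangentFrame n Q => frameAct hG (1, c p.1)) (G := fun p => p.2)
      ?_ contMDiffAt_snd (fun p => isInvertible_mfderiv_frameAct hG hs (1, c p.1))
    have h1 : ContMDiffAt ((𝓘(ℝ, ℝ).prod (CotangentFrameModel n)).prod 𝓘(ℝ, FrameModel n))
        𝓘(ℝ, EG) ∞ (fun p : (ℝ × CotangentFrame n Q) × OrthoFrame n Q => c p.1.1)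
        (((0 : ℝ), ζ), ζ.1) :=
      ContMDiffAt.comp (g := c) (f := fun p : (ℝ × CotangentFrame n Q) × OrthoFrame n Q => p.1.1)
        (((0 : ℝ), ζ), ζ.1) hc (contMDiffAt_fst.comp (((0 : ℝ), ζ), ζ.1) contMDiffAt_fst)
    exact hact.contMDiffAt.comp (((0 : ℝ), ζ), ζ.1) (h1.prodMk contMDiffAt_snd)
  refine mfderiv_momentum_hamiltonianVectorField
    (Ψ := fun s ζ => cotangentAct hG (1, c s) ζ) (hΨ η) (fun ζ => ?_)
    (Filter.Eventually.of_forall fun p => liouvilleForm_cotangentAct hG hs (1, c p.1) p.2)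
    (Filter.Eventually.of_forall fun ζ => ?_) (hf η)
    (Filter.Eventually.of_forall fun s => hinv (c s) η)
  · rw [hc0]
    exact cotangentAct_one hG ζ
  · -- the fundamental vector field projects to that of the action on `P`
    have hd : MDifferentiableAt 𝓘(ℝ, ℝ) (CotangentFrameModel n)
        (fun s => cotangentAct hG (1, c s) ζ) 0 :=
      (ContMDiffAt.comp (g := fun p : ℝ × CotangentFrame n Q => cotangentAct hG (1, c p.1) p.2)
        (f := fun s : ℝ => (s, ζ)) 0 (hΨ ζ)
          (contMDiffAt_id.prodMk contMDiffAt_const)).mdifferentiableAt (by simp)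
    have h1 := mfderiv_comp (g := fun ζ : CotangentFrame n Q => ζ.1) (0 : ℝ)
      ((contMDiff_cotangent_proj (E := FrameModel n) (M := OrthoFrame n Q)).mdifferentiable
        (by simp) _) hd
    have h2 : ContMDiffAt 𝓘(ℝ, EG) 𝓘(ℝ, FrameModel n) ∞ (fun g : G => frameAct hG (1, g) ζ.1)
        (c 0) := hact.contMDiffAt.comp (c 0) (contMDiffAt_id.prodMk contMDiffAt_const)
    have h3 := mfderiv_comp (g := fun g : G => frameAct hG (1, g) ζ.1) (f := c) (0 : ℝ)
      (h2.mdifferentiableAt (by simp)) (hc.mdifferentiableAt (by simp))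
    have h4 : (mfderiv (CotangentFrameModel n) 𝓘(ℝ, FrameModel n)
        (fun ζ : CotangentFrame n Q => ζ.1) (cotangentAct hG (1, c 0) ζ)
        (mfderiv 𝓘(ℝ, ℝ) (CotangentFrameModel n) (fun s => cotangentAct hG (1, c s) ζ) 0 (1 : ℝ)) :
          FrameModel n) =
        mfderiv 𝓘(ℝ, EG) 𝓘(ℝ, FrameModel n) (fun g : G => frameAct hG (1, g) ζ.1) 1 X := by
      refine (DFunLike.congr_fun h1 (1 : ℝ)).symm.trans ((DFunLike.congr_fun h3 (1 : ℝ)).trans ?_)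
      rw [← hcX, ← hc0]
      rfl
    have h5 : cotangentAct hG (1, c 0) ζ = ζ := by
      rw [hc0]
      exact cotangentAct_one hG ζ
    have h6 : ((cotangentAct hG (1, c 0) ζ).2 : FrameModel n →L[ℝ] ℝ) = ζ.2 := by rw [h5]
    exact (DFunLike.congr_fun h6 _).symm.trans
      (congrArg ((cotangentAct hG (1, c 0) ζ).2 : FrameModel n →L[ℝ] ℝ) h4.symm)

end Conservation

/-! ### Restriction of the operator to invariant sets -/

section Restriction

variable {n : ℕ} {Q : Type*} [TopologicalSpace Q] [T2Space Q] [ChartedSpace (Eucl n) Q]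
  [IsManifold 𝓘(ℝ, Eucl n) ∞ Q]
  [RiemannianBundle (fun q : Q => TangentSpace 𝓘(ℝ, Eucl n) q)]
  [IsContMDiffRiemannianBundle 𝓘(ℝ, Eucl n) ∞ (Eucl n)
    (fun q : Q => TangentSpace 𝓘(ℝ, Eucl n) q)]
  {cov : CovariantDerivative 𝓘(ℝ, Eucl n) (Eucl n) (TangentSpace 𝓘(ℝ, Eucl n) : Q → Type _)}
  {EG : Type*} [NormedAddCommGroup EG] [NormedSpace ℝ EG]
  {G : Type*} [TopologicalSpace G] [ChartedSpace EG G] [Group G] [LieGroup 𝓘(ℝ, EG) ∞ G]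
  [MulAction G Q] [ContMDiffSMul 𝓘(ℝ, EG) 𝓘(ℝ, Eucl n) ∞ G Q]
  (hG : ActsByIsometries n Q G) {Ham : Cotangent 𝓘(ℝ, Eucl n) Q → ℝ}

/-- The momentum map is constant along the integral curves of `η ↦ S(η, y) v`. -/
lemma momentumMap_eq_of_isMIntegralCurveOn (hc : IsLeviCivita cov)
    (hHam : ContMDiff (𝓘(ℝ, Eucl n).prod 𝓘(ℝ, Eucl n →L[ℝ] ℝ)) 𝓘(ℝ, ℝ) ∞ Ham)
    (hHam' : ∀ (g : G) (α : Cotangent 𝓘(ℝ, Eucl n) Q),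
      Ham (cotangentLift 𝓘(ℝ, Eucl n) (fun q => g • q) α) = Ham α) (v : NoiseSpace n)
    {γ : ℝ → CotangentFrame n Q} {a b : ℝ}
    (hγ : IsMIntegralCurveOn γ (hamiltonianVectorField 𝓘(ℝ, FrameModel n)
      (noiseHamiltonian cov Ham v)) (Set.Ioo a b)) {t t' : ℝ}
    (ht : t ∈ Set.Ioo a b) (ht' : t' ∈ Set.Ioo a b) :
    momentumMap (EG := EG) hG (γ t) = momentumMap hG (γ t') := by
  have hs : ∀ g : G, ContMDiff 𝓘(ℝ, Eucl n) 𝓘(ℝ, Eucl n) ∞ (fun q : Q => g • q) :=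
    contMDiff_smul_left (EG := EG) ContMDiffSMul.contMDiff_smul
  refine ContinuousLinearMap.ext fun X => ?_
  have hN := mfderiv_momentumMap_hamiltonianVectorField (EG := EG) hG
    ((contMDiff_noiseHamiltonian hc hHam v).mdifferentiable (by simp))
    (fun g η => noiseHamiltonian_cotangentAct hG hc hs hHam' (1, g) v η) X
  exact eq_of_isMIntegralCurveOn (fun η => (hN η).1) (fun η => (hN η).2) hγ ht ht'

/-- The isotropy groups are constant along the integral curves of `η ↦ S(η, y) v`. -/
lemma cotangentAct_eq_of_isMIntegralCurveOn (hc : IsLeviCivita cov)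
    (hHam : ContMDiff (𝓘(ℝ, Eucl n).prod 𝓘(ℝ, Eucl n →L[ℝ] ℝ)) 𝓘(ℝ, ℝ) ∞ Ham)
    (hHam' : ∀ (g : G) (α : Cotangent 𝓘(ℝ, Eucl n) Q),
      Ham (cotangentLift 𝓘(ℝ, Eucl n) (fun q => g • q) α) = Ham α)
    (hs : ∀ g : G, ContMDiff 𝓘(ℝ, Eucl n) 𝓘(ℝ, Eucl n) ∞ (fun q : Q => g • q)) (v : NoiseSpace n)
    {γ : ℝ → CotangentFrame n Q} {a b : ℝ}
    (hγ : IsMIntegralCurveOn γ (hamiltonianVectorField 𝓘(ℝ, FrameModel n)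
      (noiseHamiltonian cov Ham v)) (Set.Ioo a b)) {t t' : ℝ}
    (ht : t ∈ Set.Ioo a b) (ht' : t' ∈ Set.Ioo a b) {g : G}
    (hg : cotangentAct hG (1, g) (γ t) = γ t) : cotangentAct hG (1, g) (γ t') = γ t' := by
  have : T2Space (OrthoFrame n Q) := t2Space_orthoFrame
  have : T2Space (CotangentFrame n Q) := t2Space_cotangent
  exact isMIntegralCurveOn_fixed
    (contMDiff_hamiltonianVectorField (contMDiff_noiseHamiltonian hc hHam v))
    ((contMDiff_cotangentAct hG hs (1, g)).mdifferentiable (by simp))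
    (fun η => (hamiltonianVectorField_cotangentAct hG hc hHam hs hHam' (1, g) v η).symm)
    hγ ht hg ht'

/-- If a set is preserved by the integral curves of all the fields `η ↦ S(η, y) v`, the operator
restricts to the set and to its connected components. -/
lemma restrictsTo_of_invariant (hc : IsLeviCivita cov)
    (hHam : ContMDiff (𝓘(ℝ, Eucl n).prod 𝓘(ℝ, Eucl n →L[ℝ] ℝ)) 𝓘(ℝ, ℝ) ∞ Ham)
    {Z : Set (CotangentFrame n Q)}
    (hZ : ∀ (v : NoiseSpace n) (γ : ℝ → CotangentFrame n Q) (ε : ℝ), 0 < ε →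
      IsMIntegralCurveOn γ (hamiltonianVectorField 𝓘(ℝ, FrameModel n)
        (noiseHamiltonian cov Ham v)) (Set.Ioo (-ε) ε) →
      γ 0 ∈ Z → ∀ t ∈ Set.Ioo (-ε) ε, γ t ∈ Z) :
    RestrictsTo (CotangentFrameModel n) 𝓘(ℝ, NoiseSpace n) (stratonovichOp cov Ham) Z ∧
    ∀ ζ, RestrictsTo (CotangentFrameModel n) 𝓘(ℝ, NoiseSpace n) (stratonovichOp cov Ham)
      (connectedComponentIn Z ζ) := by
  have hS := isStratonovichOperator_stratonovichOp hc hHam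
  have key := fun (v : NoiseSpace n) {x : CotangentFrame n Q} (hx : x ∈ Z) =>
    isTangentTo_of_invariant
      (contMDiff_hamiltonianVectorField (contMDiff_noiseHamiltonian hc hHam v)) (hZ v) hx
  refine ⟨restrictsTo_of_isTangentTo hS fun x hx y v => ?_,
    fun ζ => restrictsTo_of_isTangentTo hS fun x hx y v => ?_⟩
  · rw [hamiltonianVectorField_noiseHamiltonian hc hHam]
    exact (key v hx).1
  · rw [hamiltonianVectorField_noiseHamiltonian hc hHam]
    exact (key v (connectedComponentIn_subset Z ζ hx)).2 ζ hx

end Restriction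

end FrameBundle

end

theorem mainTheorem7 {n : ℕ} {Q : Type*} [TopologicalSpace Q] [T2Space Q]
    [ChartedSpace (Eucl n) Q] [IsManifold 𝓘(ℝ, Eucl n) ∞ Q]
    [RiemannianBundle (fun q : Q => TangentSpace 𝓘(ℝ, Eucl n) q)]
    [IsContMDiffRiemannianBundle 𝓘(ℝ, Eucl n) ∞ (Eucl n)
      (fun q : Q => TangentSpace 𝓘(ℝ, Eucl n) q)]
    (cov : CovariantDerivative 𝓘(ℝ, Eucl n) (Eucl n) (TangentSpace 𝓘(ℝ, Eucl n) : Q → Type _))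
    (hcov : IsLeviCivita cov)
    {EG : Type*} [NormedAddCommGroup EG] [NormedSpace ℝ EG] [FiniteDimensional ℝ EG]
    {G : Type*} [TopologicalSpace G] [ChartedSpace EG G] [Group G] [LieGroup 𝓘(ℝ, EG) ∞ G]
    [MulAction G Q] [ContMDiffSMul 𝓘(ℝ, EG) 𝓘(ℝ, Eucl n) ∞ G Q] [ProperSMul G Q]
    (hG : ActsByIsometries n Q G)
    (Ham : Cotangent 𝓘(ℝ, Eucl n) Q → ℝ)
    (hHam : ContMDiff (𝓘(ℝ, Eucl n).prod 𝓘(ℝ, Eucl n →L[ℝ] ℝ)) 𝓘(ℝ, ℝ) ∞ Ham)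
    (hHam' : ∀ (g : G) (α : Cotangent 𝓘(ℝ, Eucl n) Q),
      Ham (cotangentLift 𝓘(ℝ, Eucl n) (fun q => g • q) α) = Ham α) :
    IsStratonovichOperator (CotangentFrameModel n) 𝓘(ℝ, NoiseSpace n) (stratonovichOp cov Ham) ∧
    (∀ (h : OrthGroup n × G) (η : CotangentFrame n Q) (y : NoiseSpace n)
      (y' : TangentSpace 𝓘(ℝ, NoiseSpace n) y),
      stratonovichOp cov Ham (cotangentAct hG h η) (noiseAct h y)
          (mfderiv 𝓘(ℝ, NoiseSpace n) 𝓘(ℝ, NoiseSpace n) (noiseAct h) y y') =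
        mfderiv (CotangentFrameModel n) (CotangentFrameModel n) (cotangentAct hG h) η
          (stratonovichOp cov Ham η y y')) ∧
    ∀ l : GroupLieAlgebra 𝓘(ℝ, EG) G →L[ℝ] ℝ,
      RestrictsTo (CotangentFrameModel n) 𝓘(ℝ, NoiseSpace n) (stratonovichOp cov Ham)
        (momentumLevel hG (coadjointOrbit EG l)) ∧
      ∀ ζ ∈ momentumLevel hG (coadjointOrbit EG l),
        RestrictsTo (CotangentFrameModel n) 𝓘(ℝ, NoiseSpace n) (stratonovichOp cov Ham)
          (orbitTypePiece hG (coadjointOrbit EG l) ζ) ∧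
        RestrictsTo (CotangentFrameModel n) 𝓘(ℝ, NoiseSpace n) (stratonovichOp cov Ham)
          (connectedComponentIn (orbitTypePiece hG (coadjointOrbit EG l) ζ) ζ) := by
  have hs : ∀ g : G, ContMDiff 𝓘(ℝ, Eucl n) 𝓘(ℝ, Eucl n) ∞ (fun q : Q => g • q) :=
    contMDiff_smul_left (EG := EG) ContMDiffSMul.contMDiff_smul
  refine ⟨isStratonovichOperator_stratonovichOp hcov hHam,
    stratonovichOp_equivariant hG hcov hHam hs hHam', fun l => ?_⟩
  have h0 : ∀ ε : ℝ, 0 < ε → (0 : ℝ) ∈ Set.Ioo (-ε) ε := fun ε hε => ⟨neg_lt_zero.2 hε, hε⟩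
  have hlevel : ∀ (v : NoiseSpace n) (γ : ℝ → CotangentFrame n Q) (ε : ℝ), 0 < ε →
      IsMIntegralCurveOn γ (hamiltonianVectorField 𝓘(ℝ, FrameModel n)
        (noiseHamiltonian cov Ham v)) (Set.Ioo (-ε) ε) →
      γ 0 ∈ momentumLevel hG (coadjointOrbit EG l) →
      ∀ t ∈ Set.Ioo (-ε) ε, γ t ∈ momentumLevel hG (coadjointOrbit EG l) := by
    intro v γ ε hε hγ h t ht
    change momentumMap hG (γ t) ∈ coadjointOrbit EG l
    rw [momentumMap_eq_of_isMIntegralCurveOn hG hcov hHam hHam' v hγ ht (h0 ε hε)]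
    exact h
  refine ⟨(restrictsTo_of_invariant hcov hHam hlevel).1, fun ζ _ => ?_⟩
  have hpiece := restrictsTo_of_invariant hcov hHam
    (Z := orbitTypePiece hG (coadjointOrbit EG l) ζ) fun v γ ε hε hγ h t ht =>
      ⟨hlevel v γ ε hε hγ h.1 t ht, by
        obtain ⟨a, ha⟩ := h.2
        refine ⟨a, fun g => Iff.trans ⟨fun hg => ?_, fun hg => ?_⟩ (ha g)⟩
        · exact cotangentAct_eq_of_isMIntegralCurveOn hG hcov hHam hHam' hs v hγ ht (h0 ε hε) hg
        · exact cotangentAct_eq_of_isMIntegralCurveOn hG hcov hHam hHam' hs v hγ (h0 ε hε) ht hg⟩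
  exact ⟨hpiece.1, hpiece.2 ζ⟩
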